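/- Let $N=(G,\sigma)$ be a synchronous network of $n\ge 2$ parties, i.e. a connected undirected graph $G=(V,E)$ with $|V|=n$, together with a port numbering $\sigma$ (for each $v$, a bijection $\sigma[v]$ from the edges at $v$ to $\{1,\dots,\deg v\}$), and let $X:V\to\mathbb Z$ be a labelling of the parties. Let $D$ be the maximum degree. The view $T_X(v)$ is the infinite rooted tree whose nodes are the walks of $G$ starting at $v$, the children of a walk being its one-edge extensions; a walk ending at $w$ has label $X(w)$, and the tree edge that corresponds to a step from $w$ to $w'$ has label $(\sigma[w](w,w'),\sigma[w'](w,w'))$. $T^h_X(v)$ is its part of depth at most $h$. The merging operation takes two nodes of the same depth with the same label and the same outgoing edges (same edge labels, same destinations), removes one of them with its outgoing edges, and redirects its incoming edges to the other. A minimal folded view $\widetilde T^h_X(v)$ is a rooted labelled directed acyclic multigraph obtained from $T^h_X(v)$ by merging operations until none applies. $\Gamma_X$ is the set of the views $T_X(v)$, $v\in V$, up to isomorphism, and $\Gamma_X(S)$ the set of those with root label in $S$. All parties run the same deterministic program; time is counted in elementary operations of a while-program on binary trees (list cells) in which numbers are written in binary, and in each round a party computes locally and then sends one bit string through each of its ports.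 (1) There is a program that, given to each party $v$ only $h$, $\deg v$ and $X(v)$, makes every party $v$ halt with an explicit representation of $\widetilde T^h_X(v)$ as output, such that for every fixed $b$, whenever all labels satisfy $|X(v)|<2^b$, and for all $n\ge 2$ and $h\ge 1$, it uses $O(D^2h^2n(\log n)^2)$ time for each party, $O(h)$ rounds, and $O(D|E|h^2n\max(1,\log D))$ bits of classical communication in total; the implied constants depend only on $b$. (2) There is a program that, given $n$, a finite set $S\subset\mathbb Z$ and any such representation of $\widetilde T^{2(n-1)}_X(v)$, computes $|\Gamma_X|$ and $|\Gamma_X(S)|$ without communication, such that for every fixed $b$, whenever all labels and all elements of $S$ have absolute value less than $2^b$, it takes $O(Dn^5\log n)$ time, where the implied constant depends only on $b$. (3) There is an absolute constant $C$ such that, for every $n\ge1$, every Boolean function $f:\{0,1\}^n\to\{0,1\}$ and every set $K$ of networks on the parties $1,\dots,n$: if some program computes $f$ on $K$ (for all networks in $K$ and all inputs $x$, every party $l$, given only $n$, its degree and its bit $x_l$, halts with output $f(x)$), then some program computes $f$ on $K$ in at most $Cn$ rounds with at most $Cn^6\log n$ bits of communication in total. -/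

import Mathlib

/-! ### Rooted labelled directed multigraphs, the merging operation, folded views -/

/-- A rooted directed multigraph with node labels in `α` and edge labels in `β`;
`edge u x w` says that there is an edge from `u` to `w` with label `x`. -/
structure RootedGraph (α β : Type) where
  Node : Type
  root : Node
  label : Node → α
  edge : Node → β → Node → Prop

namespace RootedGraph

variable {α β : Type}

/-- Isomorphism of rooted graphs, respecting node labels and edge labels. -/
def Iso (A B : RootedGraph α β) : Prop :=
  ∃ φ : A.Node ≃ B.Node, φ A.root = B.root ∧ (∀ u, B.label (φ u) = A.label u) ∧
    ∀ u x w, B.edge (φ u) x (φ w) ↔ A.edge u x w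

theorem Iso.refl (A : RootedGraph α β) : Iso A A :=
  ⟨Equiv.refl _, rfl, fun _ => rfl, fun _ _ _ => Iff.rfl⟩

theorem Iso.symm {A B : RootedGraph α β} (h : Iso A B) : Iso B A := by
  obtain ⟨φ, h1, h2, h3⟩ := h
  refine ⟨φ.symm, by simp [← h1], fun u => ?_, fun u x w => ?_⟩
  · simpa using (h2 (φ.symm u)).symm
  · simpa using (h3 (φ.symm u) x (φ.symm w)).symm

theorem Iso.trans {A B C : RootedGraph α β} (h : Iso A B) (h' : Iso B C) : Iso A C := by
  obtain ⟨φ, h1, h2, h3⟩ := h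
  obtain ⟨ψ, k1, k2, k3⟩ := h'
  exact ⟨φ.trans ψ, by simp [h1, k1], fun u => by simp [h2, k2], fun u x w => by simp [h3, k3]⟩

instance isoSetoid (α β : Type) : Setoid (RootedGraph α β) where
  r := Iso
  iseqv := ⟨Iso.refl, Iso.symm, Iso.trans⟩

/-- `A.HasDepth u k`: there is a directed path of length `k` from the root to `u`. -/
inductive HasDepth (A : RootedGraph α β) : A.Node → ℕ → Prop
  | root : HasDepth A A.root 0
  | step {u w : A.Node} {x : β} {k : ℕ} :
      HasDepth A u k → A.edge u x w → HasDepth A w (k + 1)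

/-- Two distinct nodes may be merged if they have the same depth, the same label, and the same
outgoing edges (same edge labels, same destinations). -/
def Mergeable (A : RootedGraph α β) (u u' : A.Node) : Prop :=
  u ≠ u' ∧ (∃ k, A.HasDepth u k ∧ A.HasDepth u' k) ∧ A.label u = A.label u' ∧
    ∀ x w, A.edge u x w ↔ A.edge u' x w

/-- The merging operation: eliminate `u'` and its outgoing edges, and redirect every edge into
`u'` to `u`. -/
def merge (A : RootedGraph α β) (u u' : A.Node) (hr : A.root ≠ u') : RootedGraph α β where
  Node := {w : A.Node // w ≠ u'}
  root := ⟨A.root, hr⟩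
  label w := A.label w
  edge a x c := A.edge a x c ∨ (A.edge a x u' ∧ (c : A.Node) = u)

/-- The folded views of `A`: everything obtained from `A` by merging operations. -/
inductive IsFoldedView (A : RootedGraph α β) : RootedGraph α β → Prop
  | refl : IsFoldedView A A
  | step {B : RootedGraph α β} (hB : IsFoldedView A B) (u u' : B.Node)
      (h : B.Mergeable u u') (hr : B.root ≠ u') : IsFoldedView A (B.merge u u' hr)

/-- A minimal folded view: one to which no further merging operation applies. -/
def IsMinimalFoldedView (A B : RootedGraph α β) : Prop :=
  A.IsFoldedView B ∧ ∀ u u', ¬ B.Mergeable u u'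

end RootedGraph

/-! ### Anonymous networks and views -/

/-- A network of `n` parties: a connected undirected graph with a port numbering. The ports of
party `v` are numbered `0, …, deg v - 1`. -/
structure Network (n : ℕ) where
  graph : SimpleGraph (Fin n)
  connected : graph.Connected
  deg : Fin n → ℕ
  port : (v : Fin n) → graph.neighborSet v ≃ Fin (deg v)

namespace Network

variable {n : ℕ} (N : Network n)

/-- The maximum degree. -/
def maxDeg : ℕ := Finset.univ.sup N.deg

/-- The number of edges. -/
noncomputable def numEdges : ℕ := N.graph.edgeSet.ncard

/-- The number of the port of `v` that leads to its neighbour `w`. -/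
def portTo {v w : Fin n} (h : N.graph.Adj v w) : Fin (N.deg v) := N.port v ⟨w, h⟩

/-- The neighbour of `v` reached through port `i`. -/
def nbr (v : Fin n) (i : Fin (N.deg v)) : Fin n := ((N.port v).symm i : Fin n)

theorem adj_nbr (v : Fin n) (i : Fin (N.deg v)) : N.graph.Adj v (N.nbr v i) :=
  ((N.port v).symm i).2

/-- The number of the port of `N.nbr v i` at the other end of the link at port `i` of `v`. -/
def backPort (v : Fin n) (i : Fin (N.deg v)) : Fin (N.deg (N.nbr v i)) :=
  N.portTo (N.adj_nbr v i).symm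

/-- The label of the directed edge `(v, w)`: the port number at `v` and the port number at `w`. -/
def edgeLabel {v w : Fin n} (h : N.graph.Adj v w) : ℕ × ℕ :=
  (N.portTo h, N.portTo h.symm)

/-- The (infinite) view of party `v`, for node labels `X`: its nodes are the walks that start
at `v`, and the children of a walk are its extensions by one edge. -/
def view (X : Fin n → ℤ) (v : Fin n) : RootedGraph ℤ (ℕ × ℕ) where
  Node := Σ w : Fin n, N.graph.Walk v w
  root := ⟨v, SimpleGraph.Walk.nil⟩
  label p := X p.1
  edge p x q := ∃ h : N.graph.Adj p.1 q.1, q.2 = p.2.concat h ∧ x = N.edgeLabel h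

/-- The view of depth `h` of party `v`: the part of the view within depth `h`. -/
def viewUpTo (X : Fin n → ℤ) (h : ℕ) (v : Fin n) : RootedGraph ℤ (ℕ × ℕ) where
  Node := {p : Σ w : Fin n, N.graph.Walk v w // p.2.length ≤ h}
  root := ⟨⟨v, SimpleGraph.Walk.nil⟩, Nat.zero_le h⟩
  label p := X p.1.1
  edge p x q := (N.view X v).edge p.1 x q.1

/-- `Γ_X`: the set of views of all parties, up to isomorphism. -/
def views (X : Fin n → ℤ) : Set (Quotient (RootedGraph.isoSetoid ℤ (ℕ × ℕ))) :=
  {t | ∃ v, t = ⟦N.view X v⟧}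

/-- `Γ_X(S)`: the set of views in `Γ_X` whose root is labelled with a value in `S`. -/
def viewsIn (X : Fin n → ℤ) (S : Finset ℤ) : Set (Quotient (RootedGraph.isoSetoid ℤ (ℕ × ℕ))) :=
  {t | ∃ v, X v ∈ S ∧ t = ⟦N.view X v⟧}

end Network

/-! ### The machine model: while-programs over binary trees, with unit cost per operation -/

/-- Data are binary trees (list cells). -/
inductive Data : Type
  | nil : Data
  | cons : Data → Data → Data

namespace Data

def hd : Data → Data
  | nil => nil
  | cons a _ => a

def tl : Data → Data
  | nil => nil
  | cons _ b => b

/-- A tree read as the list of the entries along its right spine. -/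
def toList : Data → List Data
  | nil => []
  | cons a b => a :: b.toList

/-- A tree read as a truth value: a cell is true. -/
def toBool : Data → Bool
  | nil => false
  | cons _ _ => true

/-- A tree read as a bit string. -/
def toBits (t : Data) : List Bool := t.toList.map toBool

def ofBool : Bool → Data
  | false => nil
  | true => cons nil nil

def ofList : List Data → Data
  | [] => nil
  | a :: l => cons a (ofList l)

def ofBits (l : List Bool) : Data := ofList (l.map ofBool)

/-- Natural numbers are written in binary, least significant bit first. -/
def ofNat (k : ℕ) : Data := ofBits k.bits

/-- Integers: a sign bit and the absolute value. -/
def ofInt (z : ℤ) : Data := cons (ofBool (decide (z < 0))) (ofNat z.natAbs)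

end Data

/-- Expressions; evaluating one costs one unit for each operation in it. -/
inductive Expr : Type
  | var : ℕ → Expr
  | nil : Expr
  | cons : Expr → Expr → Expr
  | hd : Expr → Expr
  | tl : Expr → Expr

/-- A store assigns a tree to each variable. -/
abbrev Store : Type := ℕ → Data

namespace Expr

def eval (s : Store) : Expr → Data
  | var x => s x
  | nil => Data.nil
  | cons e f => Data.cons (e.eval s) (f.eval s)
  | hd e => (e.eval s).hd
  | tl e => (e.eval s).tl

def cost : Expr → ℕ
  | var _ => 1
  | nil => 1
  | cons e f => e.cost + f.cost + 1
  | hd e => e.cost + 1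
  | tl e => e.cost + 1

end Expr

/-- Programs. Tests only check whether a tree is a cell. -/
inductive Program : Type
  | skip : Program
  | assign : ℕ → Expr → Program
  | seq : Program → Program → Program
  | cond : Expr → Program → Program → Program
  | loop : Expr → Program → Program

/-- `Exec p s s' t`: started in store `s`, program `p` halts in store `s'` after `t` steps. -/
inductive Exec : Program → Store → Store → ℕ → Prop
  | skip (s : Store) : Exec .skip s s 1
  | assign (x : ℕ) (e : Expr) (s : Store) :
      Exec (.assign x e) s (Function.update s x (e.eval s)) (e.cost + 1)
  | seq {p q : Program} {s s' s'' : Store} {t t' : ℕ} :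
      Exec p s s' t → Exec q s' s'' t' → Exec (.seq p q) s s'' (t + t')
  | condTrue {e : Expr} {p q : Program} {s s' : Store} {t : ℕ} :
      e.eval s ≠ Data.nil → Exec p s s' t → Exec (.cond e p q) s s' (e.cost + 1 + t)
  | condFalse {e : Expr} {p q : Program} {s s' : Store} {t : ℕ} :
      e.eval s = Data.nil → Exec q s s' t → Exec (.cond e p q) s s' (e.cost + 1 + t)
  | loopStop {e : Expr} {p : Program} {s : Store} :
      e.eval s = Data.nil → Exec (.loop e p) s s (e.cost + 1)
  | loopStep {e : Expr} {p : Program} {s s' s'' : Store} {t t' : ℕ} :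
      e.eval s ≠ Data.nil → Exec p s s' t → Exec (.loop e p) s' s'' t' →
        Exec (.loop e p) s s'' (e.cost + 1 + t + t')

namespace Store

/-- The store in which variable `0` holds the input and all other variables are `nil`. -/
def start (input : Data) : Store := Function.update (fun _ => Data.nil) 0 input

/-- Variable `1` holds the received messages, in the order of the ports. -/
def withInbox (s : Store) (msgs : List (List Bool)) : Store :=
  Function.update s 1 (Data.ofList (msgs.map Data.ofBits))

/-- Variable `2` holds the messages to be sent, in the order of the ports; it is emptied when
they are sent. -/
def outgoing (s : Store) (i : ℕ) : List Bool := ((s 2).toList.getD i Data.nil).toBits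

def clearOutbox (s : Store) : Store := Function.update s 2 Data.nil

/-- Variable `3` holds the output. -/
def output (s : Store) : Data := s 3

/-- A party has halted when variable `4` is not `nil`. -/
def Halted (s : Store) : Prop := s 4 ≠ Data.nil

end Store

/-! ### Synchronous anonymous execution of a program on a network -/

namespace Network

variable {n : ℕ} (N : Network n)

/-- What a party does in a round: it runs the program on its store, which holds the messages
received; a party that has halted does nothing, and sends nothing. -/
def LocalStep (p : Program) (s s' : Store) (t : ℕ) : Prop :=
  (s.Halted ∧ s' = s.clearOutbox ∧ t = 0) ∨ (¬ s.Halted ∧ Exec p s s' t)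

/-- The stores after the messages have been delivered: the message that a party receives through
port `i` is the one that its neighbour there put at its own end of that link. -/
def deliver (s : Fin n → Store) (v : Fin n) : Store :=
  ((s v).withInbox
    (List.ofFn fun i : Fin (N.deg v) => (s (N.nbr v i)).outgoing (N.backPort v i))).clearOutbox

/-- The number of bits sent by all parties. -/
def bitsSent (s : Fin n → Store) : ℕ :=
  ∑ v, ∑ i : Fin (N.deg v), ((s v).outgoing i).length

/-- `N.Run p s r s' T B`: when all parties run the same program `p`, from stores `s`, then after
`r` rounds the stores are `s'`, party `v` has used `T v` steps of local computation,
and `B` bits have been sent in total. -/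
inductive Run (p : Program) (s : Fin n → Store) :
    ℕ → (Fin n → Store) → (Fin n → ℕ) → ℕ → Prop
  | zero : Run p s 0 s (fun _ => 0) 0
  | succ {r : ℕ} {s₁ s₂ : Fin n → Store} {T t : Fin n → ℕ} {B : ℕ} :
      Run p s r s₁ T B → (∀ v, LocalStep p (s₁ v) (s₂ v) (t v)) →
        Run p s (r + 1) (N.deliver s₂) (fun v => T v + t v) (B + N.bitsSent s₂)

/-- Program `p`, each party knowing the number `n` of parties, the number of its own ports, and
its own input bit, halts after `r` rounds and `B` bits of communication, with every party
having the output bit `y`. -/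
def Outputs (p : Program) (x : Fin n → Bool) (y : Bool) (r B : ℕ) : Prop :=
  ∃ s T, N.Run p (fun v => Store.start (Data.ofList
      [Data.ofNat n, Data.ofNat (N.deg v), Data.ofBool (x v)])) r s T B ∧
    ∀ v, (s v).Halted ∧ (s v).output = Data.ofBool y

end Network

/-! ### Explicit representation of folded views -/

/-- A graph in levels: level `j` lists the nodes of depth `j`; a node is given by its label and by
the list of its outgoing edges, each with its label and with the position of its destination
in the next level. -/
abbrev LevelList : Type := List (List (ℤ × List ((ℕ × ℕ) × ℕ)))

namespace LevelList

/-- `c` represents the rooted graph `A`, whose node `u` is listed at position `(φ u).2` of level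
`(φ u).1`. The outgoing edges of a node are listed in the order of the port numbers. -/
def Represents (c : LevelList) (A : RootedGraph ℤ (ℕ × ℕ)) : Prop :=
  [] ∉ c ∧ ∃ φ : A.Node → ℕ × ℕ,
    Function.Injective φ ∧
    (∀ j k, (∃ u, φ u = (j, k)) ↔ k < (c.getD j []).length) ∧
    φ A.root = (0, 0) ∧
    ∀ u, ∃ es : List ((ℕ × ℕ) × ℕ),
      (c.getD (φ u).1 [])[(φ u).2]? = some (A.label u, es) ∧
      es.map (fun e => e.1.1) = List.range es.length ∧
      (∀ x q, (x, q) ∈ es ↔ ∃ w, A.edge u x w ∧ φ w = ((φ u).1 + 1, q)) ∧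
      ∀ x w, A.edge u x w → (φ w).1 = (φ u).1 + 1

def encodeEdge (e : (ℕ × ℕ) × ℕ) : Data :=
  Data.ofList [Data.ofNat e.1.1, Data.ofNat e.1.2, Data.ofNat e.2]

def encodeNode (a : ℤ × List ((ℕ × ℕ) × ℕ)) : Data :=
  Data.cons (Data.ofInt a.1) (Data.ofList (a.2.map encodeEdge))

def encode (c : LevelList) : Data :=
  Data.ofList (c.map fun l => Data.ofList (l.map encodeNode))

end LevelList

/-! Views are replaced throughout by finite trees (`unfoldTree`): `viewTree` keeps the labels of the
leaves, `preTree` drops them. A fold map sends two nodes of depth `j` of the view of depth `h` to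
the same node only if the trees of depth `h - j` below them coincide (`IsFoldMap.viewTree_eq`). In a
minimal folded view the converse holds as well (`IsFoldMap.eq_of_viewTree_eq`). A minimal folded
view is therefore canonical: its level `j` consists of the distinct subtrees found there. `IsLayout`
states this for level lists in terms of walks. Partition refinement (`unfoldTree_stable`) shows that
the classes of parties under equality of depth `d` trees grow in number with `d` until they never
change again. So trees of depth `n - 1` decide isomorphism of views, and trees of depth `n + n' - 1`
decide it for parties of two networks.

Construction. After `k` rounds a party holds its tree of depth `k` in hash-consed form, in a table
that contains every tree once, given by its label and the names of its subtrees. In a round it sends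
through each port the entries that are new, together with the name of its present tree. The receiver
translates foreign names into its own. At most `(h + 1) n` distinct trees occur, and each passes a
given port once (`sum_fresh_le`). A table has at most `(D + 2) ^ h` entries
(`length_tables_le_pow`), so names have `O(h max(1, log D))` bits and entries consist of `O(D)`
names. This gives the communication bound (`Fits.sum_message_le`) and the running time
(`Fits.sum_roundCost_le`). A breadth-first listing of the names turns the table into a level list
(`Naming.exists_isLayout`).

Counting. On the folded view of depth `2 (n - 1)` the nodes are classified by trees of depth `0, 1,
2, …`. Each refinement loses the deepest level still classified. After `n - 1` refinements the
levels `0, …, n - 1` remain. Every party occurs there, because it is joined to `v` by a walk of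
fewer than `n` edges; the classes are then the views (`IsLayout.round`, `IsLayout.countViews`).

Boolean functions. Parties with the same views behave alike under any deterministic program
(`Run.sameViews`), so a computable `f` factors through the folded view of depth `2 n + 1`. For fixed
`n` there are finitely many networks and inputs. The values of `f` are put into a table indexed by
encoded folded views, and this table is built into the program.

Programs are never written out as a whole. `Impl f T` says that `f` is computable within time `O(T +
1)`, and it is closed under composition, pairing, branching, folds and loops. Copying a tree is one
assignment, and finite maps are tries addressed by serialised trees, so a lookup costs the size of
the key. -/

/-! ### Functions on encoded values, computed by while-programs -/

/-- Types whose values are written as trees. -/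
class Enc (α : Type) where
  enc : α → Data

open Enc

instance : Enc Data := ⟨id⟩
instance : Enc Bool := ⟨Data.ofBool⟩
instance : Enc Unit := ⟨fun _ => Data.nil⟩
instance : Enc ℕ := ⟨Data.ofNat⟩
instance : Enc ℤ := ⟨Data.ofInt⟩
instance {α β : Type} [Enc α] [Enc β] : Enc (α × β) := ⟨fun p => Data.cons (enc p.1) (enc p.2)⟩
instance {α : Type} [Enc α] : Enc (List α) := ⟨fun l => Data.ofList (l.map enc)⟩

section Enc
variable {α β : Type} [Enc α] [Enc β]

theorem enc_data (d : Data) : enc d = d := rfl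
theorem enc_pair (a : α) (b : β) : enc (a, b) = Data.cons (enc a) (enc b) := rfl
theorem enc_nil : enc ([] : List α) = Data.nil := rfl
theorem enc_cons (a : α) (l : List α) : enc (a :: l) = Data.cons (enc a) (enc l) := rfl
theorem enc_true : enc true = Data.cons Data.nil Data.nil := rfl
theorem enc_false : enc false = Data.nil := rfl

end Enc

theorem Data.toList_ofList (l : List Data) : (Data.ofList l).toList = l := by
  induction l with
  | nil => rfl
  | cons a l ih => simp [Data.ofList, Data.toList, ih]

theorem Data.toBool_ofBool (b : Bool) : (Data.ofBool b).toBool = b := by cases b <;> rfl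

theorem Data.toBits_ofBits (l : List Bool) : (Data.ofBits l).toBits = l := by
  simp [Data.toBits, Data.ofBits, Data.toList_ofList, Function.comp_def, Data.toBool_ofBool]

/-- `Impl f T`: there is a program that computes `f` in place, with stack discipline, within
time `O(T + 1)`. -/
def Impl {α β : Type} [Enc α] [Enc β] (f : α → β) (T : α → ℕ) : Prop :=
  ∃ C : ℕ, ∀ k : ℕ, ∃ p : Program, ∀ (s : Store) (a : α), s k = enc a →
    ∃ s' t, Exec p s s' t ∧ t ≤ C * (T a + 1) ∧ s' k = enc (f a) ∧ ∀ i < k, s' i = s i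

namespace Impl

variable {α β γ δ σ τ ε : Type} [Enc α] [Enc β] [Enc γ] [Enc δ] [Enc σ] [Enc τ] [Enc ε]

theorem mono' {f : α → β} {T T' : α → ℕ} (h : Impl f T) (c : ℕ)
    (hT : ∀ a, T a ≤ c * (T' a + 1)) : Impl f T' := by
  obtain ⟨C, h⟩ := h
  refine ⟨C * (c + 1), fun k => ?_⟩
  obtain ⟨p, h⟩ := h k
  refine ⟨p, fun s a hs => ?_⟩
  obtain ⟨s', t, h1, h2, h3⟩ := h s a hs
  refine ⟨s', t, h1, h2.trans ?_, h3⟩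
  rw [mul_assoc]
  refine Nat.mul_le_mul_left _ ?_
  have := hT a
  nlinarith

theorem mono {f : α → β} {T T' : α → ℕ} (h : Impl f T) (hT : ∀ a, T a ≤ T' a) : Impl f T' :=
  h.mono' 1 fun a => by have := hT a; omega

/-- Programs see encodings only, so agreement after encoding is enough. -/
theorem congr {f g : α → β} {T : α → ℕ} (h : Impl f T) (hfg : ∀ a, enc (g a) = enc (f a)) :
    Impl g T := by
  obtain ⟨C, h⟩ := h
  refine ⟨C, fun k => ?_⟩
  obtain ⟨p, h⟩ := h k
  refine ⟨p, fun s a hs => ?_⟩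
  rw [hfg]
  exact h s a hs

theorem of_expr {f : α → β} (e : ℕ → Expr) (c : ℕ) (hc : ∀ k, (e k).cost ≤ c)
    (he : ∀ k (s : Store) a, s k = enc a → (e k).eval s = enc (f a)) : Impl f (fun _ => 0) := by
  refine ⟨c + 1, fun k => ⟨.assign k (e k), fun s a hs => ⟨_, _, Exec.assign _ _ _, ?_, ?_, ?_⟩⟩⟩
  · have := hc k
    simp only [zero_add, mul_one]
    omega
  · simp [he k s a hs]
  · intro i hi
    rw [Function.update_of_ne (by omega)]

/-- A mere change of type; it lets the same tree be read as a number, a bit list or a raw tree at no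
cost. -/
theorem cast {f : α → β} (h : ∀ a, enc (f a) = enc a) : Impl f (fun _ => 0) :=
  of_expr (fun k => .var k) 1 (fun _ => le_rfl) fun k s a hs => by rw [h, ← hs]; rfl

theorem id : Impl (fun a : α => a) (fun _ => 0) := cast fun _ => rfl

/-- An expression for a fixed tree. -/
def constExpr : Data → Expr
  | .nil => .nil
  | .cons a b => .cons (constExpr a) (constExpr b)

theorem eval_constExpr (s : Store) (d : Data) : (constExpr d).eval s = d := by
  induction d with
  | nil => rfl
  | cons a b iha ihb => simp [constExpr, Expr.eval, iha, ihb]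

theorem const (b : β) : Impl (fun _ : α => b) (fun _ => 0) :=
  of_expr (fun _ => constExpr (enc b)) _ (fun _ => le_rfl) fun _ s _ _ => eval_constExpr s _

theorem fst : Impl (fun p : α × β => p.1) (fun _ => 0) :=
  of_expr (fun k => .hd (.var k)) 2 (fun _ => le_rfl) fun k s a hs => by
    simp only [Expr.eval, hs]; rfl

theorem snd : Impl (fun p : α × β => p.2) (fun _ => 0) :=
  of_expr (fun k => .tl (.var k)) 2 (fun _ => le_rfl) fun k s a hs => by
    simp only [Expr.eval, hs]; rfl

theorem hd : Impl Data.hd (fun _ => 0) :=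
  of_expr (fun k => .hd (.var k)) 2 (fun _ => le_rfl) fun k s a hs => by
    simp only [Expr.eval, hs]; rfl

theorem tl : Impl Data.tl (fun _ => 0) :=
  of_expr (fun k => .tl (.var k)) 2 (fun _ => le_rfl) fun k s a hs => by
    simp only [Expr.eval, hs]; rfl

theorem tail : Impl (List.tail : List α → List α) (fun _ => 0) :=
  of_expr (fun k => .tl (.var k)) 2 (fun _ => le_rfl) fun k s a hs => by
    simp only [Expr.eval, hs]; cases a <;> rfl

theorem comp {g : β → γ} {f : α → β} {Tg : β → ℕ} {Tf : α → ℕ} (hg : Impl g Tg)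
    (hf : Impl f Tf) : Impl (fun a => g (f a)) (fun a => Tf a + Tg (f a)) := by
  obtain ⟨C, hg⟩ := hg
  obtain ⟨C', hf⟩ := hf
  refine ⟨C + C', fun k => ?_⟩
  obtain ⟨p, hp⟩ := hf k
  obtain ⟨q, hq⟩ := hg k
  refine ⟨.seq p q, fun s a hs => ?_⟩
  obtain ⟨s', t, h1, h2, h3, h4⟩ := hp s a hs
  obtain ⟨s'', t', k1, k2, k3, k4⟩ := hq s' (f a) h3
  refine ⟨s'', _, Exec.seq h1 k1, ?_, k3, fun i hi => (k4 i hi).trans (h4 i hi)⟩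
  nlinarith [Nat.zero_le (C * Tf a), Nat.zero_le (C' * Tg (f a))]

theorem pair {f : α → β} {g : α → γ} {Tf Tg : α → ℕ} (hf : Impl f Tf) (hg : Impl g Tg) :
    Impl (fun a => (f a, g a)) (fun a => Tf a + Tg a) := by
  obtain ⟨C, hf⟩ := hf
  obtain ⟨C', hg⟩ := hg
  refine ⟨C + C' + 8, fun k => ?_⟩
  obtain ⟨p, hp⟩ := hf (k + 1)
  obtain ⟨q, hq⟩ := hg (k + 2)
  -- `f` runs at `k + 1` and `g` at `k + 2`, each on a copy of the input. The stack discipline keeps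
  -- `g` away from the result of `f`, and `f` away from the input.
  refine ⟨.seq (.assign (k + 1) (.var k)) (.seq p (.seq (.assign (k + 2) (.var k)) (.seq q
    (.assign k (.cons (.var (k + 1)) (.var (k + 2))))))), fun s a hs => ?_⟩
  obtain ⟨s', t, h1, h2, h3, h4⟩ := hp (Function.update s (k + 1) (s k)) a (by simp [hs])
  have hk : s' k = s k := by
    rw [h4 k (by omega), Function.update_of_ne (by omega)]
  obtain ⟨s'', t', k1, k2, k3, k4⟩ := hq (Function.update s' (k + 2) (s' k)) a (by simp [hk, hs])
  have hk1 : s'' (k + 1) = enc (f a) := by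
    rw [k4 (k + 1) (by omega), Function.update_of_ne (by omega), h3]
  refine ⟨_, _, Exec.seq (Exec.assign _ _ _) (Exec.seq h1 (Exec.seq (Exec.assign _ _ _)
    (Exec.seq k1 (Exec.assign _ _ _)))), ?_, ?_, ?_⟩
  · simp only [Expr.cost]
    nlinarith [Nat.zero_le (C * Tg a), Nat.zero_le (C' * Tf a)]
  · simp [Expr.eval, hk1, k3, enc_pair]
  · intro i hi
    rw [Function.update_of_ne (by omega), k4 i (by omega), Function.update_of_ne (by omega),
      h4 i (by omega), Function.update_of_ne (by omega)]

theorem ite {c : α → Bool} {f g : α → β} {Tc Tf Tg : α → ℕ} (hc : Impl c Tc) (hf : Impl f Tf)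
    (hg : Impl g Tg) :
    Impl (fun a => if c a then f a else g a)
      (fun a => Tc a + if c a then Tf a else Tg a) := by
  obtain ⟨C₀, hc⟩ := hc
  obtain ⟨C, hf⟩ := hf
  obtain ⟨C', hg⟩ := hg
  refine ⟨C₀ + C + C' + 4, fun k => ?_⟩
  obtain ⟨r, hr⟩ := hc (k + 1)
  obtain ⟨p, hp⟩ := hf k
  obtain ⟨q, hq⟩ := hg k
  refine ⟨.seq (.assign (k + 1) (.var k)) (.seq r (.cond (.var (k + 1)) p q)), fun s a hs => ?_⟩
  obtain ⟨s', t, h1, h2, h3, h4⟩ := hr (Function.update s (k + 1) (s k)) a (by simp [hs])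
  have hk : s' k = s k := by
    rw [h4 k (by omega), Function.update_of_ne (by omega)]
  have hlt : ∀ i < k, s' i = s i := fun i hi => by
    rw [h4 i (by omega), Function.update_of_ne (by omega)]
  by_cases hca : c a = true
  · obtain ⟨s'', t', k1, k2, k3, k4⟩ := hp s' a (by rw [hk, hs])
    refine ⟨s'', _, Exec.seq (Exec.assign _ _ _) (Exec.seq h1 (Exec.condTrue ?_ k1)), ?_, ?_,
      fun i hi => (k4 i hi).trans (hlt i hi)⟩
    · simp [Expr.eval, h3, hca, enc_true]
    · simp only [Expr.cost, hca, if_true]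
      nlinarith [Nat.zero_le (C * Tc a), Nat.zero_le (C' * Tc a), Nat.zero_le (C₀ * Tf a),
        Nat.zero_le (C' * Tf a)]
    · simp [hca, k3]
  · obtain ⟨s'', t', k1, k2, k3, k4⟩ := hq s' a (by rw [hk, hs])
    refine ⟨s'', _, Exec.seq (Exec.assign _ _ _) (Exec.seq h1 (Exec.condFalse ?_ k1)), ?_, ?_,
      fun i hi => (k4 i hi).trans (hlt i hi)⟩
    · simp only [Bool.not_eq_true] at hca
      simp [Expr.eval, h3, hca, enc_false]
    · simp only [Expr.cost, hca, if_false, Bool.false_eq_true]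
      nlinarith [Nat.zero_le (C * Tc a), Nat.zero_le (C' * Tc a), Nat.zero_le (C₀ * Tg a),
        Nat.zero_le (C * Tg a)]
    · simp [hca, k3]

/-- Repeating a step until a work list is empty. -/
theorem loop {step : (α × List α) × τ → List α × τ} {T : (α × List α) × τ → ℕ}
    (hstep : Impl step T) (F : List α × τ → τ) (N : List α × τ → ℕ) (h0 : ∀ t, F ([], t) = t)
    (h1 : ∀ a l t, F (a :: l, t) = F (step ((a, l), t)))
    (hN : ∀ a l t, T ((a, l), t) + 1 + N (step ((a, l), t)) ≤ N (a :: l, t)) : Impl F N := by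
  obtain ⟨C, hstep⟩ := hstep
  refine ⟨C + 8, fun k => ?_⟩
  obtain ⟨p, hp⟩ := hstep k
  -- `N` is a potential that drops by more than the cost of each step, so induction on a bound for
  -- it gives termination and the time at once. The summand `3` is the last, failing test.
  have key : ∀ n : ℕ, ∀ (s : Store) (l : List α) (t : τ), N (l, t) ≤ n → s k = enc (l, t) →
      ∃ s' m, Exec (.loop (.hd (.var k)) p) s s' m ∧ m ≤ (C + 8) * (N (l, t)) + 3 ∧
        s' k = enc (([] : List α), F (l, t)) ∧ ∀ i < k, s' i = s i := by
    intro n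
    induction n with
    | zero =>
      intro s l t hn hs
      cases l with
      | nil =>
        refine ⟨s, _, Exec.loopStop ?_, ?_, ?_, fun _ _ => rfl⟩
        · simp [Expr.eval, hs, enc_pair, enc_nil, Data.hd]
        · simp [Expr.cost]
        · rw [hs, h0]
      | cons a l => have := hN a l t; omega
    | succ n ih =>
      intro s l t hn hs
      cases l with
      | nil =>
        refine ⟨s, _, Exec.loopStop ?_, ?_, ?_, fun _ _ => rfl⟩
        · simp [Expr.eval, hs, enc_pair, enc_nil, Data.hd]
        · simp [Expr.cost]
        · rw [hs, h0]
      | cons a l =>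
        have hN' := hN a l t
        obtain ⟨s', m, e1, e2, e3, e4⟩ := hp s ((a, l), t) (by rw [hs]; rfl)
        obtain ⟨s'', m', f1, f2, f3, f4⟩ := ih s' (step ((a, l), t)).1 (step ((a, l), t)).2
          (by simp only [Prod.mk.eta]; omega) e3
        simp only [Prod.mk.eta] at f2 f3
        refine ⟨s'', _, Exec.loopStep ?_ e1 f1, ?_, ?_, fun i hi => (f4 i hi).trans (e4 i hi)⟩
        · simp [Expr.eval, hs, enc_pair, enc_cons, Data.hd]
        · simp only [Expr.cost]
          have := Nat.mul_le_mul_left (C + 8) hN'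
          nlinarith
        · rw [f3, h1]
  refine ⟨.seq (.loop (.hd (.var k)) p) (.assign k (.tl (.var k))), fun s x hs => ?_⟩
  obtain ⟨s', m, e1, e2, e3, e4⟩ := key _ s x.1 x.2 le_rfl hs
  simp only [Prod.mk.eta] at e2 e3
  refine ⟨_, _, Exec.seq e1 (Exec.assign _ _ _), ?_, ?_, ?_⟩
  · simp only [Expr.cost]
    nlinarith
  · simp [Expr.eval, e3, enc_pair, Data.tl]
  · intro i hi
    rw [Function.update_of_ne (by omega), e4 i hi]

/-- The cost of a fold, given the cost of a step. -/
def foldCost {α σ : Type} (T : σ → α → ℕ) (step : σ → α → σ) : σ → List α → ℕ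
  | _, [] => 0
  | s, a :: l => T s a + 1 + foldCost T step (step s a) l

/-- The environment `e` travels with the accumulator in the loop state, since the body of the loop
works on a single variable. -/
theorem foldl {l : ε → List α} {s₀ : ε → σ} {step : ε → σ → α → σ} {Tl Ts : ε → ℕ}
    {T : ε × σ × α → ℕ} (hl : Impl l Tl) (hs : Impl s₀ Ts)
    (hstep : Impl (fun x : ε × σ × α => step x.1 x.2.1 x.2.2) T) :
    Impl (fun e => (l e).foldl (step e) (s₀ e))
      (fun e => Tl e + Ts e + foldCost (fun s a => T (e, s, a)) (step e) (s₀ e) (l e)) := by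
  have h1 : Impl (fun x : (α × List α) × ε × σ =>
      (x.1.2, x.2.1, step x.2.1 x.2.2 x.1.1)) (fun x => T (x.2.1, x.2.2, x.1.1)) := by
    refine (Impl.pair (Impl.comp snd fst) (Impl.pair (Impl.comp fst snd)
      (Impl.comp hstep (Impl.pair (Impl.comp fst snd)
        (Impl.pair (Impl.comp snd snd) (Impl.comp fst fst)))))).mono fun x => ?_
    simp
  have h2 := loop h1 (fun x => (x.2.1, x.1.foldl (step x.2.1) x.2.2))
    (fun x => foldCost (fun s a => T (x.2.1, s, a)) (step x.2.1) x.2.2 x.1)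
    (fun t => rfl) (fun a l t => rfl) (fun a l t => by simp [foldCost])
  refine (snd.comp (h2.comp (Impl.pair hl (Impl.pair id hs)))).mono fun e => ?_
  simp

/-- The invariant `I` also sees the rest of the list, so that it can record how far the fold has
come. -/
theorem foldCost_le_sum {α σ : Type} {T : σ → α → ℕ} {step : σ → α → σ} (B : α → ℕ) :
    ∀ (l : List α) (s : σ) (I : σ → List α → Prop), I s l →
      (∀ s a l, I s (a :: l) → T s a ≤ B a ∧ I (step s a) l) →
      foldCost T step s l ≤ (l.map fun a => B a + 1).sum
  | [], _, _, _, _ => by simp [foldCost]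
  | a :: l, s, I, hs, h => by
    have h1 := h s a l hs
    have h2 := foldCost_le_sum B l (step s a) I h1.2 h
    simp only [foldCost, List.map_cons, List.sum_cons]
    have := h1.1
    omega

theorem foldCost_eq_sum {α σ : Type} (T : α → ℕ) {step : σ → α → σ} :
    ∀ (l : List α) (s : σ), foldCost (fun _ a => T a) step s l = (l.map fun a => T a + 1).sum
  | [], _ => rfl
  | a :: l, s => by simp [foldCost, foldCost_eq_sum T l]

theorem foldCost_append {α σ : Type} {T : σ → α → ℕ} {step : σ → α → σ} :
    ∀ (l l' : List α) (s : σ),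
      foldCost T step s (l ++ l') = foldCost T step s l + foldCost T step (l.foldl step s) l'
  | [], _, _ => by simp [foldCost]
  | a :: l, l', s => by simp [foldCost, foldCost_append l l', add_assoc]

theorem cons : Impl (fun p : α × List α => p.1 :: p.2) (fun _ => 0) := cast fun _ => rfl

theorem reverse : Impl (fun l : List α => l.reverse) (fun l => l.length) := by
  have h : Impl (fun l : List α => l.foldl (fun s a => a :: s) []) _ :=
    foldl (ε := List α) (step := fun _ s a => a :: s) id (const [])
      (cons.comp (pair (snd.comp snd) (fst.comp snd)))
  refine (h.mono' 1 (T' := fun l => l.length) fun l => ?_).congr fun l => ?_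
  · simp only [foldCost_eq_sum (fun _ => 0 + 0 + (0 + 0) + 0)]
    simp
  · congr 1
    simp

theorem map {l : ε → List α} {f : ε → α → β} {Tl : ε → ℕ} {T : ε × α → ℕ} (hl : Impl l Tl)
    (hf : Impl (fun x : ε × α => f x.1 x.2) T) :
    Impl (fun e => (l e).map (f e))
      (fun e => Tl e + ((l e).map fun a => T (e, a) + 1).sum) := by
  have h : Impl (fun e => (l e).foldl (fun s a => f e a :: s) []) _ :=
    foldl (step := fun e s a => f e a :: s) (T := fun x => T (x.1, x.2.2)) hl (const [])
      ((cons.comp (pair (hf.comp (pair fst (snd.comp snd))) (fst.comp snd))).mono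
        fun x => by simp)
  have hrev : ∀ e, (l e).foldl (fun s a => f e a :: s) [] = ((l e).map (f e)).reverse := by
    intro e
    have : ∀ (l : List α) (s : List β),
        l.foldl (fun s a => f e a :: s) s = (l.map (f e)).reverse ++ s := by
      intro l
      induction l with
      | nil => simp
      | cons a l ih => intro s; simp [ih]
    simp [this]
  refine ((reverse.comp h).mono' 2 fun e => ?_).congr fun e => ?_
  · simp only [hrev, foldCost_eq_sum (fun a => T (e, a))]
    have : (l e).length ≤ ((l e).map fun a => T (e, a) + 1).sum := by
      induction l e with
      | nil => simp
      | cons a l ih => simp only [List.map_cons, List.sum_cons, List.length_cons]; omega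
    simp only [List.length_reverse, List.length_map]
    omega
  · rw [hrev, List.reverse_reverse]

/-- The first list is reversed and pushed onto the second, whose length does not enter the cost. -/
theorem append {l l' : ε → List α} {Tl Tl' : ε → ℕ} (hl : Impl l Tl) (hl' : Impl l' Tl') :
    Impl (fun e => l e ++ l' e) (fun e => Tl e + Tl' e + (l e).length) := by
  have h : Impl (fun e => (l e).reverse.foldl (fun s a => a :: s) (l' e)) _ :=
    foldl (step := fun _ s a => a :: s) (reverse.comp hl) hl'
      (cons.comp (pair (snd.comp snd) (fst.comp snd)))
  refine (h.mono' 2 fun e => ?_).congr fun e => ?_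
  · simp only [foldCost_eq_sum (fun _ => 0 + 0 + (0 + 0) + 0)]
    simp
    omega
  · congr 1
    simp

/-- Is a tree a cell? -/
theorem toBool : Impl Data.toBool (fun _ => 0) := by
  have h : Impl (fun d : Data => if d.toBool then true else false) (fun _ => 0) := by
    refine ⟨8, fun k => ⟨.cond (.var k) (.assign k (constExpr (enc true)))
      (.assign k (constExpr (enc false))), fun s d hs => ?_⟩⟩
    cases d with
    | nil =>
      refine ⟨_, _, Exec.condFalse ?_ (Exec.assign _ _ _), ?_, ?_, ?_⟩
      · simpa [Expr.eval, enc_data] using hs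
      · simp [Expr.cost, constExpr, enc_false]
      · simp [Data.toBool, eval_constExpr]
      · intro i hi
        rw [Function.update_of_ne (by omega)]
    | cons a b =>
      refine ⟨_, _, Exec.condTrue ?_ (Exec.assign _ _ _), ?_, ?_, ?_⟩
      · simp [Expr.eval, hs, enc_data]
      · simp [Expr.cost, constExpr, enc_true]
      · simp [Data.toBool, eval_constExpr]
      · intro i hi
        rw [Function.update_of_ne (by omega)]
  exact h.congr fun d => by cases d <;> rfl

theorem encode : Impl (fun a : α => enc a) (fun _ => 0) := cast fun _ => rfl

end Impl

/-! ### Serialization of trees -/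

namespace Data

def size : Data → ℕ
  | nil => 1
  | cons a b => a.size + b.size + 1

/-- The preorder code of a tree. -/
def preorder : Data → List Bool
  | nil => [false]
  | cons a b => true :: (a.preorder ++ b.preorder)

/-- The reversed preorder code of a tree. -/
def ser (t : Data) : List Bool := t.preorder.reverse

theorem length_preorder (t : Data) : t.preorder.length = t.size := by
  induction t with
  | nil => rfl
  | cons a b iha ihb => simp [preorder, size, iha, ihb]

theorem length_ser (t : Data) : t.ser.length = t.size := by simp [ser, length_preorder]

/-- One step of decoding: the stack is a tree, too. -/
def deserStep (st : Data) (b : Bool) : Data :=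
  if b then cons (cons st.hd st.tl.hd) st.tl.tl else cons nil st

def deser (l : List Bool) : Data := (l.foldl deserStep nil).hd

/-- The preorder code read backwards is a postfix expression, so a stack decodes it: `false` pushes
a leaf, `true` joins the two topmost entries. -/
theorem foldl_deserStep (t : Data) : ∀ st, t.ser.foldl deserStep st = cons t st := by
  induction t with
  | nil => intro st; rfl
  | cons a b iha ihb =>
    intro st
    have : (cons a b).ser = b.ser ++ a.ser ++ [true] := by simp [ser, preorder]
    rw [this, List.foldl_append, List.foldl_append, ihb, iha]
    rfl

theorem deser_ser (t : Data) : deser t.ser = t := by simp [deser, foldl_deserStep, hd]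

theorem ser_injective : Function.Injective ser := fun a b h => by
  rw [← deser_ser a, h, deser_ser]

theorem size_ofBits (l : List Bool) : (ofBits l).size ≤ 4 * l.length + 1 := by
  induction l with
  | nil => simp [ofBits, ofList, size]
  | cons b l ih =>
    have hb : (ofBool b).size ≤ 3 := by cases b <;> simp [ofBool, size]
    simp only [ofBits, List.map_cons, ofList, size, List.length_cons] at ih ⊢
    omega

theorem size_ofNat (k : ℕ) : (ofNat k).size ≤ 4 * k.size + 1 := by
  have := size_ofBits k.bits
  rwa [Nat.size_eq_bits_len] at *

theorem ofBits_injective : Function.Injective ofBits := fun a b h => by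
  rw [← toBits_ofBits a, h, toBits_ofBits]

theorem ofNat_injective : Function.Injective ofNat := fun a b h => by
  have h1 : a.bits = b.bits := ofBits_injective h
  have h2 := congrArg (List.foldr (fun b n => Nat.bit b n) 0) h1
  have h3 : ∀ n : ℕ, n.bits.foldr (fun b n => Nat.bit b n) 0 = n := by
    intro n
    induction n using Nat.binaryRec' with
    | zero => simp
    | bit b n h ih => rw [Nat.bits_append_bit n b h, List.foldr_cons, ih]
  rwa [h3, h3] at h2

theorem ofInt_injective : Function.Injective ofInt := fun a b h => by
  simp only [ofInt, cons.injEq] at h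
  have h1 := ofNat_injective h.2
  have h2 := congrArg Data.toBool h.1
  rw [toBool_ofBool, toBool_ofBool, decide_eq_decide] at h2
  omega

end Data

theorem enc_zero : (enc (0 : ℕ) : Data) = Data.nil := by
  change Data.ofNat 0 = _
  simp [Data.ofNat, Data.ofBits, Data.ofList]

theorem enc_list_injective {α : Type} [Enc α] (h : Function.Injective (enc : α → Data)) :
    Function.Injective (enc : List α → Data) := fun a b hab => by
  have := congrArg Data.toList hab
  change (Data.ofList _).toList = (Data.ofList _).toList at this
  rw [Data.toList_ofList, Data.toList_ofList] at this
  exact List.map_injective_iff.2 h this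

theorem enc_prod_injective {α β : Type} [Enc α] [Enc β]
    (h : Function.Injective (enc : α → Data)) (h' : Function.Injective (enc : β → Data)) :
    Function.Injective (enc : α × β → Data) := fun a b hab => by
  obtain ⟨a1, a2⟩ := a
  obtain ⟨b1, b2⟩ := b
  simp only [enc_pair, Data.cons.injEq] at hab
  rw [h hab.1, h' hab.2]

/-- A value in transit, written as a bit string. -/
structure Wire (α : Type) where
  val : α

instance {α : Type} [Enc α] : Enc (Wire α) := ⟨fun w => enc (enc w.val : Data).ser⟩

namespace Impl

variable {α β γ δ σ τ ε : Type} [Enc α] [Enc β] [Enc γ] [Enc δ] [Enc σ] [Enc τ] [Enc ε]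

/-- The work list holds the subtrees still to be written, and their total size is the potential.
Output is added at the head, so the code comes out reversed, as `ser` requires. -/
theorem ser : Impl Data.ser (fun d => d.size) := by
  let step : (Data × List Data) × List Bool → List Data × List Bool := fun x =>
    if x.1.1.toBool then (x.1.1.hd :: x.1.1.tl :: x.1.2, true :: x.2) else (x.1.2, false :: x.2)
  have hstep : Impl step (fun _ => 0) := by
    have ht : Impl (fun x : (Data × List Data) × List Bool => x.1.1) (fun _ => 0) :=
      fst.comp fst
    refine (ite (toBool.comp ht)
      (pair (cons.comp (pair (hd.comp ht) (cons.comp (pair (tl.comp ht) (snd.comp fst)))))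
        (cons.comp (pair (const true) snd)))
      (pair (snd.comp fst) (cons.comp (pair (const false) snd)))).mono fun x => ?_
    simp
  have h := loop hstep (fun x => (x.1.flatMap Data.preorder).reverse ++ x.2)
    (fun x => (x.1.map Data.size).sum) (fun t => by simp) (fun a l t => by
      cases a <;> simp [step, Data.toBool, Data.preorder, Data.hd, Data.tl])
    (fun a l t => by
      cases a <;> simp [step, Data.toBool, Data.size, Data.hd, Data.tl]; omega)
  refine ((h.comp (pair (cons.comp (pair id (const []))) (const []))).mono fun d => ?_).congr
    fun d => ?_
  · simp
  · simp [Data.ser]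

theorem deser : Impl Data.deser (fun l => l.length) := by
  have hstep : Impl (fun x : List Bool × Data × Bool => Data.deserStep x.2.1 x.2.2)
      (fun _ => 0) := by
    have ht : Impl (fun x : List Bool × Data × Bool => x.2.1) (fun _ => 0) := fst.comp snd
    have cons' : Impl (fun x : Data × Data => Data.cons x.1 x.2) (fun _ => 0) :=
      cast fun _ => rfl
    refine (ite (snd.comp snd)
      (cons'.comp (pair (cons'.comp (pair (hd.comp ht) (hd.comp (tl.comp ht))))
        (tl.comp (tl.comp ht)))) (cons'.comp (pair (const Data.nil) ht))).mono fun x => ?_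
    simp
  have h := foldl (ε := List Bool) (step := fun _ => Data.deserStep) id (const Data.nil) hstep
  refine (hd.comp h).mono fun l => ?_
  simp [foldCost_eq_sum (fun _ => 0)]

theorem wire : Impl (fun a : α => Wire.mk a) (fun a => (enc a : Data).size) :=
  ((ser.comp encode).mono fun a => by simp).congr fun a => rfl

theorem unwire : Impl (fun w : Wire α => w.val) (fun w => (enc w.val : Data).size) := by
  have h : Impl (fun w : Wire α => (enc w.val : Data).ser) (fun _ => 0) := cast fun _ => rfl
  refine ((deser.comp h).mono fun w => ?_).congr fun w => ?_
  · simp [Data.length_ser]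
  · exact Data.deser_ser _ |>.symm

end Impl

/-! ### Tries -/

namespace Data

def left (t : Data) : Data := t.tl.hd
def right (t : Data) : Data := t.tl.tl

def trieStep (t : Data) (b : Bool) : Data := if b then t.right else t.left

/-- A trie has its value at the head; the tail holds the two subtries. -/
def trieGet (t : Data) (k : List Bool) : Data := (k.foldl trieStep t).hd

def trieSet : Data → List Bool → Data → Data
  | t, [], v => cons v t.tl
  | t, b :: k, v =>
    cons t.hd (if b then cons t.left (trieSet t.right k v) else cons (trieSet t.left k v) t.right)

theorem trieGet_nil (k : List Bool) : trieGet nil k = nil := by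
  have : k.foldl trieStep nil = nil := by
    induction k with
    | nil => rfl
    | cons b k ih => cases b <;> simpa [trieStep, left, right, hd, tl] using ih
  simp [trieGet, this, hd]

theorem trieGet_trieSet (k : List Bool) : ∀ (t : Data) (k' : List Bool) (v : Data),
    trieGet (trieSet t k v) k' = if k' = k then v else trieGet t k' := by
  induction k with
  | nil =>
    intro t k' v
    cases k' with
    | nil => simp [trieGet, trieSet, hd]
    | cons b k' => cases b <;> simp [trieGet, trieSet, trieStep, left, right, tl]
  | cons c k ih =>
    intro t k' v
    cases k' with
    | nil => simp [trieGet, trieSet, hd]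
    | cons b k' =>
      have h : ∀ t : Data, trieGet t (b :: k') = trieGet (trieStep t b) k' := fun t => rfl
      rw [h, h]
      cases b <;> cases c <;> simp [trieSet, trieStep, left, right, tl, hd, ih]

/-- Tables: finite maps from trees to trees, as tries. -/
def get (m k : Data) : Data := trieGet m k.ser
def set (m k v : Data) : Data := trieSet m k.ser v

theorem get_nil (k : Data) : get nil k = nil := trieGet_nil _

-- Serialisation is injective, so distinct keys have distinct addresses in the trie.
open Classical in
theorem get_set (m k v k' : Data) : get (set m k v) k' = if k' = k then v else get m k' := by
  rw [get, set, trieGet_trieSet]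
  simp only [ser_injective.eq_iff]
  congr

end Data

namespace Impl

variable {α β γ δ σ τ ε : Type} [Enc α] [Enc β] [Enc γ] [Enc δ] [Enc σ] [Enc τ] [Enc ε]

theorem dcons : Impl (fun x : Data × Data => Data.cons x.1 x.2) (fun _ => 0) := cast fun _ => rfl

theorem left : Impl Data.left (fun _ => 0) := (hd.comp tl).mono fun _ => by simp
theorem right : Impl Data.right (fun _ => 0) := (tl.comp tl).mono fun _ => by simp

theorem get : Impl (fun x : Data × Data => x.1.get x.2) (fun x => x.2.size) := by
  have hstep : Impl (fun x : (Data × Data) × Data × Bool => Data.trieStep x.2.1 x.2.2)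
      (fun _ => 0) :=
    (ite (snd.comp snd) (right.comp (fst.comp snd)) (left.comp (fst.comp snd))).mono fun _ => by
      simp
  have h := foldl (ε := Data × Data) (step := fun _ => Data.trieStep)
    (l := fun x => x.2.ser) (s₀ := fun x => x.1) (ser.comp snd) fst hstep
  refine (hd.comp h).mono' 2 fun x => ?_
  simp [foldCost_eq_sum (fun _ => 0), Data.length_ser]
  omega

/-- There is no recursion in the language: `down` follows the address and records the nodes passed,
with the directions taken, and `up` rebuilds them along that trail. -/
theorem set : Impl (fun x : Data × Data × Data => x.1.set x.2.1 x.2.2) (fun x => x.2.1.size) := by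
  let down : Data × List (Bool × Data) → Bool → Data × List (Bool × Data) := fun s b =>
    (Data.trieStep s.1 b, (b, s.1) :: s.2)
  let up : Data → Bool × Data → Data := fun t x =>
    Data.cons x.2.hd (if x.1 then Data.cons x.2.left t else Data.cons t x.2.right)
  have hdown : Impl (fun x : (Data × Data × Data) × (Data × List (Bool × Data)) × Bool =>
      down x.2.1 x.2.2) (fun _ => 0) := by
    have ht : Impl (fun x : (Data × Data × Data) × (Data × List (Bool × Data)) × Bool => x.2.1.1)
      (fun _ => 0) := fst.comp (fst.comp snd)
    refine (pair (ite (snd.comp snd) (right.comp ht) (left.comp ht))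
      (cons.comp (pair (pair (snd.comp snd) ht) (snd.comp (fst.comp snd))))).mono fun _ => ?_
    simp
  have hup : Impl (fun x : (Data × List (Bool × Data)) × Data × (Bool × Data) => up x.2.1 x.2.2)
      (fun _ => 0) := by
    have ht : Impl (fun x : (Data × List (Bool × Data)) × Data × (Bool × Data) => x.2.2.2)
      (fun _ => 0) := snd.comp (snd.comp snd)
    refine (dcons.comp (pair (hd.comp ht) (ite (fst.comp (snd.comp snd))
      (dcons.comp (pair (left.comp ht) (fst.comp snd)))
      (dcons.comp (pair (fst.comp snd) (right.comp ht)))))).mono fun _ => ?_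
    simp
  have h1 := foldl (ε := Data × Data × Data) (step := fun _ => down)
    (l := fun x => x.2.1.ser) (s₀ := fun x => (x.1, [])) (ser.comp (fst.comp snd))
    (pair fst (const [])) hdown
  have hdl : ∀ (k : List Bool) (s : Data × List (Bool × Data)),
      (k.foldl down s).2.length = s.2.length + k.length := by
    intro k
    induction k with
    | nil => intro s; rfl
    | cons b k ih => intro s; rw [List.foldl_cons, ih]; simp [down]; omega
  have h2 := foldl (ε := (Data × List (Bool × Data)) × Data) (step := fun _ => up)
    (l := fun x => x.1.2) (s₀ := fun x => Data.cons x.2 x.1.1.tl) (snd.comp fst)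
    (dcons.comp (pair snd (tl.comp (fst.comp fst))))
    (T := fun _ => 0) ((hup.comp (pair (fst.comp fst) snd)).mono fun _ => by simp)
  have key : ∀ (k : List Bool) (t v : Data) (r : List (Bool × Data)),
      (k.foldl down (t, r)).2.foldl up (Data.cons v (k.foldl down (t, r)).1.tl) =
        r.foldl up (Data.trieSet t k v) := by
    intro k
    induction k with
    | nil => intro t v r; rfl
    | cons b k ih =>
      intro t v r
      rw [List.foldl_cons, ih, List.foldl_cons]
      cases b <;> simp [up, Data.trieStep, Data.trieSet]
  refine ((h2.comp (pair h1 (snd.comp snd))).mono' 4 fun x => ?_).congr fun x => ?_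
  · simp [foldCost_eq_sum (fun _ => 0), Data.length_ser, hdl]
    omega
  · simp only [key]
    rfl

end Impl

/-! ### Arithmetic -/

/-- The successor on binary numbers. -/
def succBits : List Bool → List Bool
  | [] => [true]
  | false :: l => true :: l
  | true :: l => false :: succBits l

theorem bits_succ (n : ℕ) : (n + 1).bits = succBits n.bits := by
  induction n using Nat.binaryRec' with
  | zero => simp [succBits]
  | bit b n h ih =>
    rw [Nat.bits_append_bit n b h]
    cases b with
    | false =>
      have : Nat.bit false n + 1 = Nat.bit true n := by simp [Nat.bit_val]
      rw [this, Nat.bits_append_bit n true (by simp)]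
      rfl
    | true =>
      have : Nat.bit true n + 1 = Nat.bit false (n + 1) := by simp [Nat.bit_val]; ring
      rw [this, Nat.bits_append_bit (n + 1) false (by simp), ih]
      rfl

namespace Impl

variable {α β γ δ σ τ ε : Type} [Enc α] [Enc β] [Enc γ] [Enc δ] [Enc σ] [Enc τ] [Enc ε]

theorem succ : Impl (fun n : ℕ => n + 1) Nat.size := by
  let step : Bool × List Bool → Bool → Bool × List Bool := fun s b =>
    if s.1 then (b, (if b then false else true) :: s.2) else (false, b :: s.2)
  have hstep : Impl (fun x : List Bool × (Bool × List Bool) × Bool => step x.2.1 x.2.2)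
      (fun _ => 0) := by
    have hb : Impl (fun x : List Bool × (Bool × List Bool) × Bool => x.2.2) (fun _ => 0) :=
      snd.comp snd
    have hs : Impl (fun x : List Bool × (Bool × List Bool) × Bool => x.2.1) (fun _ => 0) :=
      fst.comp snd
    refine (ite (fst.comp hs) (pair hb (cons.comp (pair (ite hb (const false) (const true))
      (snd.comp hs)))) (pair (const false) (cons.comp (pair hb (snd.comp hs))))).mono fun _ => ?_
    simp
  have h1 := foldl (ε := List Bool) (step := fun _ => step) (s₀ := fun _ => (true, []))
    id (const _) hstep
  have h2 : Impl (fun s : Bool × List Bool => (if s.1 then true :: s.2 else s.2).reverse)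
      (fun s => s.2.length + 1) := by
    refine (reverse.comp (ite fst (cons.comp (pair (const true) snd)) snd)).mono fun s => ?_
    split_ifs <;> simp
  have key0 : ∀ (l r : List Bool), l.foldl step (false, r) = (false, l.reverse ++ r) := by
    intro l
    induction l with
    | nil => intro r; rfl
    | cons b l ih =>
      intro r
      rw [List.foldl_cons, show step (false, r) b = (false, b :: r) from rfl, ih]
      simp
  have key : ∀ (l r : List Bool), (if (l.foldl step (true, r)).1 then
      true :: (l.foldl step (true, r)).2 else (l.foldl step (true, r)).2).reverse =
        r.reverse ++ succBits l := by
    intro l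
    induction l with
    | nil => intro r; simp [succBits]
    | cons b l ih =>
      intro r
      cases b
      · rw [List.foldl_cons, show step (true, r) false = (false, true :: r) from rfl, key0]
        simp [succBits]
      · rw [List.foldl_cons]
        have : step (true, r) true = (true, false :: r) := rfl
        rw [this, ih]
        simp [succBits]
  have hlen : ∀ (l : List Bool) (s : Bool × List Bool),
      (l.foldl step s).2.length = s.2.length + l.length := by
    intro l
    induction l with
    | nil => intro s; rfl
    | cons b l ih =>
      intro s
      rw [List.foldl_cons, ih]
      have : (step s b).2.length = s.2.length + 1 := by
        simp only [step]; split_ifs <;> simp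
      rw [this, List.length_cons]; omega
  have hbits : Impl Nat.bits (fun _ => 0) := cast fun _ => rfl
  refine ((h2.comp (h1.comp hbits)).mono' 2 fun n => ?_).congr fun n => ?_
  · simp [foldCost_eq_sum (fun _ => 0), hlen, Nat.size_eq_bits_len]
    omega
  · rw [key]
    exact congrArg Data.ofBits (bits_succ n)

/-- Doubling from the most significant bit downwards: the lengths copied form a geometric series,
which keeps the cost linear. -/
theorem unary : Impl (fun n : ℕ => List.replicate n ()) (fun n => n) := by
  let step : List Unit → Bool → List Unit := fun s b => if b then () :: (s ++ s) else s ++ s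
  have hstep : Impl (fun x : List Bool × List Unit × Bool => step x.2.1 x.2.2)
      (fun x => x.2.1.length) := by
    have hs : Impl (fun x : List Bool × List Unit × Bool => x.2.1) (fun _ => 0) := fst.comp snd
    refine (ite (snd.comp snd) (cons.comp (pair (const ()) (append hs hs)))
      (append hs hs)).mono fun _ => ?_
    split_ifs <;> simp
  have h1 := foldl (ε := List Bool) (step := fun _ => step) (l := fun l => l.reverse)
    (s₀ := fun _ => []) reverse (const _) hstep
  have hbits : Impl Nat.bits (fun _ => 0) := cast fun _ => rfl
  have key : ∀ n : ℕ, n.bits.reverse.foldl step [] = List.replicate n () := by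
    intro n
    induction n using Nat.binaryRec' with
    | zero => rfl
    | bit b n h ih =>
      rw [Nat.bits_append_bit n b h, List.reverse_cons, List.foldl_append, ih]
      rw [List.eq_replicate_iff]
      cases b <;> simp [step, Nat.bit_val] <;> omega
  have cost : ∀ n : ℕ, foldCost (fun s _ => s.length) step [] n.bits.reverse ≤ 2 * n := by
    intro n
    induction n using Nat.binaryRec' with
    | zero => simp [foldCost]
    | bit b n h ih =>
      rw [Nat.bits_append_bit n b h, List.reverse_cons, foldCost_append, key]
      simp only [foldCost, List.length_replicate, Nat.bit_val]
      rcases Nat.eq_zero_or_pos n with rfl | hn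
      · have := h rfl
        subst this
        simp [foldCost] at *
      · omega
  refine ((h1.comp hbits).mono' 3 fun n => ?_).congr fun n => ?_
  · have := cost n
    have h2 : n.bits.length ≤ n := by
      rw [Nat.size_eq_bits_len]
      exact Nat.size_le.2 n.lt_two_pow_self
    simp only at *
    omega
  · rw [key]

theorem range : Impl (fun l : List Unit => List.range l.length)
    (fun l => l.length * l.length.size) := by
  let step : ℕ × List ℕ → Unit → ℕ × List ℕ := fun s _ => (s.1 + 1, s.1 :: s.2)
  have hstep : Impl (fun x : List Unit × (ℕ × List ℕ) × Unit => step x.2.1 x.2.2)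
      (fun x => x.2.1.1.size) := by
    have hs : Impl (fun x : List Unit × (ℕ × List ℕ) × Unit => x.2.1) (fun _ => 0) :=
      fst.comp snd
    refine (pair (succ.comp (fst.comp hs)) (cons.comp (pair (fst.comp hs)
      (snd.comp hs)))).mono fun _ => ?_
    simp
  have h1 := foldl (ε := List Unit) (step := fun _ => step) (s₀ := fun _ => (0, []))
    id (const _) hstep
  have key : ∀ (l : List Unit) (i : ℕ) (r : List ℕ),
      (l.foldl step (i, r)).2 = (List.range' i l.length).reverse ++ r := by
    intro l
    induction l with
    | nil => intro i r; rfl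
    | cons b l ih =>
      intro i r
      rw [List.foldl_cons, ih, List.length_cons, List.range'_succ]
      simp
  refine ((reverse.comp (snd.comp h1)).mono' 3 fun l => ?_).congr fun l => ?_
  · have h2 := foldCost_le_sum (T := fun (s : ℕ × List ℕ) (_ : Unit) => s.1.size) (step := step)
      (fun _ => l.length.size) l (0, []) (fun s r => s.1 + r.length = l.length) (by simp)
      (fun s a r h => ⟨Nat.size_le_size (by simp at h; omega), by simp [step] at h ⊢; omega⟩)
    simp only [List.map_const', List.sum_replicate, smul_eq_mul] at h2
    simp only [key, List.append_nil, List.length_reverse, List.length_range']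
    rcases Nat.eq_zero_or_pos l.length with h0 | h0
    · rw [h0] at h2 ⊢; simp at h2 ⊢; omega
    · have := Nat.size_pos.2 h0
      nlinarith
  · rw [key, List.append_nil, List.reverse_reverse, List.range_eq_range']

end Impl

/-! ### Truncated unfoldings of labelled port systems -/

/-- The tree of depth `d` unfolded from `a`; the edges out of a node carry the port numbers at
their other ends. -/
def unfoldTree {α : Type} (lab : α → ℤ) (out : α → List (ℕ × α)) (base : α → Data) : ℕ → α → Data
  | 0, a => base a
  | d + 1, a => Data.cons (Data.ofInt (lab a)) (Data.ofList ((out a).map fun e =>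
      Data.cons (Data.ofNat e.1) (unfoldTree lab out base d e.2)))

section unfoldTree

variable {α β : Type} {lab : α → ℤ} {out : α → List (ℕ × α)} {base : α → Data}
  {lab' : β → ℤ} {out' : β → List (ℕ × β)} {base' : β → Data}

/-- All encodings involved are injective, so trees can be compared one level at a time; the two
sides may belong to different systems. -/
theorem unfoldTree_succ_eq {d : ℕ} {a : α} {b : β} :
    unfoldTree lab out base (d + 1) a = unfoldTree lab' out' base' (d + 1) b ↔
      lab a = lab' b ∧ (out a).map (fun e => (e.1, unfoldTree lab out base d e.2)) =
        (out' b).map (fun e => (e.1, unfoldTree lab' out' base' d e.2)) := by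
  have hinj : Function.Injective fun x : ℕ × Data => Data.cons (Data.ofNat x.1) x.2 := by
    rintro ⟨a, b⟩ ⟨c, d⟩ h
    simp only [Data.cons.injEq] at h
    rw [Data.ofNat_injective h.1, h.2]
  have h2 : ∀ l l' : List (ℕ × Data), Data.ofList (l.map fun x => Data.cons (Data.ofNat x.1) x.2) =
      Data.ofList (l'.map fun x => Data.cons (Data.ofNat x.1) x.2) ↔ l = l' := by
    intro l l'
    refine ⟨fun h => ?_, fun h => by rw [h]⟩
    have := congrArg Data.toList h
    rw [Data.toList_ofList, Data.toList_ofList] at this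
    exact List.map_injective_iff.2 hinj this
  simp only [unfoldTree, Data.cons.injEq, Data.ofInt_injective.eq_iff]
  rw [← h2]
  simp [List.map_map, Function.comp_def]

/-- Two lists of pairs agree after mapping if they agree after a finer mapping. -/
theorem map_pair_congr {γ δ : Type} {f : α → γ} {g : β → γ} {f' : α → δ} {g' : β → δ}
    (h : ∀ a b, f a = g b → f' a = g' b) :
    ∀ (l : List (ℕ × α)) (l' : List (ℕ × β)),
      l.map (fun e => (e.1, f e.2)) = l'.map (fun e => (e.1, g e.2)) →
      l.map (fun e => (e.1, f' e.2)) = l'.map (fun e => (e.1, g' e.2))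
  | [], [], _ => rfl
  | [], _ :: _, h' => by simp at h'
  | _ :: _, [], h' => by simp at h'
  | a :: l, b :: l', h' => by
    simp only [List.map_cons, List.cons.injEq, Prod.mk.injEq] at h' ⊢
    exact ⟨⟨h'.1.1, h _ _ h'.1.2⟩, map_pair_congr h l l' h'.2⟩

/-- Deeper trees separate more nodes. Only the bottom level needs an assumption, which is trivial
for a constant `base`. -/
theorem unfoldTree_mono (h0 : ∀ a b, unfoldTree lab out base 1 a = unfoldTree lab' out' base' 1 b →
    base a = base' b) (d : ℕ) : ∀ a b,
    unfoldTree lab out base (d + 1) a = unfoldTree lab' out' base' (d + 1) b →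
    unfoldTree lab out base d a = unfoldTree lab' out' base' d b := by
  induction d with
  | zero => exact h0
  | succ d ih =>
    intro a b h
    rw [unfoldTree_succ_eq] at h ⊢
    exact ⟨h.1, map_pair_congr ih _ _ h.2⟩

/-- On a system of `M` nodes, unfoldings that agree up to depth `M - 1` agree at all depths. -/
theorem unfoldTree_stable [Fintype α] (c : Data) {M : ℕ} (hM : Fintype.card α ≤ M + 1) {a b : α}
    (h : unfoldTree lab out (fun _ => c) M a = unfoldTree lab out (fun _ => c) M b) (d : ℕ) :
    unfoldTree lab out (fun _ => c) d a = unfoldTree lab out (fun _ => c) d b := by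
  classical
  set t : ℕ → α → Data := unfoldTree lab out (fun _ => c) with ht
  have mono : ∀ d a b, t (d + 1) a = t (d + 1) b → t d a = t d b :=
    unfoldTree_mono (lab := lab) (lab' := lab) fun _ _ _ => rfl
  -- No class of depth `d` is split at depth `d + 1`; by `hst` no class is split later either.
  let Stable : ℕ → Prop := fun d => ∀ a b, t d a = t d b → t (d + 1) a = t (d + 1) b
  have hst : ∀ d, Stable d → Stable (d + 1) := by
    intro d hd a b hab
    simp only [ht] at hab ⊢
    rw [unfoldTree_succ_eq] at hab ⊢
    exact ⟨hab.1, map_pair_congr hd _ _ hab.2⟩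
  have hcard : ∀ d, Stable d ∨ d + 1 ≤ (Finset.univ.image (t d)).card := by
    intro d
    induction d with
    | zero =>
      right
      exact Finset.card_pos.2 ⟨_, Finset.mem_image_of_mem _ (Finset.mem_univ a)⟩
    | succ d ih =>
      rcases ih with ih | ih
      · exact Or.inl (hst d ih)
      · by_cases hd : Stable d
        · exact Or.inl (hst d hd)
        · right
          -- The trees of depth `d` are a function of those of depth `d + 1`. If that function were
          -- injective on the values that occur, no class would be split, so the number of classes
          -- grows strictly.
          have hf : Function.FactorsThrough (t d) (t (d + 1)) := fun a b hab => mono d a b hab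
          have him : Finset.univ.image (t d) =
              (Finset.univ.image (t (d + 1))).image (Function.extend (t (d + 1)) (t d) fun _ => c) := by
            rw [Finset.image_image]
            congr 1
            funext a
            exact (hf.extend_apply _ a).symm
          have hlt : (Finset.univ.image (t d)).card < (Finset.univ.image (t (d + 1))).card := by
            rw [him]
            refine lt_of_le_of_ne Finset.card_image_le fun heq => hd ?_
            intro a b hab
            have := Finset.card_image_iff.1 heq
            refine this (by simp) (by simp) ?_
            rw [hf.extend_apply, hf.extend_apply, hab]
          omega
  have hM' : Stable M := by
    rcases hcard M with h | h
    · exact h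
    -- There are as many classes as nodes, hence equal trees belong to equal nodes.
    · intro x y hxy
      have h1 : (Finset.univ.image (t M)).card ≤ Fintype.card α := by
        simpa using Finset.card_image_le (s := Finset.univ) (f := t M)
      have h2 : (Finset.univ.image (t M)).card = (Finset.univ : Finset α).card := by
        rw [Finset.card_univ]; omega
      have := Finset.card_image_iff.1 h2
      rw [this (by simp) (by simp) hxy]
  have hup : ∀ k, t (M + k) a = t (M + k) b ∧ Stable (M + k) := by
    intro k
    induction k with
    | zero => exact ⟨h, hM'⟩
    | succ k ih => exact ⟨ih.2 _ _ ih.1, hst _ ih.2⟩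
  have hdown : ∀ k d, t (d + k) a = t (d + k) b → t d a = t d b := by
    intro k
    induction k with
    | zero => intro d h; exact h
    | succ k ih => intro d h; exact ih d (mono _ _ _ h)
  exact hdown M d (by rw [add_comm]; exact (hup d).1)

theorem unfoldTree_of_hom (φ : α → β) (hlab : ∀ a, lab' (φ a) = lab a)
    (hout : ∀ a, out' (φ a) = (out a).map fun e => (e.1, φ e.2))
    (hbase : ∀ a, base' (φ a) = base a) (d : ℕ) :
    ∀ a, unfoldTree lab' out' base' d (φ a) = unfoldTree lab out base d a := by
  induction d with
  | zero => exact hbase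
  | succ d ih =>
    intro a
    simp [unfoldTree, hlab, hout, Function.comp_def, ih]

/-- The version of `unfoldTree_stable` for nodes of two systems. -/
theorem unfoldTree_stable₂ [Fintype α] [Fintype β] (c : Data) {M : ℕ}
    (hM : Fintype.card α + Fintype.card β ≤ M + 1) {a : α} {b : β}
    (h : unfoldTree lab out (fun _ => c) M a = unfoldTree lab' out' (fun _ => c) M b) (d : ℕ) :
    unfoldTree lab out (fun _ => c) d a = unfoldTree lab' out' (fun _ => c) d b := by
  -- The stabilisation theorem is applied to the disjoint union of the two systems.
  let l : α ⊕ β → ℤ := Sum.elim lab lab'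
  let o : α ⊕ β → List (ℕ × (α ⊕ β)) := Sum.elim
    (fun a => (out a).map fun e => (e.1, Sum.inl e.2)) (fun b => (out' b).map fun e => (e.1, Sum.inr e.2))
  have h1 := fun d => unfoldTree_of_hom (lab := lab) (lab' := l) (out := out) (out' := o)
    (base := fun _ => c) (base' := fun _ => c) Sum.inl (fun _ => rfl) (fun _ => rfl) (fun _ => rfl) d a
  have h2 := fun d => unfoldTree_of_hom (lab := lab') (lab' := l) (out := out') (out' := o)
    (base := fun _ => c) (base' := fun _ => c) Sum.inr (fun _ => rfl) (fun _ => rfl) (fun _ => rfl) d b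
  rw [← h1, ← h2]
  rw [← h1, ← h2] at h
  exact unfoldTree_stable c (by simpa using hM) h d

end unfoldTree

/-! ### Views as unfoldings of the port system; walks extended at their end -/

namespace Network

variable {n : ℕ} (N : Network n) (X : Fin n → ℤ)

/-- The port numbers at the other ends of the links at `v`, and the neighbours there. -/
def out (v : Fin n) : List (ℕ × Fin n) :=
  List.ofFn fun i : Fin (N.deg v) => ((N.backPort v i : ℕ), N.nbr v i)

/-- The tree that stands for the view of depth `d`. -/
def viewTree (d : ℕ) (v : Fin n) : Data :=
  unfoldTree X N.out (fun v => Data.cons (Data.ofInt (X v)) Data.nil) d v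

/-- The tree that stands for the view of depth `d` without the labels of the leaves. -/
def preTree (d : ℕ) (v : Fin n) : Data := unfoldTree X N.out (fun _ => Data.nil) d v

theorem map_out_eq {n' : ℕ} (N' : Network n') {γ : Type} (f : Fin n → γ) (g : Fin n' → γ)
    (v : Fin n) (w : Fin n') :
    (N.out v).map (fun e => (e.1, f e.2)) = (N'.out w).map (fun e => (e.1, g e.2)) ↔
      N.deg v = N'.deg w ∧ ∀ i (h : i < N.deg v) (h' : i < N'.deg w),
        (N.backPort v ⟨i, h⟩ : ℕ) = N'.backPort w ⟨i, h'⟩ ∧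
          f (N.nbr v ⟨i, h⟩) = g (N'.nbr w ⟨i, h'⟩) := by
  rw [out, out, List.map_ofFn, List.map_ofFn, List.ext_get_iff]
  simp

theorem portTo_injective {v w w' : Fin n} (h : N.graph.Adj v w) (h' : N.graph.Adj v w')
    (he : N.portTo h = N.portTo h') : w = w' := by
  exact congrArg Subtype.val ((N.port v).injective he)

theorem portTo_nbr (v : Fin n) (i : Fin (N.deg v)) : N.portTo (N.adj_nbr v i) = i := by
  simp [portTo, nbr]

theorem nbr_portTo {v w : Fin n} (h : N.graph.Adj v w) : N.nbr v (N.portTo h) = w := by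
  simp [portTo, nbr]

/-- Extension of a walk by the link at a port of its end. -/
def ext {v : Fin n} (p : Σ w, N.graph.Walk v w) (i : Fin (N.deg p.1)) : Σ w, N.graph.Walk v w :=
  ⟨N.nbr p.1 i, p.2.concat (N.adj_nbr p.1 i)⟩

theorem length_ext {v : Fin n} (p : Σ w, N.graph.Walk v w) (i : Fin (N.deg p.1)) :
    (N.ext p i).2.length = p.2.length + 1 := by
  simp [ext]

/-- An edge of the view is the choice of a port at the end of a walk. This form frees later
arguments from adjacency proofs and from casts between end points. -/
theorem view_edge_iff {v : Fin n} (p q : Σ w, N.graph.Walk v w) (x : ℕ × ℕ) :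
    (N.view X v).edge p x q ↔
      ∃ i : Fin (N.deg p.1), x = ((i : ℕ), (N.backPort p.1 i : ℕ)) ∧ q = N.ext p i := by
  constructor
  · rintro ⟨h, hq, rfl⟩
    obtain ⟨w, q⟩ := q
    obtain ⟨u, p⟩ := p
    dsimp only at h hq
    subst hq
    refine ⟨N.portTo h, ?_, ?_⟩
    · have hw := N.nbr_portTo h
      -- The neighbour at port `N.portTo h` equals `w` only by a theorem, so the end point is
      -- generalised before it is substituted.
      have : ∀ (w' : Fin n) (e : w' = w) (h' : N.graph.Adj u w'),
          (N.portTo h'.symm : ℕ) = N.portTo h.symm := by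
        rintro w' rfl h'; rfl
      simp only [edgeLabel, backPort]
      rw [this _ hw (N.adj_nbr _ _)]
    · have : ∀ (w' : Fin n) (e : w' = w) (h' : N.graph.Adj u w'),
          (⟨w, p.concat h⟩ : Σ w, N.graph.Walk v w) = ⟨w', p.concat h'⟩ := by
        rintro w' rfl h'; rfl
      exact this _ (N.nbr_portTo h) _
  · rintro ⟨i, rfl, rfl⟩
    exact ⟨N.adj_nbr p.1 i, rfl,
      Prod.ext (congrArg Fin.val (N.portTo_nbr p.1 i)).symm rfl⟩

/-- The end of a walk of positive length is reached from the walk without its last edge. -/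
theorem exists_ext {v : Fin n} (q : Σ w, N.graph.Walk v w) (h : q.2.length ≠ 0) :
    ∃ p i, q = N.ext p i := by
  obtain ⟨w, q⟩ := q
  induction q using SimpleGraph.Walk.concatRec with
  | Hnil => simp at h
  | Hconcat p h' _ =>
    have := (N.view_edge_iff (fun _ => 0) ⟨_, p⟩ ⟨_, p.concat h'⟩ _).1 ⟨h', rfl, rfl⟩
    obtain ⟨i, -, hi⟩ := this
    exact ⟨_, i, hi⟩

theorem walk_induction {v : Fin n} {P : (Σ w, N.graph.Walk v w) → Prop}
    (h0 : P ⟨v, SimpleGraph.Walk.nil⟩) (h1 : ∀ p i, P p → P (N.ext p i)) : ∀ p, P p := by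
  have : ∀ k, ∀ p : Σ w, N.graph.Walk v w, p.2.length = k → P p := by
    intro k
    induction k with
    | zero =>
      rintro ⟨w, p⟩ hp
      cases p with
      | nil => exact h0
      | cons h p => simp at hp
    | succ k ih =>
      intro q hq
      obtain ⟨p, i, rfl⟩ := N.exists_ext q (by omega)
      rw [length_ext] at hq
      exact h1 p i (ih p (by omega))
  exact fun p => this _ p rfl

end Network

/-! ### Folded views and layouts -/

namespace Network

variable {n : ℕ} (N : Network n) (X : Fin n → ℤ) (h : ℕ) (v : Fin n)

theorem viewUpTo_edge_iff (p q : (N.viewUpTo X h v).Node) (x : ℕ × ℕ) :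
    (N.viewUpTo X h v).edge p x q ↔
      ∃ i : Fin (N.deg p.1.1), x = ((i : ℕ), (N.backPort p.1.1 i : ℕ)) ∧ q.1 = N.ext p.1 i :=
  N.view_edge_iff X p.1 q.1 x

/-- A walk in a simple graph is determined by its sequence of vertices, and there are finitely many
such sequences of bounded length. -/
instance finite_viewUpTo : Finite (N.viewUpTo X h v).Node := by
  have hf : {l : List (Fin n) | l.length ≤ h + 1}.Finite := List.finite_length_le _ _
  have := hf.to_subtype
  refine Finite.of_injective (β := {l : List (Fin n) | l.length ≤ h + 1})
    (fun p : (N.viewUpTo X h v).Node => ⟨p.1.2.support, by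
      have := p.2; simp [SimpleGraph.Walk.length_support]; exact this⟩) ?_
  rintro ⟨⟨w, p⟩, hp⟩ ⟨⟨w', q⟩, hq⟩ hpq
  have hs : p.support = q.support := congrArg Subtype.val hpq
  have hw : w = w' := by
    have h1 := p.getLast_support
    have h2 := q.getLast_support
    rw [← h1, ← h2]
    congr 1
  subst hw
  have := SimpleGraph.Walk.ext_support hs
  subst this
  rfl

/-- A map from the view onto one of its folded views. -/
structure IsFoldMap (B : RootedGraph ℤ (ℕ × ℕ)) (f : (N.viewUpTo X h v).Node → B.Node) : Prop where
  surj : Function.Surjective f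
  root : f (N.viewUpTo X h v).root = B.root
  label : ∀ p, B.label (f p) = X p.1.1
  edge : ∀ p x c, B.edge (f p) x c ↔ ∃ q, (N.viewUpTo X h v).edge p x q ∧ f q = c
  length : ∀ p q, f p = f q → p.1.2.length = q.1.2.length

variable {N X h v}

/-- Folded views stay graded: paths from the root lift to walks, and walks over the same node have
the same length. -/
theorem IsFoldMap.hasDepth {B : RootedGraph ℤ (ℕ × ℕ)} {f : (N.viewUpTo X h v).Node → B.Node}
    (hf : N.IsFoldMap X h v B f) (p : (N.viewUpTo X h v).Node) (k : ℕ) :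
    B.HasDepth (f p) k ↔ p.1.2.length = k := by
  constructor
  · have : ∀ b, B.HasDepth b k → ∃ p, f p = b ∧ p.1.2.length = k := by
      intro b hb
      induction hb with
      | root => exact ⟨_, hf.root, rfl⟩
      | step _ he ih =>
        obtain ⟨p, rfl, hp⟩ := ih
        obtain ⟨q, hq, hqw⟩ := (hf.edge _ _ _).1 he
        obtain ⟨i, -, hi⟩ := (N.viewUpTo_edge_iff X h v p q _).1 hq
        exact ⟨q, hqw, by rw [hi, length_ext, hp]⟩
    intro hb
    obtain ⟨q, hq, hk⟩ := this _ hb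
    rw [← hk]
    exact hf.length _ _ hq.symm
  · have : ∀ p : Σ w, N.graph.Walk v w, ∀ hp : p.2.length ≤ h,
        B.HasDepth (f ⟨p, hp⟩) p.2.length := by
      refine N.walk_induction (fun hp => ?_) fun p i ih hp => ?_
      · have : f ⟨⟨v, SimpleGraph.Walk.nil⟩, hp⟩ = B.root := hf.root
        rw [this]
        exact RootedGraph.HasDepth.root
      · rw [length_ext] at *
        exact RootedGraph.HasDepth.step (ih (by omega)) ((hf.edge _ _ _).2
          ⟨_, (N.viewUpTo_edge_iff X h v _ _ _).2 ⟨i, rfl, rfl⟩, rfl⟩)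
    rintro rfl
    exact this p.1 p.2

/-- By induction on the merges: the walks over the removed node are redirected to the retained one.
Label and outgoing edges of the two agree, so all conditions survive. -/
theorem exists_isFoldMap {B : RootedGraph ℤ (ℕ × ℕ)} (hB : (N.viewUpTo X h v).IsFoldedView B) :
    ∃ f, N.IsFoldMap X h v B f := by
  classical
  induction hB with
  | refl =>
    exact ⟨id, Function.surjective_id, rfl, fun _ => rfl, fun p x c => by simp,
      fun p q hpq => by rw [show p = q from hpq]⟩
  | @step B hB u u' hm hr ih =>
    obtain ⟨f, hf⟩ := ih
    obtain ⟨hne, ⟨k, hk, hk'⟩, hl, he⟩ := hm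
    obtain ⟨p₀, rfl⟩ := hf.surj u
    obtain ⟨p₁, rfl⟩ := hf.surj u'
    have hlen : p₀.1.2.length = p₁.1.2.length := by
      rw [(hf.hasDepth p₀ k).1 hk, (hf.hasDepth p₁ k).1 hk']
    let g : (N.viewUpTo X h v).Node → (B.merge (f p₀) (f p₁) hr).Node := fun p =>
      if hp : f p = f p₁ then ⟨f p₀, hne⟩ else ⟨f p, hp⟩
    have g1 : ∀ p, f p = f p₁ → g p = ⟨f p₀, hne⟩ := fun p hp => dif_pos hp
    have g2 : ∀ p (hp : f p ≠ f p₁), g p = ⟨f p, hp⟩ := fun p hp => dif_neg hp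
    refine ⟨g, ⟨?_, ?_, ?_, ?_, ?_⟩⟩
    · rintro ⟨b, hb⟩
      obtain ⟨p, rfl⟩ := hf.surj b
      exact ⟨p, g2 p hb⟩
    · rw [g2 _ (by rw [hf.root]; exact hr)]
      exact Subtype.ext hf.root
    · intro p
      by_cases hp : f p = f p₁
      · rw [g1 p hp]
        change B.label (f p₀) = _
        rw [hl, ← hp, hf.label]
      · rw [g2 p hp]
        exact hf.label p
    · intro p x c
      have hedge : (B.merge (f p₀) (f p₁) hr).edge (g p) x c ↔
          B.edge (f p) x c.1 ∨ (B.edge (f p) x (f p₁) ∧ c.1 = f p₀) := by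
        by_cases hp : f p = f p₁
        · rw [g1 p hp, hp, ← he, ← he]; rfl
        · rw [g2 p hp]; rfl
      rw [hedge, hf.edge, hf.edge]
      constructor
      · rintro (⟨q, hq, hqc⟩ | ⟨⟨q, hq, hqc⟩, hc⟩)
        · have := c.2
          exact ⟨q, hq, by rw [g2 q (by rw [hqc]; exact this)]; exact Subtype.ext hqc⟩
        · exact ⟨q, hq, by rw [g1 q hqc]; exact Subtype.ext hc.symm⟩
      · rintro ⟨q, hq, rfl⟩
        by_cases hqc : f q = f p₁
        · exact Or.inr ⟨⟨q, hq, hqc⟩, by rw [g1 q hqc]⟩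
        · exact Or.inl ⟨q, hq, by rw [g2 q hqc]⟩
    · intro p q hpq
      by_cases hp : f p = f p₁ <;> by_cases hq : f q = f p₁
      · exact hf.length _ _ (hp.trans hq.symm)
      · rw [g1 p hp, g2 q hq] at hpq
        have := hf.length _ _ (congrArg Subtype.val hpq)
        have := hf.length _ _ hp
        omega
      · rw [g2 p hp, g1 q hq] at hpq
        have := hf.length _ _ (congrArg Subtype.val hpq)
        have := hf.length _ _ hq
        omega
      · rw [g2 p hp, g2 q hq] at hpq
        exact hf.length _ _ (congrArg Subtype.val hpq)

-- Each merge removes a node of a finite graph, so merging comes to an end.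
variable (N X h v) in
theorem exists_isMinimalFoldedView : ∃ A, (N.viewUpTo X h v).IsMinimalFoldedView A := by
  have key : ∀ k, ∀ B, (N.viewUpTo X h v).IsFoldedView B → Nat.card B.Node ≤ k →
      ∃ A, (N.viewUpTo X h v).IsMinimalFoldedView A := by
    intro k
    induction k with
    | zero =>
      intro B hB hk
      obtain ⟨f, hf⟩ := exists_isFoldMap hB
      have := Finite.of_surjective f hf.surj
      have : Nonempty B.Node := ⟨B.root⟩
      have := Nat.card_pos (α := B.Node)
      omega
    | succ k ih =>
      intro B hB hk
      by_cases hm : ∀ u u', ¬ B.Mergeable u u'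
      · exact ⟨B, hB, hm⟩
      push Not at hm
      -- Mergeability is symmetric, so the roles can be exchanged if the node to be removed is the
      -- root.
      have : ∃ u u', B.Mergeable u u' ∧ B.root ≠ u' := by
        obtain ⟨u, u', hm⟩ := hm
        by_cases hr : B.root = u'
        · obtain ⟨h1, ⟨k, h2, h3⟩, h4, h5⟩ := hm
          exact ⟨u', u, ⟨h1.symm, ⟨k, h3, h2⟩, h4.symm, fun x w => (h5 x w).symm⟩,
            fun h' => h1 (h'.symm.trans hr)⟩
        · exact ⟨u, u', hm, hr⟩
      obtain ⟨u, u', hm, hr⟩ := this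
      obtain ⟨f, hf⟩ := exists_isFoldMap hB
      have hfin := Finite.of_surjective f hf.surj
      refine ih _ (hB.step u u' hm hr) ?_
      have : Nat.card {w : B.Node // w ≠ u'} < Nat.card B.Node :=
        Finite.card_subtype_lt (x := u') (by simp)
      change Nat.card {w : B.Node // w ≠ u'} ≤ k
      omega
  exact key _ _ .refl le_rfl

/-- The edges out of the common node carry port numbers, so the continuations of both walks pair off
port by port; induction on the remaining depth does the rest. -/
theorem IsFoldMap.viewTree_eq {B : RootedGraph ℤ (ℕ × ℕ)} {f : (N.viewUpTo X h v).Node → B.Node}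
    (hf : N.IsFoldMap X h v B f) (d : ℕ) : ∀ p q : (N.viewUpTo X h v).Node, p.1.2.length + d = h →
    f p = f q → N.viewTree X d p.1.1 = N.viewTree X d q.1.1 := by
  induction d with
  | zero =>
    intro p q _ hpq
    have := hf.label q
    rw [← hpq, hf.label] at this
    simp [viewTree, unfoldTree, this]
  | succ d ih =>
    intro p q hd hpq
    have hl : X p.1.1 = X q.1.1 := by
      have := hf.label q
      rwa [← hpq, hf.label] at this
    have hlen := hf.length _ _ hpq
    have key : ∀ p q : (N.viewUpTo X h v).Node, p.1.2.length + (d + 1) = h → f p = f q →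
        ∀ i (hi : i < N.deg p.1.1), ∃ hi' : i < N.deg q.1.1,
          (N.backPort p.1.1 ⟨i, hi⟩ : ℕ) = N.backPort q.1.1 ⟨i, hi'⟩ ∧
          N.viewTree X d (N.nbr p.1.1 ⟨i, hi⟩) = N.viewTree X d (N.nbr q.1.1 ⟨i, hi'⟩) := by
      intro p q hd hpq i hi
      have h1 : B.edge (f p) (i, (N.backPort p.1.1 ⟨i, hi⟩ : ℕ))
          (f ⟨N.ext p.1 ⟨i, hi⟩, by rw [length_ext]; omega⟩) :=
        (hf.edge _ _ _).2 ⟨_, (N.viewUpTo_edge_iff X h v _ _ _).2 ⟨⟨i, hi⟩, rfl, rfl⟩, rfl⟩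
      rw [hpq] at h1
      obtain ⟨q', hq', hfq⟩ := (hf.edge _ _ _).1 h1
      obtain ⟨j, hj, hjq⟩ := (N.viewUpTo_edge_iff X h v _ _ _).1 hq'
      simp only [Prod.mk.injEq] at hj
      obtain ⟨rfl, hj⟩ := hj
      refine ⟨j.2, hj, ?_⟩
      have := ih _ _ (by rw [length_ext]; omega) hfq.symm
      rw [hjq] at this
      exact this
    have hdeg : N.deg p.1.1 = N.deg q.1.1 := by
      refine le_antisymm (not_lt.1 fun hlt => ?_) (not_lt.1 fun hlt => ?_)
      · exact lt_irrefl _ (key p q hd hpq _ hlt).1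
      · exact lt_irrefl _ (key q p (by omega) hpq.symm _ hlt).1
    simp only [viewTree]
    rw [unfoldTree_succ_eq]
    refine ⟨hl, (N.map_out_eq N _ _ _ _).2 ⟨hdeg, fun i hi hi' => ?_⟩⟩
    exact (key p q hd hpq i hi).2

/-- Induction from the leaves towards the root: once the children are identified, equal trees give
equal labels and equal outgoing edges, and distinct nodes of that kind could still be merged. -/
theorem IsFoldMap.eq_of_viewTree_eq {B : RootedGraph ℤ (ℕ × ℕ)}
    {f : (N.viewUpTo X h v).Node → B.Node} (hf : N.IsFoldMap X h v B f)
    (hm : ∀ u u', ¬ B.Mergeable u u') (d : ℕ) : ∀ p q : (N.viewUpTo X h v).Node,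
    p.1.2.length + d = h → q.1.2.length + d = h →
    N.viewTree X d p.1.1 = N.viewTree X d q.1.1 → f p = f q := by
  have lab : ∀ (d : ℕ) (a b : Fin n), N.viewTree X d a = N.viewTree X d b → X a = X b := by
    intro d a b hab
    cases d with
    | zero => simpa [viewTree, unfoldTree, Data.ofInt_injective.eq_iff] using hab
    | succ d => exact (unfoldTree_succ_eq.1 hab).1
  induction d with
  | zero =>
    intro p q hp hq hpq
    by_contra hne
    refine hm (f p) (f q) ⟨hne, ⟨h, (hf.hasDepth _ _).2 hp, (hf.hasDepth _ _).2 hq⟩, ?_, ?_⟩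
    · rw [hf.label, hf.label]; exact lab _ _ _ hpq
    · have none : ∀ p : (N.viewUpTo X h v).Node, p.1.2.length + 0 = h → ∀ x w,
          ¬ B.edge (f p) x w := by
        intro p hp x w hw
        obtain ⟨q, hq, -⟩ := (hf.edge _ _ _).1 hw
        obtain ⟨i, -, hi⟩ := (N.viewUpTo_edge_iff X h v _ _ _).1 hq
        have := q.2
        rw [hi, length_ext] at this
        omega
      intro x w
      simp [none p hp x w, none q hq x w]
  | succ d ih =>
    intro p q hp hq hpq
    by_contra hne
    refine hm (f p) (f q) ⟨hne, ⟨p.1.2.length, (hf.hasDepth _ _).2 rfl,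
      (hf.hasDepth _ _).2 (by omega)⟩, ?_, ?_⟩
    · rw [hf.label, hf.label]; exact lab _ _ _ hpq
    · have key : ∀ p q : (N.viewUpTo X h v).Node, p.1.2.length + (d + 1) = h →
          q.1.2.length + (d + 1) = h →
          N.viewTree X (d + 1) p.1.1 = N.viewTree X (d + 1) q.1.1 → ∀ x w,
          B.edge (f p) x w → B.edge (f q) x w := by
        intro p q hp hq hpq x w hw
        obtain ⟨p', hp', rfl⟩ := (hf.edge _ _ _).1 hw
        obtain ⟨i, rfl, hi⟩ := (N.viewUpTo_edge_iff X h v _ _ _).1 hp'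
        have := (N.map_out_eq N _ _ _ _).1 (unfoldTree_succ_eq.1 hpq).2
        obtain ⟨hdeg, hch⟩ := this
        have hi' : (i : ℕ) < N.deg q.1.1 := hdeg ▸ i.2
        obtain ⟨hb, ht⟩ := hch i i.2 hi'
        refine (hf.edge _ _ _).2 ⟨⟨N.ext q.1 ⟨i, hi'⟩, by rw [length_ext]; omega⟩,
          (N.viewUpTo_edge_iff X h v _ _ _).2 ⟨⟨i, hi'⟩, ?_, rfl⟩, ?_⟩
        · simp [hb]
        · refine (ih _ _ ?_ ?_ ?_).symm
          · rw [hi, length_ext]; omega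
          · rw [length_ext]; omega
          · rw [hi]; exact ht
      exact fun x w => ⟨key p q hp hq hpq x w, key q p hq hp hpq.symm x w⟩

variable (N X h v)

/-- The level list `c` lays out the folded view of depth `h` of `v`; the walk `p` ends at
position `pos p` of its level. -/
structure IsLayout (c : LevelList) (pos : (Σ w, N.graph.Walk v w) → ℕ) : Prop where
  nonempty : [] ∉ c
  root : pos ⟨v, SimpleGraph.Walk.nil⟩ = 0
  node : ∀ p, p.2.length ≤ h → (c.getD p.2.length [])[pos p]? = some (X p.1,
    if p.2.length < h then List.ofFn fun i : Fin (N.deg p.1) =>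
      (((i : ℕ), (N.backPort p.1 i : ℕ)), pos (N.ext p i)) else [])
  surj : ∀ j k, k < (c.getD j []).length → ∃ p, p.2.length = j ∧ pos p = k ∧ j ≤ h
  eq_iff : ∀ p q, p.2.length ≤ h → p.2.length = q.2.length → (pos p = pos q ↔
    N.viewTree X (h - p.2.length) p.1 = N.viewTree X (h - p.2.length) q.1)

variable {N X h v}

/-- The fold map followed by the numbering of the nodes assigns a position to every walk. From here
on minimal folded views are handled through walks and positions alone. -/
theorem exists_isLayout {A : RootedGraph ℤ (ℕ × ℕ)} {c : LevelList}
    (hA : (N.viewUpTo X h v).IsMinimalFoldedView A) (hc : c.Represents A) :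
    ∃ pos, N.IsLayout X h v c pos := by
  classical
  obtain ⟨hne, φ, hinj, hlev, hroot, hnode⟩ := hc
  obtain ⟨f, hf⟩ := exists_isFoldMap hA.1
  have hφ1 : ∀ p : Σ w, N.graph.Walk v w, ∀ hp : p.2.length ≤ h,
      (φ (f ⟨p, hp⟩)).1 = p.2.length := by
    refine N.walk_induction (fun hp => ?_) fun p i ih hp => ?_
    · have : f ⟨⟨v, SimpleGraph.Walk.nil⟩, hp⟩ = A.root := hf.root
      rw [this, hroot]
      rfl
    · have hp' := hp
      rw [length_ext] at hp' ⊢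
      obtain ⟨es, -, -, -, h4⟩ := hnode (f ⟨p, by omega⟩)
      rw [h4 _ (f ⟨N.ext p i, hp⟩) ((hf.edge _ _ _).2
          ⟨_, (N.viewUpTo_edge_iff X h v _ _ _).2 ⟨i, rfl, rfl⟩, rfl⟩), ih]
  -- The value for walks longer than `h` is a dummy.
  let pos : (Σ w, N.graph.Walk v w) → ℕ := fun p =>
    if hp : p.2.length ≤ h then (φ (f ⟨p, hp⟩)).2 else 0
  have hpos : ∀ p (hp : p.2.length ≤ h), φ (f ⟨p, hp⟩) = (p.2.length, pos p) := fun p hp =>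
    Prod.ext (hφ1 p hp) (by simp [pos, hp])
  refine ⟨pos, hne, ?_, ?_, ?_, ?_⟩
  · have := hpos ⟨v, SimpleGraph.Walk.nil⟩ (Nat.zero_le _)
    have h2 : f ⟨⟨v, SimpleGraph.Walk.nil⟩, Nat.zero_le _⟩ = A.root := hf.root
    rw [h2, hroot] at this
    exact (congrArg Prod.snd this).symm
  · intro p hp
    obtain ⟨es, h1, h2, h3, h4⟩ := hnode (f ⟨p, hp⟩)
    rw [hpos p hp] at h1 h3 h4
    refine h1.trans (congrArg some (Prod.ext (hf.label _) ?_))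
    dsimp only
    have mem : ∀ x q, (x, q) ∈ es ↔ ∃ i : Fin (N.deg p.1), p.2.length < h ∧
        x = ((i : ℕ), (N.backPort p.1 i : ℕ)) ∧ q = pos (N.ext p i) := by
      intro x q
      rw [h3]
      constructor
      · rintro ⟨w, hw, hwq⟩
        obtain ⟨p', hp', rfl⟩ := (hf.edge _ _ _).1 hw
        obtain ⟨i, rfl, hi⟩ := (N.viewUpTo_edge_iff X h v _ _ _).1 hp'
        have hp2 := p'.2
        refine ⟨i, ?_, rfl, ?_⟩
        · rw [hi, length_ext] at hp2; exact hp2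
        · have := hwq.symm.trans (hpos p'.1 p'.2)
          rw [← hi]
          exact congrArg Prod.snd this
      · rintro ⟨i, hlt, rfl, rfl⟩
        refine ⟨f ⟨N.ext p i, by rw [length_ext]; omega⟩, (hf.edge _ _ _).2
          ⟨_, (N.viewUpTo_edge_iff X h v _ _ _).2 ⟨i, rfl, rfl⟩, rfl⟩, ?_⟩
        rw [hpos, length_ext]
    have hport : ∀ k (hk : k < es.length), es[k].1.1 = k := by
      intro k hk
      have := congrArg (fun l => l[k]?) h2
      simpa [hk] using this
    by_cases hlt : p.2.length < h
    · rw [if_pos hlt]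
      -- The `k`-th listed edge has port number `k`: a longer list would contain the nonexistent
      -- port `deg`, and a shorter one would miss a port.
      have hlen : es.length = N.deg p.1 := by
        refine le_antisymm (not_lt.1 fun hl => ?_) (not_lt.1 fun hl => ?_)
        · obtain ⟨i, -, hx, -⟩ := (mem es[N.deg p.1].1 es[N.deg p.1].2).1 (List.getElem_mem hl)
          have := hport _ hl
          rw [hx] at this
          have := i.2
          simp at *
          omega
        · have h5 := (mem _ _).2 ⟨⟨_, hl⟩, hlt, rfl, rfl⟩
          obtain ⟨k, hk, hek⟩ := List.mem_iff_getElem.1 h5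
          have := hport k hk
          rw [hek] at this
          simp at this
          omega
      refine List.ext_getElem (by simp [hlen]) fun k hk hk' => ?_
      have hkd : k < N.deg p.1 := by omega
      obtain ⟨i, -, hx, hq⟩ := (mem es[k].1 es[k].2).1 (List.getElem_mem hk)
      have h6 := hport _ hk
      rw [hx] at h6
      have hik : i = ⟨k, hkd⟩ := Fin.ext h6
      subst hik
      rw [List.getElem_ofFn]
      exact Prod.ext hx hq
    · rw [if_neg hlt]
      rw [List.eq_nil_iff_forall_not_mem]
      rintro ⟨x, q⟩ hxq
      obtain ⟨i, hi, -⟩ := (mem _ _).1 hxq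
      exact hlt hi
  · intro j k hjk
    obtain ⟨a, ha⟩ := (hlev j k).2 hjk
    obtain ⟨p, rfl⟩ := hf.surj a
    have := hpos p.1 p.2
    rw [show (⟨p.1, p.2⟩ : (N.viewUpTo X h v).Node) = p from rfl, ha, Prod.mk.injEq] at this
    exact ⟨p.1, this.1.symm, this.2.symm, this.1 ▸ p.2⟩
  · intro p q hp hpq
    have hq : q.2.length ≤ h := hpq ▸ hp
    have h1 : pos p = pos q ↔ f ⟨p, hp⟩ = f ⟨q, hq⟩ := by
      rw [← hinj.eq_iff, hpos, hpos, Prod.mk.injEq]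
      simp [hpq]
    rw [h1]
    constructor
    · exact hf.viewTree_eq _ ⟨p, hp⟩ ⟨q, hq⟩ (by simp only; omega)
    · exact hf.eq_of_viewTree_eq hA.2 _ ⟨p, hp⟩ ⟨q, hq⟩ (by simp only; omega)
        (by simp only; omega)

/-- The fold map onto any minimal folded view identifies exactly the walks with the same level and
position, because both are governed by the remaining trees. -/
theorem IsLayout.exists_represents {c : LevelList} {pos : (Σ w, N.graph.Walk v w) → ℕ}
    (hc : N.IsLayout X h v c pos) :
    ∃ A, (N.viewUpTo X h v).IsMinimalFoldedView A ∧ c.Represents A := by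
  obtain ⟨A, hA⟩ := N.exists_isMinimalFoldedView X h v
  obtain ⟨f, hf⟩ := exists_isFoldMap hA.1
  refine ⟨A, hA, hc.nonempty, ?_⟩
  have hiff : ∀ p q : (N.viewUpTo X h v).Node,
      f p = f q ↔ (p.1.2.length, pos p.1) = (q.1.2.length, pos q.1) := by
    intro p q
    have hp := p.2
    constructor
    · intro hpq
      have hl := hf.length _ _ hpq
      rw [Prod.mk.injEq]
      exact ⟨hl, (hc.eq_iff _ _ p.2 hl).2 (hf.viewTree_eq _ p q (by omega) hpq)⟩
    · intro hpq
      rw [Prod.mk.injEq] at hpq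
      exact hf.eq_of_viewTree_eq hA.2 (h - p.1.2.length) p q (by omega) (by omega)
        ((hc.eq_iff _ _ p.2 hpq.1).1 hpq.2)
  -- Each node is numbered through some walk over it; by `hiff` the choice does not matter.
  choose g hg using hf.surj
  let φ : A.Node → ℕ × ℕ := fun a => ((g a).1.2.length, pos (g a).1)
  have hφ : ∀ p, φ (f p) = (p.1.2.length, pos p.1) := fun p =>
    (hiff (g (f p)) p).1 (hg _)
  refine ⟨φ, ?_, ?_, ?_, ?_⟩
  · intro a b hab
    rw [← hg a, ← hg b]
    exact (hiff _ _).2 hab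
  · intro j k
    constructor
    · rintro ⟨a, ha⟩
      obtain ⟨p, rfl⟩ := hf.surj a
      rw [hφ, Prod.mk.injEq] at ha
      obtain ⟨rfl, rfl⟩ := ha
      have := hc.node p.1 p.2
      by_contra hlt
      rw [List.getElem?_eq_none (not_lt.1 hlt)] at this
      exact absurd this (by simp)
    · intro hk
      obtain ⟨p, hp, hpk, hj⟩ := hc.surj j k hk
      exact ⟨f ⟨p, hp ▸ hj⟩, (hφ ⟨p, hp ▸ hj⟩).trans (Prod.ext hp hpk)⟩
  · rw [← hf.root, hφ]
    exact Prod.ext rfl hc.root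
  · intro a
    obtain ⟨p, rfl⟩ := hf.surj a
    have hp := p.2
    refine ⟨_, by rw [hφ, hf.label]; exact hc.node p.1 p.2, ?_, ?_, ?_⟩
    · split_ifs
      · apply List.ext_getElem <;> simp
      · rfl
    · intro x q
      constructor
      · intro hx
        split_ifs at hx with hlt
        · obtain ⟨i, hi⟩ := (List.mem_ofFn' _ _).1 hx
          simp only [Prod.mk.injEq] at hi
          obtain ⟨rfl, rfl⟩ := hi
          refine ⟨f ⟨N.ext p.1 i, by rw [length_ext]; omega⟩, (hf.edge _ _ _).2
            ⟨_, (N.viewUpTo_edge_iff X h v _ _ _).2 ⟨i, rfl, rfl⟩, rfl⟩, ?_⟩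
          rw [hφ p]
          exact (hφ ⟨N.ext p.1 i, _⟩).trans (Prod.ext (N.length_ext _ _) rfl)
        · simp at hx
      · rintro ⟨w, hw, hwq⟩
        obtain ⟨p', hp', rfl⟩ := (hf.edge _ _ _).1 hw
        obtain ⟨i, rfl, hi⟩ := (N.viewUpTo_edge_iff X h v _ _ _).1 hp'
        have hp2 := p'.2
        rw [hi, length_ext] at hp2
        rw [if_pos (by omega)]
        rw [hφ, Prod.mk.injEq, hi] at hwq
        rw [← hwq.2]
        exact (List.mem_ofFn' _ _).2 ⟨i, rfl⟩
    · intro x w hw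
      obtain ⟨p', hp', rfl⟩ := (hf.edge _ _ _).1 hw
      obtain ⟨i, rfl, hi⟩ := (N.viewUpTo_edge_iff X h v _ _ _).1 hp'
      rw [hφ, hφ, hi, length_ext]

end Network

/-! ### Isomorphism of views -/

namespace Network

variable {n : ℕ} (N : Network n) (X : Fin n → ℤ)

/-- The port numbers along a walk. -/
def portList : ∀ {v w : Fin n}, N.graph.Walk v w → List ℕ
  | _, _, .nil => []
  | _, _, .cons h p => (N.portTo h : ℕ) :: portList p

theorem portList_cons {u v w : Fin n} (h : N.graph.Adj u v) (p : N.graph.Walk v w) :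
    N.portList (SimpleGraph.Walk.cons h p) = (N.portTo h : ℕ) :: N.portList p := rfl

theorem portList_concat {u v w : Fin n} (p : N.graph.Walk u v) (h : N.graph.Adj v w) :
    N.portList (p.concat h) = N.portList p ++ [(N.portTo h : ℕ)] := by
  induction p with
  | nil => rfl
  | cons h' p ih => rw [SimpleGraph.Walk.concat_cons, portList_cons, ih, portList_cons]; rfl

theorem portList_ext {v : Fin n} (p : Σ w, N.graph.Walk v w) (i : Fin (N.deg p.1)) :
    N.portList (N.ext p i).2 = N.portList p.2 ++ [(i : ℕ)] := by
  rw [ext, portList_concat, portTo_nbr]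

/-- The ports of a party lead to distinct neighbours, so the port numbers steer the walk. -/
theorem portList_injective {v : Fin n} (p q : Σ w, N.graph.Walk v w)
    (h : N.portList p.2 = N.portList q.2) : p = q := by
  obtain ⟨w, p⟩ := p
  obtain ⟨w', q⟩ := q
  dsimp only at h
  induction p with
  | nil =>
    cases q with
    | nil => rfl
    | cons h' q => simp [portList_cons] at h; simp [portList] at h
  | cons h' p ih =>
    cases q with
    | nil => simp [portList_cons] at h; simp [portList] at h
    | cons h'' q =>
      rw [portList_cons, portList_cons, List.cons.injEq] at h
      obtain rfl := N.portTo_injective h' h'' (Fin.ext h.1)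
      have := ih q h.2
      simp only [Sigma.mk.injEq] at this
      obtain ⟨rfl, this⟩ := this
      rw [eq_of_heq this]

/-- The unfoldings at two parties agree at all depths. -/
def Bisim (v w : Fin n) : Prop := ∀ d, N.preTree X d v = N.preTree X d w

variable {N X}

theorem Bisim.step {v w : Fin n} (h : N.Bisim X v w) : X v = X w ∧ N.deg v = N.deg w ∧
    ∀ i (hi : i < N.deg v) (hi' : i < N.deg w),
      (N.backPort v ⟨i, hi⟩ : ℕ) = N.backPort w ⟨i, hi'⟩ ∧
        N.Bisim X (N.nbr v ⟨i, hi⟩) (N.nbr w ⟨i, hi'⟩) := by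
  have key := fun d => unfoldTree_succ_eq.1 (h (d + 1))
  have key2 := fun d => (N.map_out_eq N _ _ _ _).1 (key d).2
  exact ⟨(key 0).1, (key2 0).1, fun i hi hi' =>
    ⟨((key2 0).2 i hi hi').1, fun d => ((key2 d).2 i hi hi').2⟩⟩

theorem Bisim.symm {v w : Fin n} (h : N.Bisim X v w) : N.Bisim X w v := fun d => (h d).symm

theorem Bisim.exists_walk {v w : Fin n} (h : N.Bisim X v w) : ∀ p : Σ u, N.graph.Walk v u,
    ∃ q : Σ u, N.graph.Walk w u, N.portList q.2 = N.portList p.2 ∧ N.Bisim X p.1 q.1 := by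
  refine N.walk_induction ⟨⟨w, .nil⟩, rfl, h⟩ ?_
  rintro p i ⟨q, hq, hb⟩
  obtain ⟨-, hd, hn⟩ := hb.step
  refine ⟨N.ext q ⟨i, hd ▸ i.2⟩, ?_, (hn i i.2 (hd ▸ i.2)).2⟩
  rw [portList_ext, portList_ext, hq]

/-- Walks from `v` and from `w` are matched when they have the same port numbers; symmetry of
`Bisim` makes the matching bijective. -/
theorem Bisim.iso {v w : Fin n} (h : N.Bisim X v w) : (N.view X v).Iso (N.view X w) := by
  choose f hf hb using h.exists_walk
  have hbij : Function.Bijective f := by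
    constructor
    · intro p q hpq
      refine N.portList_injective _ _ ?_
      rw [← hf, ← hf, hpq]
    · intro q
      obtain ⟨p, hp, -⟩ := h.symm.exists_walk q
      exact ⟨p, N.portList_injective _ _ ((hf p).trans hp)⟩
  have hedge : ∀ (p : Σ u, N.graph.Walk v u) (x : ℕ × ℕ) (q : Σ u, N.graph.Walk v u),
      (∃ j : Fin (N.deg (f p).1), x = ((j : ℕ), (N.backPort (f p).1 j : ℕ)) ∧ f q = N.ext (f p) j) ↔
        ∃ i : Fin (N.deg p.1), x = ((i : ℕ), (N.backPort p.1 i : ℕ)) ∧ q = N.ext p i := by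
    intro p x q
    obtain ⟨-, hd, hn⟩ := (hb p).step
    constructor
    · rintro ⟨j, rfl, hj⟩
      have hj' : (j : ℕ) < N.deg p.1 := by rw [hd]; exact j.2
      refine ⟨⟨j, hj'⟩, ?_, N.portList_injective _ _ ?_⟩
      · simp [(hn j hj' j.2).1]
      · rw [portList_ext, ← hf q, hj, portList_ext, hf]
    · rintro ⟨i, rfl, rfl⟩
      have hi' : (i : ℕ) < N.deg (f p).1 := by rw [← hd]; exact i.2
      refine ⟨⟨i, hi'⟩, ?_, N.portList_injective _ _ ?_⟩
      · simp [← (hn i i.2 hi').1]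
      · rw [portList_ext, hf, portList_ext, hf]
  refine ⟨Equiv.ofBijective f hbij, ?_, fun p => (hb p).step.1.symm, fun p x q => ?_⟩
  · refine N.portList_injective _ _ ?_
    exact hf _
  · exact Iff.trans (N.view_edge_iff X _ _ _) (Iff.trans (hedge p x q) (N.view_edge_iff X _ _ _).symm)

/-- Edge labels contain the port number at the near end, so an isomorphism sends the child at port
`i` to the child at port `i`, and the trees agree by induction on the depth. -/
theorem bisim_of_iso {v w : Fin n} (h : (N.view X v).Iso (N.view X w)) : N.Bisim X v w := by
  obtain ⟨φ, h1, h2, h3⟩ := h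
  have key : ∀ d, ∀ p, N.preTree X d p.1 = N.preTree X d (φ p).1 := by
    intro d
    induction d with
    | zero => intro p; rfl
    | succ d ih =>
      intro p
      have fwd : ∀ i (hi : i < N.deg p.1), ∃ hi' : i < N.deg (φ p).1,
          (N.backPort p.1 ⟨i, hi⟩ : ℕ) = N.backPort (φ p).1 ⟨i, hi'⟩ ∧
          φ (N.ext p ⟨i, hi⟩) = N.ext (φ p) ⟨i, hi'⟩ := by
        intro i hi
        have := (h3 p (i, (N.backPort p.1 ⟨i, hi⟩ : ℕ)) (N.ext p ⟨i, hi⟩)).2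
          ((N.view_edge_iff X _ _ _).2 ⟨_, rfl, rfl⟩)
        obtain ⟨j, hj, hj'⟩ := (N.view_edge_iff X _ _ _).1 this
        simp only [Prod.mk.injEq] at hj
        obtain ⟨rfl, hj⟩ := hj
        exact ⟨j.2, hj, hj'⟩
      have bwd : ∀ i (hi : i < N.deg (φ p).1), i < N.deg p.1 := by
        intro i hi
        have := (h3 p (i, (N.backPort (φ p).1 ⟨i, hi⟩ : ℕ)) (φ.symm (N.ext (φ p) ⟨i, hi⟩))).1
          ((N.view_edge_iff X _ _ _).2 ⟨⟨i, hi⟩, rfl, φ.apply_symm_apply _⟩)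
        obtain ⟨j, hj, -⟩ := (N.view_edge_iff X _ _ _).1 this
        simp only [Prod.mk.injEq] at hj
        rw [hj.1]
        exact j.2
      refine unfoldTree_succ_eq.2 ⟨(h2 p).symm, (N.map_out_eq N _ _ _ _).2 ⟨?_, ?_⟩⟩
      · refine le_antisymm (not_lt.1 fun hlt => ?_) (not_lt.1 fun hlt => ?_)
        · exact lt_irrefl _ (fwd _ hlt).1
        · exact lt_irrefl _ (bwd _ hlt)
      · intro i hi hi'
        obtain ⟨_, hb, he⟩ := fwd i hi
        refine ⟨hb, ?_⟩
        have := ih (N.ext p ⟨i, hi⟩)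
        rw [he] at this
        exact this
  intro d
  have := key d (N.view X v).root
  rw [h1] at this
  exact this

/-- This is where depth `n - 1` becomes sufficient, by stabilisation. -/
theorem bisim_iff_preTree {v w : Fin n} {M : ℕ} (hM : n ≤ M + 1) :
    N.Bisim X v w ↔ N.preTree X M v = N.preTree X M w :=
  ⟨fun h => h M, fun h d => unfoldTree_stable Data.nil (by simpa using hM) h d⟩

/-- Serves to count views by counting trees, and trees by counting keys. -/
theorem ncard_image_eq_of_iff {α β γ : Type*} (S : Set α) (f : α → β) (g : α → γ)
    (h : ∀ a b, f a = f b ↔ g a = g b) : (f '' S).ncard = (g '' S).ncard := by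
  have hf : Function.FactorsThrough g f := fun a b hab => (h a b).1 hab
  rcases S.eq_empty_or_nonempty with rfl | ⟨a₀, _⟩
  · simp
  have : g '' S = Function.extend f g (fun _ => g a₀) '' (f '' S) := by
    rw [Set.image_image]
    exact Set.image_congr fun a _ => (hf.extend_apply _ a).symm
  rw [this]
  refine (Set.InjOn.ncard_image ?_).symm
  rintro _ ⟨a, _, rfl⟩ _ ⟨b, _, rfl⟩ hab
  rw [hf.extend_apply, hf.extend_apply] at hab
  exact (h a b).2 hab

theorem mk_view_eq_iff {v w : Fin n} {M : ℕ} (hM : n ≤ M + 1) :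
    (⟦N.view X v⟧ : Quotient (RootedGraph.isoSetoid ℤ (ℕ × ℕ))) = ⟦N.view X w⟧ ↔
      N.preTree X M v = N.preTree X M w := by
  rw [← bisim_iff_preTree hM, Quotient.eq]
  exact ⟨bisim_of_iso, Bisim.iso⟩

theorem ncard_views {M : ℕ} (hM : n ≤ M + 1) :
    (N.views X).ncard = (Set.range (N.preTree X M)).ncard := by
  have : N.views X = (fun v => (⟦N.view X v⟧ : Quotient _)) '' Set.univ := by
    ext t; simp [views, eq_comm]
  rw [this, ncard_image_eq_of_iff _ _ (N.preTree X M) fun a b => mk_view_eq_iff hM, Set.image_univ]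

theorem ncard_viewsIn {M : ℕ} (hM : n ≤ M + 1) (S : Finset ℤ) :
    (N.viewsIn X S).ncard = (N.preTree X M '' {v | X v ∈ S}).ncard := by
  have : N.viewsIn X S = (fun v => (⟦N.view X v⟧ : Quotient _)) '' {v | X v ∈ S} := by
    ext t; simp [viewsIn, eq_comm]
  rw [this, ncard_image_eq_of_iff _ _ (N.preTree X M) fun a b => mk_view_eq_iff hM]

end Network

/-- Correctness and cost come out of one induction, as the cost of a step is bounded only while the
invariant holds. -/
theorem Impl.foldl_inv {α σ : Type} {T : σ → α → ℕ} {step : σ → α → σ} (B : α → ℕ)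
    (I : σ → List α → Prop)
    (h : ∀ s a l, I s (a :: l) → T s a ≤ B a ∧ I (step s a) l) :
    ∀ (l : List α) (s : σ), I s l →
      I (l.foldl step s) [] ∧ foldCost T step s l ≤ (l.map fun a => B a + 1).sum
  | [], s, hs => ⟨hs, by simp [foldCost]⟩
  | a :: l, s, hs => by
    have h1 := h s a l hs
    obtain ⟨h2, h3⟩ := foldl_inv B I h l (step s a) h1.2
    refine ⟨h2, ?_⟩
    simp only [foldCost, List.map_cons, List.sum_cons]
    have := h1.1
    omega

theorem Impl.headD {α : Type} [Enc α] : Impl (fun l : List (List α) => l.headD []) (fun _ => 0) :=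
  Impl.of_expr (fun k => .hd (.var k)) 2 (fun _ => le_rfl) fun k s a hs => by
    simp only [Expr.eval, hs]; cases a <;> rfl

/-! ### Interning -/

/-- The name of the `i`-th entry of a table. -/
def Data.mark (i : ℕ) : Data := Data.cons Data.nil (enc i)

theorem Data.mark_injective : Function.Injective Data.mark := fun i j h => by
  simp only [Data.mark, Data.cons.injEq] at h
  exact Data.ofNat_injective h.2

/-- The reason for the extra cell in a name: `0` is encoded by `nil`, which is also the answer of a
table for an absent key. -/
theorem Data.mark_ne_nil (i : ℕ) : Data.mark i ≠ Data.nil := by simp [Data.mark]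

theorem Data.size_mark_le {i n : ℕ} (h : i ≤ n) : (Data.mark i).size ≤ 4 * n.size + 3 := by
  have h1 := Data.size_ofNat i
  have h2 := Nat.size_le_size h
  change _ + (Data.ofNat i).size + 1 ≤ _
  simp only [Data.size]
  omega

/-- The table `t` names the entries of `E`. -/
structure Interned (t : Data) (E : List Data) : Prop where
  get : ∀ i (h : i < E.length), t.get E[i] = Data.mark i
  none : ∀ k ∉ E, t.get k = Data.nil

namespace Interned

variable {t : Data} {E : List Data}

theorem empty : Interned Data.nil [] := ⟨fun i h => by simp at h, fun k _ => Data.get_nil k⟩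

theorem get_ne_nil (h : Interned t E) {k : Data} : t.get k ≠ Data.nil ↔ k ∈ E := by
  constructor
  · intro hk
    by_contra hE
    exact hk (h.none k hE)
  · intro hk
    obtain ⟨i, hi, rfl⟩ := List.mem_iff_getElem.1 hk
    rw [h.get i hi]
    exact Data.mark_ne_nil i

theorem toBool_get (h : Interned t E) {k : Data} : (t.get k).toBool = true ↔ k ∈ E := by
  rw [← h.get_ne_nil]
  cases t.get k <;> simp [Data.toBool]

theorem injOn (h : Interned t E) {k k' : Data} (hk : k ∈ E) (hk' : k' ∈ E)
    (he : t.get k = t.get k') : k = k' := by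
  obtain ⟨i, hi, rfl⟩ := List.mem_iff_getElem.1 hk
  obtain ⟨j, hj, rfl⟩ := List.mem_iff_getElem.1 hk'
  rw [h.get i hi, h.get j hj] at he
  obtain rfl := Data.mark_injective he
  rfl

theorem nodup (h : Interned t E) : E.Nodup := by
  rw [List.nodup_iff_injective_getElem]
  rintro ⟨i, hi⟩ ⟨j, hj⟩ hij
  dsimp only at hij
  have h1 := h.get i hi
  rw [hij, h.get j hj] at h1
  exact Fin.ext (Data.mark_injective h1).symm

theorem push (h : Interned t E) {k : Data} (hk : k ∉ E) :
    Interned (t.set k (Data.mark E.length)) (E ++ [k]) := by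
  constructor
  · intro i hi
    rw [Data.get_set]
    rw [List.length_append, List.length_singleton] at hi
    rcases Nat.lt_succ_iff_lt_or_eq.1 hi with hlt | rfl
    · rw [List.getElem_append_left hlt, if_neg, h.get i hlt]
      intro he
      exact hk (he ▸ List.getElem_mem hlt)
    · simp
  · intro k' hk'
    rw [List.mem_append, List.mem_singleton, not_or] at hk'
    rw [Data.get_set, if_neg hk'.2, h.none k' hk'.1]

/-- Names are positions in the list of entries, and these do not move when the list grows; names
given earlier stay valid. -/
theorem get_prefix {t' : Data} {E' : List Data} (h : Interned t E) (h' : Interned t' E')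
    (hp : E <+: E') {k : Data} (hk : k ∈ E) : t'.get k = t.get k := by
  obtain ⟨F, rfl⟩ := hp
  obtain ⟨i, hi, rfl⟩ := List.mem_iff_getElem.1 hk
  rw [h.get i hi, ← h'.get i (by simp; omega), List.getElem_append_left hi]

end Interned

theorem Impl.mark : Impl Data.mark (fun _ => 0) :=
  (Impl.dcons.comp (Impl.pair (Impl.const Data.nil) Impl.encode)).mono fun _ => by simp

/-! ### Counting views: the program -/

namespace CountViews

/-- A node of a level list: its label and its outgoing edges. -/
abbrev Cell : Type := Data × List (Data × Data × Data × Unit)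

/-- The map `m` sends positions in the next level to current class names, so the key describes a
node by the classes of its successors. -/
def cellKey (m : Data) (x : Cell) : Data :=
  enc (x.1, x.2.map fun e => (e.1, e.2.1, m.get e.2.2.1))

/-- A table of keys, the number of keys, and the number of keys with label in a given set. -/
abbrev Tally : Type := Data × ℕ × ℕ

/-- The head of a key is the label of the node, which is looked up in the set `s`. A new key is
named by the number of keys before it, so names stay short. -/
def tally (s : Data) (k : Data) (t : Tally) : Tally :=
  if (t.1.get k).toBool then t else
    (t.1.set k (Data.mark t.2.1), t.2.1 + 1, if (s.get k.hd).toBool then t.2.2 + 1 else t.2.2)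

/-- The last component of the state is the position in the level; the middle one collects the class
names by position. -/
def classStep (e : Data × Data) (st : Tally × Data × ℕ) (x : Cell) : Tally × Data × ℕ :=
  let k := cellKey e.1 x
  let t := tally e.2 k st.1
  (t, st.2.1.set (enc st.2.2) (t.1.get k), st.2.2 + 1)

def classStepCost (e : Data × Data) (st : Tally × Data × ℕ) (x : Cell) : ℕ :=
  (x.2.map fun e => e.2.2.1.size + 1).sum + (cellKey e.1 x).size + st.1.2.1.size +
    st.1.2.2.size + st.2.2.size

def classLevelStep (s : Data) (st : List (List Cell) × Tally × List Data) (m : Data) :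
    List (List Cell) × Tally × List Data :=
  let r := (st.1.headD []).foldl (classStep (m, s)) (st.2.1, Data.nil, 0)
  (st.1.tail, r.1, r.2.1 :: st.2.2)

def classLevelCost (s : Data) (st : List (List Cell) × Tally × List Data) (m : Data) : ℕ :=
  Impl.foldCost (classStepCost (m, s)) (classStep (m, s)) (st.2.1, Data.nil, 0) (st.1.headD [])

/-- Level `j` is classified by means of the map of level `j + 1`, so a round returns one map fewer.
The tally starts afresh and is shared by all levels of the round. -/
def classRound (e : List (List Cell) × Data) (st : List Data × Tally) (_ : Unit) :
    List Data × Tally :=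
  let r := st.1.tail.foldl (classLevelStep e.2) (e.1, (Data.nil, 0, 0), [])
  (r.2.2.reverse, r.2.1)

def classRoundCost (e : List (List Cell) × Data) (st : List Data × Tally) (_ : Unit) : ℕ :=
  Impl.foldCost (classLevelCost e.2) (classLevelStep e.2) (e.1, (Data.nil, 0, 0), []) st.1.tail

def labelSet (S : List Data) : Data := S.foldl (fun m z => m.set z (enc true)) Data.nil

/-- There are `n - 1` rounds, hence the `tail`. The empty initial maps answer `nil` everywhere, that
is, they put all nodes into one class, as trees of depth `0` do. -/
def countViews (x : ℕ × List Data × List (List Cell) × Unit) : ℕ × ℕ × Unit :=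
  let r := (List.replicate x.1 ()).tail.foldl (classRound (x.2.2.1, labelSet x.2.1))
    (x.2.2.1.map fun _ => Data.nil, (Data.nil, 0, 0))
  (r.2.2.1, r.2.2.2, ())

def countViewsCost (x : ℕ × List Data × List (List Cell) × Unit) : ℕ :=
  x.1 + (x.2.1.map fun z => z.size + 1).sum + x.2.2.1.length +
    Impl.foldCost (classRoundCost (x.2.2.1, labelSet x.2.1)) (classRound (x.2.2.1, labelSet x.2.1))
      (x.2.2.1.map fun _ => Data.nil, (Data.nil, 0, 0)) (List.replicate x.1 ()).tail

open Impl

theorem impl_cellKey : Impl (fun x : Data × Cell => cellKey x.1 x.2)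
    (fun x => (x.2.2.map fun e => e.2.2.1.size + 1).sum) := by
  have he : Impl (fun x : (Data × Cell) × (Data × Data × Data × Unit) => x.2) (fun _ => 0) := snd
  have h := Impl.map (ε := Data × Cell) (l := fun x => x.2.2)
    (f := fun x e => (e.1, e.2.1, x.1.get e.2.2.1)) (snd.comp snd)
    ((pair (fst.comp he) (pair (fst.comp (snd.comp he)) (get.comp (pair (fst.comp fst)
      (fst.comp (snd.comp (snd.comp he))))))))
  refine (encode.comp (pair (fst.comp snd) h)).mono fun x => ?_
  simp

theorem impl_tally : Impl (fun x : Data × Data × Tally => tally x.1 x.2.1 x.2.2)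
    (fun x => x.2.1.size + x.2.2.2.1.size + x.2.2.2.2.size) := by
  have hk : Impl (fun x : Data × Data × Tally => x.2.1) (fun _ => 0) := fst.comp snd
  have ht : Impl (fun x : Data × Data × Tally => x.2.2) (fun _ => 0) := snd.comp snd
  have hn : Impl (fun x : Data × Data × Tally => x.2.2.2.1) _ := fst.comp (snd.comp ht)
  refine (ite (toBool.comp (get.comp (pair (fst.comp ht) hk))) ht
    (pair (set.comp (pair (fst.comp ht) (pair hk (mark.comp hn)))) (pair (succ.comp hn)
      (ite (toBool.comp (get.comp (pair fst (hd.comp hk)))) (succ.comp (snd.comp (snd.comp ht)))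
        (snd.comp (snd.comp ht)))))).mono' 4 fun x => ?_
  have : ∀ d : Data, d.hd.size ≤ d.size := fun d => by cases d <;> simp [Data.hd, Data.size]; omega
  have := this x.2.1
  dsimp only
  split_ifs <;> omega

theorem impl_classStep : Impl (fun x : (Data × Data) × (Tally × Data × ℕ) × Cell =>
    classStep x.1 x.2.1 x.2.2) (fun x => classStepCost x.1 x.2.1 x.2.2) := by
  let A := (Data × Data) × (Tally × Data × ℕ) × Cell
  have hk : Impl (fun x : A => cellKey x.1.1 x.2.2) _ :=
    impl_cellKey.comp (pair (fst.comp fst) (snd.comp snd))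
  have ht : Impl (fun x : A × Data => tally x.1.1.2 x.2 x.1.2.1.1) _ :=
    impl_tally.comp (pair (snd.comp (fst.comp fst)) (pair snd (fst.comp (fst.comp (snd.comp fst)))))
  have hm : Impl (fun x : (A × Data) × Tally => x.1.1.2.1.2) (fun _ => 0) :=
    snd.comp (fst.comp (snd.comp (fst.comp fst)))
  have hr : Impl (fun x : (A × Data) × Tally => (x.2, x.1.1.2.1.2.1.set (enc x.1.1.2.1.2.2)
      (x.2.1.get x.1.2), x.1.1.2.1.2.2 + 1)) _ :=
    pair snd (pair (set.comp (pair (fst.comp hm) (pair (encode.comp (snd.comp hm))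
      (get.comp (pair (fst.comp snd) (snd.comp fst)))))) (succ.comp (snd.comp hm)))
  refine ((hr.comp (pair id ht)).comp (pair id hk)).mono' 8 fun x => ?_
  have := Data.size_ofNat x.2.1.2.2
  change (enc x.2.1.2.2 : Data).size ≤ _ at this
  simp only [classStepCost]
  omega

theorem impl_classLevelStep :
    Impl (fun x : Data × (List (List Cell) × Tally × List Data) × Data =>
      classLevelStep x.1 x.2.1 x.2.2) (fun x => classLevelCost x.1 x.2.1 x.2.2) := by
  let A := Data × (List (List Cell) × Tally × List Data) × Data
  have h1 := foldl (ε := (Data × Data) × List Cell × Tally) (l := fun x => x.2.1)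
    (s₀ := fun x => (x.2.2, Data.nil, 0)) (step := fun x => classStep x.1)
    (fst.comp snd) (pair (snd.comp snd) (const _)) (impl_classStep.comp (pair (fst.comp fst) snd))
  have h2 : Impl (fun x : A => ((x.2.2, x.1), x.2.1.1.headD [], x.2.1.2.1)) _ :=
    pair (pair (snd.comp snd) fst) (pair (headD.comp (fst.comp (fst.comp snd)))
      (fst.comp (snd.comp (fst.comp snd))))
  have h3 : Impl (fun x : A × (Tally × Data × ℕ) => (x.1.2.1.1.tail, x.2.1, x.2.2.1 :: x.1.2.1.2.2))
      _ := pair (tail.comp (fst.comp (fst.comp (snd.comp fst)))) (pair (fst.comp snd)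
        (cons.comp (pair (fst.comp (snd.comp snd)) (snd.comp (snd.comp (fst.comp (snd.comp fst)))))))
  refine (h3.comp (pair id (h1.comp h2))).mono fun x => ?_
  simp [classLevelCost]

theorem impl_classRound : Impl (fun x : (List (List Cell) × Data) × (List Data × Tally) × Unit =>
    classRound x.1 x.2.1 x.2.2) (fun x => classRoundCost x.1 x.2.1 x.2.2) := by
  have h1 := foldl (ε := (List (List Cell) × Data) × (List Data × Tally) × Unit)
    (l := fun x => x.2.1.1.tail) (s₀ := fun x => (x.1.1, (Data.nil, 0, 0), []))
    (step := fun x => classLevelStep x.1.2) (tail.comp (fst.comp (fst.comp snd)))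
    (pair (fst.comp fst) (const _)) (impl_classLevelStep.comp (pair (snd.comp (fst.comp fst)) snd))
  have h2 : Impl (fun x : List (List Cell) × Tally × List Data => (x.2.2.reverse, x.2.1)) _ :=
    pair (reverse.comp (snd.comp snd)) (fst.comp snd)
  have hlen : ∀ (s : Data) (l : List Data) (st : List (List Cell) × Tally × List Data),
      (l.foldl (classLevelStep s) st).2.2.length = st.2.2.length + l.length := by
    intro s l
    induction l with
    | nil => intro st; rfl
    | cons a l ih => intro st; rw [List.foldl_cons, ih]; simp [classLevelStep]; omega
  have hle : ∀ (s : Data) (l : List Data) (st : List (List Cell) × Tally × List Data),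
      l.length ≤ foldCost (classLevelCost s) (classLevelStep s) st l := by
    intro s l
    induction l with
    | nil => intro st; simp
    | cons a l ih => intro st; simp only [foldCost, List.length_cons]; have := ih (classLevelStep s st a); omega
  refine (h2.comp h1).mono' 2 fun x => ?_
  simp only [hlen, classRoundCost, zero_add]
  change foldCost (classLevelCost x.1.2) _ _ _ + _ ≤ _
  have := hle x.1.2 x.2.1.1.tail (x.1.1, (Data.nil, 0, 0), [])
  simp only [List.length_nil] at *
  omega

theorem impl_labelSet : Impl labelSet (fun S => (S.map fun z => z.size + 1).sum) := by
  have h := foldl (ε := List Data) (step := fun _ m z => m.set z (enc true)) (l := fun S => S)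
    (s₀ := fun _ => Data.nil) id (const _)
    (set.comp (pair (fst.comp snd) (pair (snd.comp snd) (const (enc true)))))
  refine h.mono fun S => ?_
  simp only [zero_add, add_zero]
  exact (foldCost_eq_sum (fun z : Data => z.size) S _).le

theorem impl_countViews : Impl countViews countViewsCost := by
  let A := ℕ × List Data × List (List Cell) × Unit
  have h1 : Impl (fun x : A => (x, labelSet x.2.1)) _ := pair id (impl_labelSet.comp (fst.comp snd))
  have hl : Impl (fun x : A × Data => (List.replicate x.1.1 ()).tail) _ :=
    tail.comp (unary.comp (fst.comp fst))
  have hm : Impl (fun x : A × Data => x.1.2.2.1.map fun _ => Data.nil) _ :=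
    Impl.map (f := fun _ _ => Data.nil) (fst.comp (snd.comp (snd.comp fst))) (const Data.nil)
  have hp : Impl (fun x : (A × Data) × (List Data × Tally) × Unit =>
      ((x.1.1.2.2.1, x.1.2), x.2)) _ :=
    pair (pair (fst.comp (snd.comp (snd.comp (fst.comp fst)))) (snd.comp fst)) snd
  have hs : Impl (fun x : (A × Data) × (List Data × Tally) × Unit =>
      classRound (x.1.1.2.2.1, x.1.2) x.2.1 x.2.2)
      (fun x => classRoundCost (x.1.1.2.2.1, x.1.2) x.2.1 x.2.2) :=
    (Impl.comp impl_classRound hp).mono fun x => by simp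
  have h2 := foldl (step := fun x : A × Data => classRound (x.1.2.2.1, x.2)) hl
    (pair hm (const ((Data.nil, 0, 0) : Tally))) hs
  have h3 : Impl (fun r : List Data × Tally => (r.2.2.1, r.2.2.2, ())) _ :=
    pair (fst.comp (snd.comp snd)) (pair (snd.comp (snd.comp snd)) (const ()))
  refine (h3.comp (h2.comp h1)).mono' 2 fun x => ?_
  simp only [countViewsCost, zero_add, add_zero, List.map_const', List.sum_replicate, smul_eq_mul,
    mul_one]
  change _ + (_ + _ + foldCost (classRoundCost (x.2.2.1, labelSet x.2.1)) _ _ _) ≤ _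
  omega

end CountViews

/-! ### Counting views: correctness and cost -/

namespace CountViews

structure TallyGood (s : Data) (t : Tally) (E : List Data) : Prop where
  interned : Interned t.1 E
  length : t.2.1 = E.length
  countP : t.2.2 = E.countP fun k => (s.get k.hd).toBool

theorem tallyGood_empty (s : Data) : TallyGood s (Data.nil, 0, 0) [] := ⟨.empty, rfl, rfl⟩

theorem TallyGood.tally {s : Data} {t : Tally} {E : List Data} (h : TallyGood s t E) (k : Data) :
    ∃ E', TallyGood s (tally s k t) E' ∧ E <+: E' ∧ k ∈ E' ∧ ∀ x ∈ E', x ∈ E ∨ x = k := by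
  by_cases hk : k ∈ E
  · refine ⟨E, ?_, List.prefix_rfl, hk, fun x hx => Or.inl hx⟩
    rw [CountViews.tally, if_pos (h.interned.toBool_get.2 hk)]
    exact h
  · refine ⟨E ++ [k], ?_, List.prefix_append _ _, by simp, fun x hx => by simpa using hx⟩
    rw [CountViews.tally, if_neg (by rw [h.interned.toBool_get]; exact hk)]
    refine ⟨?_, by simp [h.length], ?_⟩
    · simp only [h.length]
      exact h.interned.push hk
    · simp only [h.countP, List.countP_append, List.countP_singleton]
      split_ifs <;> rfl

/-- All keys lie in a set `K` of at most `n` elements. The table therefore never exceeds `n`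
entries, and arithmetic on its counters costs only `n.size`. -/
theorem level_spec {s m : Data} {level : List Cell} {t : Tally} {E : List Data} {n B : ℕ}
    (K : Finset Data) (hK : K.card ≤ n) (hE : TallyGood s t E) (hEK : ∀ x ∈ E, x ∈ K)
    (hkey : ∀ x ∈ level, cellKey m x ∈ K) (hlen : level.length ≤ n)
    (hB : ∀ x ∈ level, (x.2.map fun e => e.2.2.1.size + 1).sum + (cellKey m x).size ≤ B) :
    let r := level.foldl (classStep (m, s)) (t, Data.nil, 0)
    (∃ E', TallyGood s r.1 E' ∧ E <+: E' ∧ (∀ x ∈ E', x ∈ K) ∧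
      (∀ x ∈ E', x ∈ E ∨ ∃ y ∈ level, cellKey m y = x) ∧
      ∀ i (h : i < level.length), cellKey m level[i] ∈ E' ∧
        r.2.1.get (enc i) = r.1.1.get (cellKey m level[i])) ∧
    Impl.foldCost (classStepCost (m, s)) (classStep (m, s)) (t, Data.nil, 0) level ≤
      (B + 3 * n.size + 1) * n := by
  classical
  let I : Tally × Data × ℕ → List Cell → Prop := fun st rest =>
    st.2.2 ≤ level.length ∧ rest = level.drop st.2.2 ∧
    ∃ E', TallyGood s st.1 E' ∧ E <+: E' ∧ (∀ x ∈ E', x ∈ K) ∧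
      (∀ x ∈ E', x ∈ E ∨ ∃ y ∈ level, cellKey m y = x) ∧
      ∀ i (_ : i < st.2.2) (h : i < level.length), cellKey m level[i] ∈ E' ∧
        st.2.1.get (enc i) = st.1.1.get (cellKey m level[i])
  have hcard : ∀ E' : List Data, E'.Nodup → (∀ x ∈ E', x ∈ K) → E'.length ≤ n := by
    intro E' h1 h2
    rw [← List.toFinset_card_of_nodup h1]
    exact (Finset.card_le_card fun x hx => h2 x (List.mem_toFinset.1 hx)).trans hK
  have hstep : ∀ st x rest, I st (x :: rest) →
      classStepCost (m, s) st x ≤ B + 3 * n.size ∧ I (classStep (m, s) st x) rest := by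
    rintro ⟨t, nm, k⟩ x rest ⟨h1, h2, E', g1, g2, g3, g4, g5⟩
    dsimp only at h1 h2 g1 g5
    have hk : k < level.length := by
      by_contra hk
      rw [List.drop_eq_nil_of_le (by omega)] at h2
      exact absurd h2 (by simp)
    rw [List.drop_eq_getElem_cons hk, List.cons.injEq] at h2
    obtain ⟨rfl, h2⟩ := h2
    have hmem : level[k] ∈ level := List.getElem_mem hk
    constructor
    · have a1 := hcard E' g1.interned.nodup g3
      have a2 := hB _ hmem
      have a3 : t.2.1.size ≤ n.size := Nat.size_le_size (g1.length ▸ a1)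
      have a4 : t.2.2.size ≤ n.size :=
        Nat.size_le_size (g1.countP ▸ List.countP_le_length.trans a1)
      have a5 : k.size ≤ n.size := Nat.size_le_size (by omega)
      simp only [classStepCost]
      omega
    · obtain ⟨E'', f1, f2, f3, f4⟩ := g1.tally (cellKey m level[k])
      refine ⟨hk, h2, E'', f1, g2.trans f2, fun x hx => ?_, fun x hx => ?_, ?_⟩
      · rcases f4 x hx with h | rfl
        · exact g3 x h
        · exact hkey _ hmem
      · rcases f4 x hx with h | rfl
        · exact g4 x h
        · exact Or.inr ⟨_, hmem, rfl⟩
      · intro i hi hi'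
        simp only [classStep] at hi ⊢
        rw [Data.get_set]
        by_cases hik : i = k
        · subst hik
          exact ⟨f3, by rw [if_pos rfl]⟩
        · have hne : (enc i : Data) ≠ enc k := fun h => hik (Data.ofNat_injective h)
          obtain ⟨e1, e2⟩ := g5 i (by omega) hi'
          refine ⟨f2.subset e1, ?_⟩
          rw [if_neg hne, e2]
          exact (g1.interned.get_prefix f1.interned f2 e1).symm
  obtain ⟨hI, hc⟩ := Impl.foldl_inv (fun _ => B + 3 * n.size) I hstep level (t, Data.nil, 0)
    ⟨Nat.zero_le _, rfl, E, hE, List.prefix_rfl, hEK, fun x hx => Or.inl hx,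
      fun i hi => absurd hi (Nat.not_lt_zero _)⟩
  constructor
  · obtain ⟨h1, h2, E', g1, g2, g3, g4, g5⟩ := hI
    refine ⟨E', g1, g2, g3, g4, fun i h => g5 i ?_ h⟩
    have := congrArg List.length h2
    rw [List.length_drop, List.length_nil] at this
    omega
  · refine hc.trans ?_
    rw [List.map_const', List.sum_replicate, smul_eq_mul, mul_comm]
    exact Nat.mul_le_mul_left _ hlen

/-- Induction over the levels. One table serves them all, so class names are comparable between
levels, and names given for early levels persist. -/
theorem round_spec {s : Data} {c : List (List Cell)} {maps : List Data} {st : Tally} {n B : ℕ}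
    (K : Finset Data) (hK : K.card ≤ n)
    (hkey : ∀ j, j + 1 < maps.length → ∀ x ∈ c.getD j [], cellKey (maps.getD (j + 1) Data.nil) x ∈ K)
    (hlen : ∀ j, (c.getD j []).length ≤ n)
    (hB : ∀ j, j + 1 < maps.length → ∀ x ∈ c.getD j [], (x.2.map fun e => e.2.2.1.size + 1).sum +
      (cellKey (maps.getD (j + 1) Data.nil) x).size ≤ B) :
    let r := classRound (c, s) (maps, st) ()
    r.1.length = maps.length - 1 ∧
    (∃ E, TallyGood s r.2 E ∧ (∀ x ∈ E, x ∈ K) ∧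
      ∀ j, j + 1 < maps.length → ∀ i (h : i < (c.getD j []).length),
        cellKey (maps.getD (j + 1) Data.nil) (c.getD j [])[i] ∈ E ∧
        (r.1.getD j Data.nil).get (enc i) =
          r.2.1.get (cellKey (maps.getD (j + 1) Data.nil) (c.getD j [])[i])) ∧
    classRoundCost (c, s) (maps, st) () ≤ ((B + 3 * n.size + 1) * n + 1) * maps.length := by
  let I : List (List Cell) × Tally × List Data → List Data → Prop := fun st rest =>
    st.2.2.length ≤ maps.tail.length ∧ rest = maps.tail.drop st.2.2.length ∧
    st.1 = c.drop st.2.2.length ∧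
    ∃ E, TallyGood s st.2.1 E ∧ (∀ x ∈ E, x ∈ K) ∧
      ∀ j, j < st.2.2.length → ∀ i (h : i < (c.getD j []).length),
        cellKey (maps.getD (j + 1) Data.nil) (c.getD j [])[i] ∈ E ∧
        (st.2.2.reverse.getD j Data.nil).get (enc i) =
          st.2.1.1.get (cellKey (maps.getD (j + 1) Data.nil) (c.getD j [])[i])
  have htail : maps.tail.length = maps.length - 1 := List.length_tail
  have hstep : ∀ st m rest, I st (m :: rest) →
      classLevelCost s st m ≤ (B + 3 * n.size + 1) * n ∧ I (classLevelStep s st m) rest := by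
    rintro ⟨lv, t, ms⟩ m rest ⟨h1, h2, h3, E, g1, g3, g5⟩
    dsimp only at h1 h2 h3 g1 g5
    have hk : ms.length < maps.tail.length := by
      by_contra hk
      rw [List.drop_eq_nil_of_le (by omega)] at h2
      exact absurd h2 (by simp)
    rw [List.drop_eq_getElem_cons hk, List.cons.injEq] at h2
    obtain ⟨hm, h2⟩ := h2
    have hm' : maps.getD (ms.length + 1) Data.nil = m := by
      rw [hm, List.getElem_tail, List.getD_eq_getElem]
    have hlv : lv.headD [] = c.getD ms.length [] := by
      rw [h3, List.headD_eq_head?_getD, List.head?_drop, List.getD_eq_getElem?_getD]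
    have := level_spec (t := t) (E := E) K hK g1 g3 (hm' ▸ hkey ms.length (by omega))
      (hlen ms.length) (hm' ▸ hB ms.length (by omega))
    obtain ⟨⟨E', f1, f2, f3, f4, f5⟩, hcost⟩ := this
    refine ⟨?_, ?_⟩
    · simpa only [classLevelCost, hlv] using hcost
    · simp only [classLevelStep, hlv, I, List.length_cons]
      refine ⟨hk, h2, ?_, E', f1, f3, ?_⟩
      · rw [h3, List.tail_drop]
      · intro j hj i hi
        rcases Nat.lt_succ_iff_lt_or_eq.1 hj with hj' | rfl
        · obtain ⟨e1, e2⟩ := g5 j hj' i hi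
          refine ⟨f2.subset e1, ?_⟩
          rw [List.reverse_cons, List.getD_append _ _ _ _ (by simpa using hj'), e2]
          exact (g1.interned.get_prefix f1.interned f2 e1).symm
        · obtain ⟨e1, e2⟩ := f5 i hi
          rw [hm']
          refine ⟨e1, ?_⟩
          rw [List.reverse_cons, List.getD_append_right _ _ _ _ (by simp)]
          simpa using e2
  obtain ⟨hI, hc⟩ := Impl.foldl_inv (fun _ => (B + 3 * n.size + 1) * n) I hstep maps.tail
    (c, (Data.nil, 0, 0), []) ⟨Nat.zero_le _, rfl, rfl, [], tallyGood_empty s, by simp,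
      fun j hj => absurd hj (Nat.not_lt_zero _)⟩
  obtain ⟨h1, h2, h3, E, g1, g3, g5⟩ := hI
  have hl : (maps.tail.foldl (classLevelStep s) (c, (Data.nil, 0, 0), [])).2.2.length =
      maps.tail.length := by
    have := congrArg List.length h2
    rw [List.length_drop, List.length_nil] at this
    omega
  refine ⟨?_, ⟨E, g1, g3, fun j hj i hi => g5 j (by rw [hl]; omega) i hi⟩, ?_⟩
  · simp only [classRound, List.length_reverse]
    rw [hl, htail]
  · refine hc.trans ?_
    rw [List.map_const', List.sum_replicate, smul_eq_mul, mul_comm]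
    exact Nat.mul_le_mul_left _ (by omega)

end CountViews

namespace Impl

theorem exec_start {α β : Type} [Enc α] [Enc β] {f : α → β} {T : α → ℕ} (h : Impl f T) :
    ∃ (C : ℕ) (p : Program), ∀ a, ∃ s t, Exec p (Store.start (enc a)) s t ∧ t ≤ C * (T a + 1) ∧
      s.output = enc (f a) := by
  obtain ⟨C, h⟩ := h
  obtain ⟨p, h⟩ := h 0
  refine ⟨C + 2, .seq p (.assign 3 (.var 0)), fun a => ?_⟩
  obtain ⟨s, t, h1, h2, h3, -⟩ := h (Store.start (enc a)) a (by simp [Store.start])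
  refine ⟨_, _, .seq h1 (.assign _ _ _), ?_, ?_⟩
  · simp only [Expr.cost]; nlinarith
  · simp [Store.output, Expr.eval, h3]

end Impl

theorem size_enc_list_le {α : Type} [Enc α] {B : ℕ} :
    ∀ l : List α, (∀ a ∈ l, (enc a : Data).size ≤ B) → (enc l : Data).size ≤ (B + 1) * l.length + 1
  | [], _ => by simp [enc_nil, Data.size]
  | a :: l, h => by
    have h1 := h a (by simp)
    have h2 := size_enc_list_le l fun b hb => h b (by simp [hb])
    rw [enc_cons, Data.size, List.length_cons]
    nlinarith

theorem size_enc_nat_le {k n : ℕ} (h : k ≤ n) : (enc k : Data).size ≤ 4 * n.size + 1 :=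
  (Data.size_ofNat k).trans (by have := Nat.size_le_size h; omega)

theorem size_enc_int_le {z : ℤ} {b : ℕ} (h : |z| < 2 ^ b) : (Data.ofInt z).size ≤ 4 * b + 5 := by
  have h1 : z.natAbs < 2 ^ b := by zify; exact h
  have h2 := Nat.size_le.2 h1
  have h3 := Data.size_ofNat z.natAbs
  have h4 : (Data.ofBool (decide (z < 0))).size ≤ 3 := by
    cases decide (z < 0) <;> simp [Data.ofBool, Data.size]
  simp only [Data.ofInt, Data.size]
  omega

/-! ### Degrees, walks, and the shape of layouts -/

namespace Network

variable {n : ℕ} (N : Network n) (X : Fin n → ℤ)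

theorem deg_le_maxDeg (v : Fin n) : N.deg v ≤ N.maxDeg := Finset.le_sup (Finset.mem_univ v)

theorem deg_lt (v : Fin n) : N.deg v < n := by
  have h1 : Function.Injective fun i : Option (Fin (N.deg v)) => i.elim v (N.nbr v) := by
    intro a b hab
    have hne : ∀ i, N.nbr v i ≠ v := fun i h => (N.adj_nbr v i).ne h.symm
    cases a with
    | none => cases b with
      | none => rfl
      | some b => exact absurd hab.symm (hne b)
    | some a => cases b with
      | none => exact absurd hab (hne a)
      | some b => exact congrArg some ((N.port v).symm.injective (Subtype.ext hab))
  have := Fintype.card_le_of_injective _ h1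
  simp at this
  omega

theorem deg_pos (hn : 2 ≤ n) (v : Fin n) : 0 < N.deg v := by
  have : Nontrivial (Fin n) := Fin.nontrivial_iff_two_le.2 hn
  obtain ⟨w, hw⟩ := N.connected.preconnected.exists_adj_of_nontrivial v
  exact Fin.pos (N.portTo hw)

/-- With at least two parties, connectedness gives every party a port, so no walk gets stuck and no
level up to `h` is empty. -/
theorem exists_walk_length_eq (hn : 2 ≤ n) (v : Fin n) (k : ℕ) :
    ∃ p : Σ w, N.graph.Walk v w, p.2.length = k := by
  induction k with
  | zero => exact ⟨⟨v, .nil⟩, rfl⟩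
  | succ k ih =>
    obtain ⟨p, rfl⟩ := ih
    exact ⟨N.ext p ⟨0, N.deg_pos hn _⟩, N.length_ext _ _⟩

theorem exists_walk_lt (v w : Fin n) : ∃ p : N.graph.Walk v w, p.length < n := by
  classical
  obtain ⟨p, hp⟩ := N.connected.preconnected.exists_isPath v w
  exact ⟨p, by simpa using hp.length_lt⟩

variable {N X}

/-- Within a level the position depends only on the end point of the walk. -/
theorem IsLayout.length_level_le {h : ℕ} {v : Fin n} {c : LevelList}
    {pos : (Σ w, N.graph.Walk v w) → ℕ} (hc : N.IsLayout X h v c pos) (j : ℕ) :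
    (c.getD j []).length ≤ n := by
  choose p h1 h2 h3 using fun k : Fin (c.getD j []).length => hc.surj j k k.2
  have : Function.Injective fun k => (p k).1 := by
    intro a b hab
    have := (hc.eq_iff (p a) (p b) (by rw [h1]; exact h3 a) (by rw [h1, h1])).2
      (congrArg _ hab)
    rw [h2, h2] at this
    exact Fin.ext this
  simpa using Fintype.card_le_of_injective _ this

theorem IsLayout.length_eq {h : ℕ} {v : Fin n} {c : LevelList}
    {pos : (Σ w, N.graph.Walk v w) → ℕ} (hn : 2 ≤ n) (hc : N.IsLayout X h v c pos) :
    c.length = h + 1 := by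
  refine le_antisymm (not_lt.1 fun hlt => ?_) (not_lt.1 fun hlt => ?_)
  · have h1 : c.getD (h + 1) [] = [] := by
      rw [← List.length_eq_zero_iff]
      by_contra h0
      obtain ⟨_, _, _, h3⟩ := hc.surj (h + 1) 0 (by omega)
      omega
    rw [List.getD_eq_getElem _ _ hlt] at h1
    exact hc.nonempty (h1 ▸ List.getElem_mem hlt)
  · obtain ⟨p, hp⟩ := N.exists_walk_length_eq hn v h
    have := hc.node p hp.le
    rw [hp, List.getD_eq_default _ _ (by omega)] at this
    simp at this

end Network

/-- A level list, ready for processing. -/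
def LevelList.toCells (c : LevelList) : List (List CountViews.Cell) :=
  c.map fun l => l.map fun a => (enc a.1, a.2.map fun e => (enc e.1.1, enc e.1.2, enc e.2, ()))

/-- The program can thus read the encoded list as cells without any conversion. -/
theorem LevelList.enc_toCells (c : LevelList) : (enc c.toCells : Data) = c.encode := by
  have h1 : ∀ es : List ((ℕ × ℕ) × ℕ), (enc (es.map fun e =>
      ((enc e.1.1 : Data), (enc e.1.2 : Data), (enc e.2 : Data), ())) : Data) =
        Data.ofList (es.map encodeEdge) := fun es => by
    change Data.ofList ((es.map _).map enc) = _
    rw [List.map_map]; rfl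
  have h2 : ∀ l : List (ℤ × List ((ℕ × ℕ) × ℕ)), (enc (l.map fun a => ((enc a.1 : Data),
      a.2.map fun e => ((enc e.1.1 : Data), (enc e.1.2 : Data), (enc e.2 : Data), ()))) : Data) =
        Data.ofList (l.map encodeNode) := fun l => by
    change Data.ofList ((l.map _).map enc) = _
    rw [List.map_map]
    refine congrArg _ (List.map_congr_left fun a _ => ?_)
    exact congrArg (Data.cons _) (h1 a.2)
  change Data.ofList ((c.map _).map enc) = _
  rw [List.map_map]
  exact congrArg _ (List.map_congr_left fun l _ => h2 l)

/-! ### Refinement of classes on a layout -/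

namespace Network

open CountViews

variable {n : ℕ} {N : Network n} {X : Fin n → ℤ}

/-- The key of a node that represents the party `a`, given names for the classes of parties. -/
def classKey (N : Network n) (X : Fin n → ℤ) (ι : Fin n → Data) (a : Fin n) : Data :=
  enc (Data.ofInt (X a), List.ofFn fun i : Fin (N.deg a) =>
    ((enc (i : ℕ) : Data), (enc (N.backPort a i : ℕ) : Data), ι (N.nbr a i)))

/-- A key compares exactly what one more level of unfolding compares; the port numbers `i` are list
positions and add no information. -/
theorem classKey_eq_iff {ι : Fin n → Data} {d : ℕ}
    (hι : ∀ a b, ι a = ι b ↔ N.preTree X d a = N.preTree X d b) (a b : Fin n) :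
    N.classKey X ι a = N.classKey X ι b ↔ N.preTree X (d + 1) a = N.preTree X (d + 1) b := by
  have hid : Function.Injective (enc : Data → Data) := Function.injective_id
  have hinj := enc_prod_injective hid (enc_list_injective
    (enc_prod_injective hid (enc_prod_injective hid hid)))
  have h1 : N.preTree X (d + 1) a = N.preTree X (d + 1) b ↔ _ := unfoldTree_succ_eq
  rw [h1, N.map_out_eq N, classKey, classKey, hinj.eq_iff, Prod.mk.injEq,
    Data.ofInt_injective.eq_iff, List.ext_get_iff]
  simp only [List.length_ofFn, List.get_eq_getElem, List.getElem_ofFn, Prod.mk.injEq, true_and]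
  refine and_congr_right fun _ => and_congr_right fun _ => forall_congr' fun i =>
    forall_congr' fun hi => forall_congr' fun hi' => ?_
  rw [hι]
  exact and_congr_left fun _ => Data.ofNat_injective.eq_iff

theorem size_classKey_le {b : ℕ} (hX : ∀ v, |X v| < 2 ^ b) {ι : Fin n → Data}
    (hι : ∀ a, (ι a).size ≤ 4 * n.size + 3) (a : Fin n) :
    (N.classKey X ι a).size ≤ 4 * b + 7 + (12 * n.size + 8) * N.maxDeg := by
  have h1 := size_enc_int_le (hX a)
  have hd := N.deg_lt a
  have h2 := size_enc_list_le (B := 12 * n.size + 7) (List.ofFn fun i : Fin (N.deg a) =>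
    ((enc (i : ℕ) : Data), (enc (N.backPort a i : ℕ) : Data), ι (N.nbr a i))) (by
      intro x hx
      obtain ⟨i, rfl⟩ := (List.mem_ofFn' _ _).1 hx
      have e1 := size_enc_nat_le (i.2.le.trans hd.le)
      have e2 := size_enc_nat_le ((N.backPort a i).2.le.trans (N.deg_lt _).le)
      have e3 := hι (N.nbr a i)
      simp only [enc_pair, enc_data, Data.size]
      omega)
  have h3 := N.deg_le_maxDeg a
  rw [List.length_ofFn, show 12 * n.size + 7 + 1 = 12 * n.size + 8 from rfl] at h2
  simp only [classKey, enc_pair, enc_data, Data.size]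
  have := Nat.mul_le_mul_left (12 * n.size + 8) h3
  omega

section

variable {m b : ℕ} {v : Fin n} {c : LevelList} {pos : (Σ w, N.graph.Walk v w) → ℕ}

theorem IsLayout.cell (hc : N.IsLayout X (2 * m) v c pos) (p : Σ w, N.graph.Walk v w)
    (hp : p.2.length < 2 * m) :
    (c.toCells.getD p.2.length [])[pos p]? = some (Data.ofInt (X p.1),
      List.ofFn fun i : Fin (N.deg p.1) => ((enc (i : ℕ) : Data),
        (enc (N.backPort p.1 i : ℕ) : Data), (enc (pos (N.ext p i)) : Data), ())) := by
  have h := hc.node p hp.le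
  rw [if_pos hp] at h
  have h2 : c.toCells.getD p.2.length [] = (c.getD p.2.length []).map fun a =>
      ((enc a.1 : Data), a.2.map fun e =>
        ((enc e.1.1 : Data), (enc e.1.2 : Data), (enc e.2 : Data), ())) := by
    rw [LevelList.toCells, List.getD_eq_getElem?_getD, List.getD_eq_getElem?_getD, List.getElem?_map]
    cases (c)[p.2.length]? <;> rfl
  rw [h2, List.getElem?_map, h]
  simp [List.map_ofFn, Function.comp_def]
  rfl

/-- What is known after `d` rounds: the class identifiers of all nodes, by level. -/
structure ClassesGood (N : Network n) (X : Fin n → ℤ) (m : ℕ)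
    (pos : (Σ w, N.graph.Walk v w) → ℕ) (d : ℕ) (maps : List Data) (ι : Fin n → Data) : Prop where
  length : maps.length + d = 2 * m + 1
  iff : ∀ a b, ι a = ι b ↔ N.preTree X d a = N.preTree X d b
  size : ∀ a, (ι a).size ≤ 4 * n.size + 3
  get : ∀ p : Σ w, N.graph.Walk v w, p.2.length + d ≤ 2 * m →
    (maps.getD p.2.length Data.nil).get (enc (pos p)) = ι p.1

/-- The new class of a party is the name of its key. Every party is the end of a walk of at most `m
= n - 1` edges, and level `m` is still processed because `d < m`. So each party's key enters the
table, and nothing else does. -/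
theorem IsLayout.round (hc : N.IsLayout X (2 * m) v c pos) (hn : n = m + 1)
    (hX : ∀ v, |X v| < 2 ^ b) {d : ℕ} (hd : d < m) {maps : List Data} {ι : Fin n → Data}
    (hm : ClassesGood N X m pos d maps ι) (s : Data) (st : Tally) :
    let r := classRound (c.toCells, s) (maps, st) ()
    (∃ ι', ClassesGood N X m pos (d + 1) r.1 ι') ∧
    (∃ E, TallyGood s r.2 E ∧ ∀ x, x ∈ E ↔ ∃ a, x = N.classKey X ι a) ∧
    classRoundCost (c.toCells, s) (maps, st) () ≤
      ((4 * b + 7 + (16 * n.size + 10) * N.maxDeg + 3 * n.size + 1) * n + 1) * (2 * m + 1) := by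
  classical
  have hlev : ∀ j, (c.toCells.getD j []).length = (c.getD j []).length := by
    intro j
    rw [LevelList.toCells, List.getD_eq_getElem?_getD, List.getD_eq_getElem?_getD, List.getElem?_map]
    cases (c)[j]? <;> simp
  have hkey : ∀ p : Σ w, N.graph.Walk v w, p.2.length + 1 < maps.length →
      ∃ h : pos p < (c.toCells.getD p.2.length []).length,
      cellKey (maps.getD (p.2.length + 1) Data.nil) (c.toCells.getD p.2.length [])[pos p] =
        N.classKey X ι p.1 ∧
      (((c.toCells.getD p.2.length [])[pos p]).2.map fun e => e.2.2.1.size + 1).sum ≤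
        (4 * n.size + 2) * N.maxDeg := by
    intro p hp
    have hl := hm.length
    obtain ⟨h1, h2⟩ := List.getElem?_eq_some_iff.1 (hc.cell p (by omega))
    refine ⟨h1, ?_, ?_⟩
    · rw [h2, cellKey, classKey, List.map_ofFn]
      congr 3
      funext i
      have := hm.get (N.ext p i) (by rw [length_ext]; omega)
      rw [length_ext] at this
      simp only [Function.comp, this]
      rfl
    · rw [h2, List.map_ofFn]
      refine (List.sum_le_card_nsmul _ (4 * n.size + 2) fun x hx => ?_).trans ?_
      · obtain ⟨i, rfl⟩ := (List.mem_ofFn' _ _).1 hx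
        have hnode := hc.node (N.ext p i) (by rw [length_ext]; omega)
        have := (List.getElem?_eq_some_iff.1 hnode).1
        have := size_enc_nat_le (this.le.trans (hc.length_level_le _))
        simp only [Function.comp]
        omega
      · rw [List.length_ofFn, smul_eq_mul, mul_comm]
        exact Nat.mul_le_mul_left _ (N.deg_le_maxDeg _)
  have hall : ∀ j, j + 1 < maps.length → ∀ i, i < (c.toCells.getD j []).length →
      ∃ p : Σ w, N.graph.Walk v w, p.2.length = j ∧ pos p = i := by
    intro j _ i hi
    rw [hlev] at hi
    obtain ⟨p, h1, h2, -⟩ := hc.surj j i hi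
    exact ⟨p, h1, h2⟩
  have hcell : ∀ j, j + 1 < maps.length → ∀ x ∈ c.toCells.getD j [], ∃ a,
      cellKey (maps.getD (j + 1) Data.nil) x = N.classKey X ι a ∧
      (x.2.map fun e => e.2.2.1.size + 1).sum ≤ (4 * n.size + 2) * N.maxDeg := by
    intro j hj x hx
    obtain ⟨i, hi, rfl⟩ := List.mem_iff_getElem.1 hx
    obtain ⟨p, rfl, rfl⟩ := hall j hj i hi
    obtain ⟨_, h1, h2⟩ := hkey p hj
    exact ⟨p.1, h1, h2⟩
  have hspec := round_spec (s := s) (c := c.toCells) (maps := maps) (st := st) (n := n)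
    (B := 4 * b + 7 + (16 * n.size + 10) * N.maxDeg) (Finset.univ.image (N.classKey X ι))
    (by simpa using Finset.card_image_le (s := Finset.univ) (f := N.classKey X ι))
    (fun j hj x hx => by
      obtain ⟨a, h, -⟩ := hcell j hj x hx
      rw [h]; exact Finset.mem_image_of_mem _ (Finset.mem_univ a))
    (fun j => by rw [hlev]; exact hc.length_level_le j)
    (fun j hj x hx => by
      obtain ⟨a, h, h'⟩ := hcell j hj x hx
      have := size_classKey_le (N := N) hX hm.size a
      rw [h]
      have e : (16 * n.size + 10) * N.maxDeg =
        (4 * n.size + 2) * N.maxDeg + (12 * n.size + 8) * N.maxDeg := by ring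
      omega)
  obtain ⟨h1, ⟨E, g1, g2, g3⟩, hcost⟩ := hspec
  have hl := hm.length
  -- The reason for the depth `2 * m`: `m` levels are used up by refinement and `m` more edges are
  -- needed to reach all parties.
  have hreach : ∀ a, ∃ p : Σ w, N.graph.Walk v w, p.1 = a ∧ p.2.length ≤ m := by
    intro a
    obtain ⟨p, hp⟩ := N.exists_walk_lt v a
    exact ⟨⟨a, p⟩, rfl, by simp only; omega⟩
  have hmem : ∀ a, N.classKey X ι a ∈ E := by
    intro a
    obtain ⟨p, rfl, hp⟩ := hreach a
    obtain ⟨hi, h, -⟩ := hkey p (by omega)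
    rw [← h]
    exact (g3 p.2.length (by omega) _ hi).1
  refine ⟨⟨fun a => (classRound (c.toCells, s) (maps, st) ()).2.1.get (N.classKey X ι a),
    ⟨?_, ?_, ?_, ?_⟩⟩, ⟨E, g1, fun x => ⟨fun hx => ?_, ?_⟩⟩, hcost.trans ?_⟩
  · omega
  · intro a b
    rw [← classKey_eq_iff hm.iff]
    exact ⟨fun h => g1.interned.injOn (hmem a) (hmem b) h, fun h => by rw [h]⟩
  · intro a
    obtain ⟨i, hi, hia⟩ := List.mem_iff_getElem.1 (hmem a)
    rw [← hia, g1.interned.get i hi]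
    refine Data.size_mark_le ?_
    have : E.length ≤ n := by
      rw [← List.toFinset_card_of_nodup g1.interned.nodup]
      refine (Finset.card_le_card fun x hx => g2 x (List.mem_toFinset.1 hx)).trans ?_
      simpa using Finset.card_image_le (s := Finset.univ) (f := N.classKey X ι)
    omega
  · intro p hp
    obtain ⟨hi, h, -⟩ := hkey p (by omega)
    rw [(g3 p.2.length (by omega) _ hi).2, h]
  · obtain ⟨a, -, rfl⟩ := Finset.mem_image.1 (g2 x hx)
    exact ⟨a, rfl⟩
  · rintro ⟨a, rfl⟩
    exact hmem a
  · exact Nat.mul_le_mul_left _ (by omega)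

end

end Network

namespace CountViews

theorem toBool_get_labelSet (L : List Data) (k : Data) :
    ((labelSet L).get k).toBool = true ↔ k ∈ L := by
  have : ∀ (L : List Data) (m : Data),
      ((L.foldl (fun m z => m.set z (enc true)) m).get k).toBool = true ↔
        k ∈ L ∨ (m.get k).toBool = true := by
    intro L
    induction L with
    | nil => simp
    | cons z L ih =>
      intro m
      rw [List.foldl_cons, ih, Data.get_set]
      by_cases hk : k = z
      · simp [hk, enc_true, Data.toBool]
      · simp [hk]
  rw [labelSet, this, Data.get_nil]
  simp [Data.toBool]

end CountViews

theorem List.length_eq_ncard {α : Type*} {l : List α} (hl : l.Nodup) {S : Set α}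
    (h : ∀ x, x ∈ l ↔ x ∈ S) : l.length = S.ncard := by
  classical
  rw [← List.toFinset_card_of_nodup hl, ← Set.ncard_coe_finset]
  congr 1
  ext x
  simp [h]

namespace Network

open CountViews

variable {n : ℕ} {N : Network n} {X : Fin n → ℤ}

/-- The keys of the last round separate the parties just as trees of depth `n - 1` do, so the table
has one entry for each view, and the label at its head decides membership in `S`. -/
theorem IsLayout.countViews {m b : ℕ} {v : Fin n} {c : LevelList}
    {pos : (Σ w, N.graph.Walk v w) → ℕ} (hc : N.IsLayout X (2 * m) v c pos) (hn : n = m + 1)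
    (hm0 : 0 < m) (hX : ∀ v, |X v| < 2 ^ b) (S : Finset ℤ) :
    let x := (n, S.toList.map Data.ofInt, c.toCells, ())
    countViews x = ((N.views X).ncard, (N.viewsIn X S).ncard, ()) ∧
    countViewsCost x ≤ n + ((S.toList.map Data.ofInt).map fun z => z.size + 1).sum + (2 * m + 1) +
      (((4 * b + 7 + (16 * n.size + 10) * N.maxDeg + 3 * n.size + 1) * n + 1) * (2 * m + 1) + 1) *
        m := by
  intro x
  set s := labelSet (S.toList.map Data.ofInt) with hs
  -- The initial tally is empty and describes no classification, hence the guard `0 < d`; `hm0`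
  -- provides a first round.
  let I : List Data × Tally → List Unit → Prop := fun st rest => ∃ d, rest = List.replicate (m - d) () ∧
    d ≤ m ∧ (∃ ι, ClassesGood N X m pos d st.1 ι) ∧ (0 < d → ∃ K : Fin n → Data,
      (∀ a, ∃ t, K a = Data.cons (Data.ofInt (X a)) t) ∧
      (∀ a b, K a = K b ↔ N.preTree X d a = N.preTree X d b) ∧
      ∃ E, TallyGood s st.2 E ∧ ∀ x, x ∈ E ↔ ∃ a, x = K a)
  have hlen := hc.length_eq (by omega)
  have hstep : ∀ st u rest, I st (u :: rest) →
      classRoundCost (c.toCells, s) st u ≤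
        ((4 * b + 7 + (16 * n.size + 10) * N.maxDeg + 3 * n.size + 1) * n + 1) * (2 * m + 1) ∧
      I (classRound (c.toCells, s) st u) rest := by
    rintro ⟨maps, st⟩ u rest ⟨d, h1, h2, ⟨ι, h3⟩, -⟩
    have hd : d < m := by
      by_contra hd
      rw [Nat.sub_eq_zero_of_le (by omega)] at h1
      simp at h1
    obtain ⟨g1, ⟨E, g2, g3⟩, g4⟩ := hc.round hn hX hd h3 s st
    refine ⟨g4, d + 1, ?_, hd, g1, fun _ => ⟨N.classKey X ι, fun a => ⟨_, rfl⟩,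
      classKey_eq_iff h3.iff, E, g2, g3⟩⟩
    rw [show m - d = (m - (d + 1)) + 1 by omega, List.replicate_succ, List.cons.injEq] at h1
    exact h1.2
  have htail : (List.replicate n ()).tail = List.replicate m () := by
    rw [hn, List.replicate_succ, List.tail_cons]
  have h0 : I (c.toCells.map fun _ => Data.nil, (Data.nil, 0, 0)) (List.replicate m ()) := by
    refine ⟨0, by simp, Nat.zero_le _, ⟨fun _ => Data.nil, ?_, fun a b => by simp [preTree, unfoldTree],
      fun a => by simp [Data.size], fun p hp => ?_⟩, fun h => absurd h (lt_irrefl _)⟩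
    · simp [LevelList.toCells, hlen]
    · rw [List.getD_eq_getElem _ _ (by simp [LevelList.toCells, hlen]; omega), List.getElem_map,
        Data.get_nil]
  obtain ⟨⟨d, h1, h2, -, h4⟩, hcost⟩ := Impl.foldl_inv (fun _ =>
    ((4 * b + 7 + (16 * n.size + 10) * N.maxDeg + 3 * n.size + 1) * n + 1) * (2 * m + 1)) I hstep _ _ h0
  have hd : d = m := by
    have := congrArg List.length h1
    simp at this
    omega
  subst hd
  obtain ⟨K, k1, k2, E, g1, g2⟩ := h4 hm0
  have hnd := g1.interned.nodup
  constructor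
  · have e1 : E.length = (N.views X).ncard := by
      rw [ncard_views (M := d) (by omega), ← Set.image_univ, ← ncard_image_eq_of_iff _ K _ k2]
      exact List.length_eq_ncard hnd fun x => by simp [g2, eq_comm]
    have e2 : (E.countP fun k => (s.get k.hd).toBool) = (N.viewsIn X S).ncard := by
      rw [ncard_viewsIn (M := d) (by omega), ← ncard_image_eq_of_iff _ K _ k2,
        List.countP_eq_length_filter]
      refine List.length_eq_ncard (hnd.filter _) fun x => ?_
      rw [List.mem_filter, g2, hs, toBool_get_labelSet]
      constructor
      · rintro ⟨⟨a, rfl⟩, ha⟩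
        obtain ⟨t, ht⟩ := k1 a
        rw [ht] at ha
        obtain ⟨z, hz, hza⟩ := List.mem_map.1 ha
        refine ⟨a, ?_, rfl⟩
        rw [Set.mem_ofPred_eq, ← Data.ofInt_injective hza]
        exact Finset.mem_toList.1 hz
      · rintro ⟨a, ha, rfl⟩
        obtain ⟨t, ht⟩ := k1 a
        refine ⟨⟨a, rfl⟩, ?_⟩
        rw [ht]
        exact List.mem_map.2 ⟨_, Finset.mem_toList.2 ha, rfl⟩
    simp only [CountViews.countViews, x, htail, ← hs]
    rw [g1.length, g1.countP, e1, e2]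
  · simp only [countViewsCost, x, htail, ← hs]
    rw [List.map_replicate, List.sum_replicate, smul_eq_mul, mul_comm d] at hcost
    have : c.toCells.length = 2 * d + 1 := by simp [LevelList.toCells, hlen]
    omega

end Network

/-! ### Numerical estimates and the counting program -/

theorem card_le_of_abs_lt {S : Finset ℤ} {b : ℕ} (hS : ∀ z ∈ S, |z| < 2 ^ b) :
    S.card ≤ 2 ^ (b + 1) := by
  have : S ⊆ Finset.Ioo (-(2 ^ b : ℤ)) (2 ^ b) := fun z hz =>
    Finset.mem_Ioo.2 (abs_lt.1 (hS z hz))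
  refine (Finset.card_le_card this).trans ?_
  rw [Int.card_Ioo]
  have : (2 : ℤ) ^ (b + 1) = 2 ^ b + 2 ^ b := by ring
  rw [Int.toNat_le]
  push_cast
  omega

theorem natLog_pos_of_two_le {n : ℕ} (hn : 2 ≤ n) : 1 ≤ Nat.log 2 n := Nat.log_pos (by omega) hn

theorem size_le_two_mul_log {n : ℕ} (hn : 2 ≤ n) : n.size ≤ 2 * Nat.log 2 n := by
  have h1 := natLog_pos_of_two_le hn
  have h2 : n.size ≤ Nat.log 2 n + 1 := Nat.size_le.2 (Nat.lt_pow_succ_log_self (by omega) n)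
  omega

/-- The dominant term is of order `D n ^ 3 ℓ`; it is weakened to `D n ^ 5 ℓ` in `q2`. -/
theorem countViews_arith {b m n D ℓ L s Q cost : ℕ} (hn : n = m + 1) (hD : 1 ≤ D) (hℓ : 1 ≤ ℓ)
    (hL : L ≤ 2 * ℓ) (hsum : s ≤ Q)
    (h2 : cost ≤ n + s + (2 * m + 1) +
      (((4 * b + 7 + (16 * L + 10) * D + 3 * L + 1) * n + 1) * (2 * m + 1) + 1) * m) :
    cost + 1 ≤ (8 * b + 124 + Q) * (D * n ^ 5 * ℓ) := by
  have hone : 1 ≤ ℓ * D := Nat.mul_pos hℓ hD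
  have hin : 4 * b + 7 + (16 * L + 10) * D + 3 * L + 1 ≤ (4 * b + 56) * (ℓ * D) := by
    have q1 : (16 * L + 10) * D ≤ (42 * ℓ) * D := Nat.mul_le_mul_right _ (by omega)
    have q2 : ℓ ≤ ℓ * D := Nat.le_mul_of_pos_right _ hD
    have q3 : 4 * b + 8 ≤ (4 * b + 8) * (ℓ * D) := Nat.le_mul_of_pos_right _ hone
    have q4 : (4 * b + 56) * (ℓ * D) = (4 * b + 8) * (ℓ * D) + 42 * ℓ * D + 6 * (ℓ * D) := by ring
    omega
  have hR : ((4 * b + 7 + (16 * L + 10) * D + 3 * L + 1) * n + 1) * (2 * m + 1) + 1 ≤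
      (8 * b + 115) * (ℓ * D * n * n) := by
    have q1 : (4 * b + 7 + (16 * L + 10) * D + 3 * L + 1) * n + 1 ≤
        (4 * b + 57) * (ℓ * D * n) := by
      have := Nat.mul_le_mul_right n hin
      have q2 : 1 ≤ ℓ * D * n := Nat.mul_pos hone (by omega)
      have q3 : (4 * b + 57) * (ℓ * D * n) = (4 * b + 56) * (ℓ * D) * n + ℓ * D * n := by ring
      omega
    have q4 := Nat.mul_le_mul q1 (show 2 * m + 1 ≤ 2 * n by omega)
    have q5 : 1 ≤ ℓ * D * n * n := Nat.mul_pos (Nat.mul_pos hone (by omega)) (by omega)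
    have q6 : (8 * b + 115) * (ℓ * D * n * n) =
      (4 * b + 57) * (ℓ * D * n) * (2 * n) + ℓ * D * n * n := by ring
    omega
  have hn1 : 1 ≤ n := by omega
  have q1 := Nat.mul_le_mul hR (show m ≤ n by omega)
  have q2 : (8 * b + 115) * (ℓ * D * n * n) * n ≤ (8 * b + 115) * (D * n ^ 5 * ℓ) := by
    have : n ^ 3 ≤ n ^ 5 := Nat.pow_le_pow_right hn1 (by omega)
    calc (8 * b + 115) * (ℓ * D * n * n) * n = (8 * b + 115) * (D * n ^ 3 * ℓ) := by ring
      _ ≤ _ := by gcongr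
  have q3 : n ≤ D * n ^ 5 * ℓ := by
    calc n = 1 * n ^ 1 * 1 := by ring
      _ ≤ D * n ^ 5 * ℓ := by gcongr; omega
  have q4 : Q ≤ Q * (D * n ^ 5 * ℓ) := Nat.le_mul_of_pos_right _ (by omega)
  have q5 : (8 * b + 124 + Q) * (D * n ^ 5 * ℓ) =
    (8 * b + 115) * (D * n ^ 5 * ℓ) + 9 * (D * n ^ 5 * ℓ) + Q * (D * n ^ 5 * ℓ) := by ring
  omega

theorem exists_countViews_program :
    ∃ p : Program, ∀ b : ℕ, ∃ C : ℝ, ∀ (n : ℕ) (N : Network n) (X : Fin n → ℤ) (v : Fin n)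
        (S : Finset ℤ) (A : RootedGraph ℤ (ℕ × ℕ)) (c : LevelList),
      2 ≤ n → (∀ u, |X u| < 2 ^ b) → (∀ z ∈ S, |z| < 2 ^ b) →
      (N.viewUpTo X (2 * (n - 1)) v).IsMinimalFoldedView A → c.Represents A →
      ∃ (s : Store) (t : ℕ),
        Exec p (Store.start (Data.ofList
          [Data.ofNat n, Data.ofList (S.toList.map Data.ofInt), c.encode])) s t ∧
        s.output = Data.ofList
          [Data.ofNat (N.views X).ncard, Data.ofNat (N.viewsIn X S).ncard] ∧
        (t : ℝ) ≤ C * (N.maxDeg * (n : ℝ) ^ 5 * Real.logb 2 n) := by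
  obtain ⟨C, p, h⟩ := CountViews.impl_countViews.exec_start
  -- The last summand pays for `S`: at most `2 ^ (b + 1)` labels, each of size at most `4 * b + 5`,
  -- and one step for each.
  refine ⟨p, fun b => ⟨C * (8 * b + 124 + 2 ^ (b + 1) * (4 * b + 6) : ℕ), ?_⟩⟩
  intro n N X v S A c hn hX hS hA hc
  obtain ⟨pos, hl⟩ := Network.exists_isLayout hA hc
  obtain ⟨h1, h2⟩ := hl.countViews (by omega) (by omega) hX S
  obtain ⟨s, t, e1, e2, e3⟩ := h (n, S.toList.map Data.ofInt, c.toCells, ())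
  refine ⟨s, t, ?_, ?_, ?_⟩
  · have : (enc (n, S.toList.map Data.ofInt, c.toCells, ()) : Data) = Data.ofList
        [Data.ofNat n, Data.ofList (S.toList.map Data.ofInt), c.encode] := by
      rw [enc_pair, enc_pair, enc_pair, LevelList.enc_toCells]
      change Data.cons _ (Data.cons (Data.ofList ((S.toList.map Data.ofInt).map id)) _) = _
      rw [List.map_id]
      rfl
    rwa [this] at e1
  · rw [e3, h1]
    rfl
  · have hD : 1 ≤ N.maxDeg := (N.deg_pos hn v).trans_le (N.deg_le_maxDeg v)
    have hℓ := natLog_pos_of_two_le hn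
    have hL := size_le_two_mul_log hn
    have hsum : ((S.toList.map Data.ofInt).map fun z => z.size + 1).sum ≤
        2 ^ (b + 1) * (4 * b + 6) := by
      refine (List.sum_le_card_nsmul _ (4 * b + 6) fun x hx => ?_).trans ?_
      · simp only [List.mem_map, Finset.mem_toList] at hx
        obtain ⟨_, ⟨z, hz, rfl⟩, rfl⟩ := hx
        have := size_enc_int_le (hS z hz)
        omega
      · simp only [List.length_map, Finset.length_toList, smul_eq_mul]
        exact Nat.mul_le_mul_right _ (card_le_of_abs_lt hS)
    have hlog : (Nat.log 2 n : ℝ) ≤ Real.logb 2 n := by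
      exact_mod_cast Real.natLog_le_logb n 2
    have hfin := countViews_arith (by omega : n = (n - 1) + 1) hD hℓ hL hsum h2
    have ht : (t : ℝ) ≤ (C * ((8 * b + 124 + 2 ^ (b + 1) * (4 * b + 6)) *
        (N.maxDeg * n ^ 5 * Nat.log 2 n)) : ℕ) :=
      Nat.cast_le.2 (e2.trans (Nat.mul_le_mul_left _ hfin))
    refine ht.trans ?_
    push_cast
    rw [mul_assoc (C : ℝ)]
    gcongr

/-! ### Synchronous protocols -/

namespace Impl

/-- The part of `Impl` that concerns one variable. -/
theorem exists_bound {α β : Type} [Enc α] [Enc β] {f : α → β} {T : α → ℕ} (h : Impl f T) (k : ℕ) :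
    ∃ (C : ℕ) (p : Program), ∀ (s : Store) (a : α), s k = enc a →
      ∃ s' t, Exec p s s' t ∧ t ≤ C * (T a + 1) ∧ s' k = enc (f a) ∧ ∀ i < k, s' i = s i := by
  obtain ⟨C, h⟩ := h
  obtain ⟨p, h⟩ := h k
  exact ⟨C, p, h⟩

end Impl

namespace Network

variable {n : ℕ} (N : Network n)

/-- The messages that arrive at a party when `msg v i` is sent by `v` through port `i`. -/
def inbox {M : Type} (msg : (v : Fin n) → Fin (N.deg v) → M) (v : Fin n) : List (Wire M) :=
  List.ofFn fun i => ⟨msg (N.nbr v i) (N.backPort v i)⟩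

def outbox {M : Type} (msg : (v : Fin n) → Fin (N.deg v) → M) (v : Fin n) : List (Wire M) :=
  List.ofFn fun i => ⟨msg v i⟩

theorem outgoing_of_outbox {M : Type} [Enc M] {msg : (v : Fin n) → Fin (N.deg v) → M} {v : Fin n}
    {s : Store} (h : s 2 = enc (N.outbox msg v)) (i : Fin (N.deg v)) :
    s.outgoing i = (enc (msg v i) : Data).ser := by
  have h1 : s 2 = Data.ofList ((N.outbox msg v).map enc) := h
  rw [Store.outgoing, h1, Data.toList_ofList, outbox, List.map_ofFn,
    List.getD_eq_getElem _ _ (by simp), List.getElem_ofFn]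
  exact Data.toBits_ofBits _

theorem deliver_inbox {M : Type} [Enc M] {msg : (v : Fin n) → Fin (N.deg v) → M}
    {s : Fin n → Store} (h : ∀ v, s v 2 = enc (N.outbox msg v)) (v : Fin n) :
    N.deliver s v 1 = enc (N.inbox msg v) := by
  have : ∀ i : Fin (N.deg v), (s (N.nbr v i)).outgoing (N.backPort v i) =
      (enc (msg (N.nbr v i) (N.backPort v i)) : Data).ser := fun i =>
    N.outgoing_of_outbox (h _) _
  simp only [deliver, Store.clearOutbox, Store.withInbox, this]
  rw [Function.update_of_ne (by decide), Function.update_self]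
  change _ = Data.ofList ((N.inbox msg v).map enc)
  rw [inbox, List.map_ofFn, List.map_ofFn]
  rfl

theorem deliver_of_ne (s : Fin n → Store) (v : Fin n) {k : ℕ} (h1 : k ≠ 1) (h2 : k ≠ 2) :
    N.deliver s v k = s v k := by
  simp only [deliver, Store.clearOutbox, Store.withInbox]
  rw [Function.update_of_ne h2, Function.update_of_ne h1]

theorem bitsSent_of_outbox {M : Type} [Enc M] {msg : (v : Fin n) → Fin (N.deg v) → M}
    {s : Fin n → Store} (h : ∀ v, s v 2 = enc (N.outbox msg v)) :
    N.bitsSent s = ∑ v, ∑ i, (enc (msg v i) : Data).size := by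
  refine Finset.sum_congr rfl fun v _ => Finset.sum_congr rfl fun i _ => ?_
  rw [N.outgoing_of_outbox (h v), Data.length_ser]

end Network

/-- A protocol given by an initial step, a step, and an output function with a halting flag,
all of them computable, can be run as a program on every network. -/
theorem exists_protocol_program {ι σ M : Type} [Enc ι] [Enc σ] [Enc M]
    {init : ι → σ × List (Wire M)} {step : σ × List (Wire M) → σ × List (Wire M)}
    {outp : σ → Bool × Data} {Ti : ι → ℕ} {Ts : σ × List (Wire M) → ℕ} {To : σ → ℕ}
    (hi : Impl init Ti) (hs : Impl step Ts) (ho : Impl outp To) :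
    ∃ (C : ℕ) (p : Program), ∀ (n : ℕ) (N : Network n) (a : Fin n → ι) (st : ℕ → Fin n → σ)
      (msg : ℕ → (v : Fin n) → Fin (N.deg v) → M) (R : ℕ),
      0 < R →
      (∀ v, init (a v) = (st 0 v, N.outbox (msg 0) v)) →
      (∀ k < R, ∀ v, step (st k v, N.inbox (msg k) v) = (st (k + 1) v, N.outbox (msg (k + 1)) v)) →
      (∀ k < R, 0 < k → ∀ v, (outp (st k v)).1 = false) →
      (∀ v, (outp (st R v)).1 = true) →
      ∃ s T, N.Run p (fun v => Store.start (enc (a v))) (R + 1) s T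
          (∑ k ∈ Finset.range (R + 1), ∑ v, ∑ i, (enc (msg k v i) : Data).size) ∧
        (∀ v, (s v).Halted ∧ (s v).output = (outp (st R v)).2) ∧
        ∀ v, T v ≤ C * (Ti (a v) + 1 + ∑ k ∈ Finset.range R,
          (Ts (st k v, N.inbox (msg k) v) + To (st (k + 1) v) + 1)) := by
  obtain ⟨Ci, pi, hi⟩ := hi.exists_bound 6
  obtain ⟨Cs, ps, hs⟩ := hs.exists_bound 6
  obtain ⟨Co, po, ho⟩ := ho.exists_bound 6
  -- Variable `5` keeps the state behind an extra cell, so it is `nil` exactly before the first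
  -- round. Variable `6` is the workspace; the subprograms leave everything below it untouched.
  let pInit : Program := .seq (.assign 6 (.var 0)) (.seq pi (.seq
    (.assign 5 (.cons .nil (.hd (.var 6)))) (.assign 2 (.tl (.var 6)))))
  let pStep : Program := .seq (.assign 6 (.cons (.tl (.var 5)) (.var 1))) (.seq ps (.seq
    (.assign 5 (.cons .nil (.hd (.var 6)))) (.seq (.assign 2 (.tl (.var 6))) (.seq
    (.assign 6 (.hd (.var 6))) (.seq po (.seq (.assign 4 (.hd (.var 6)))
      (.assign 3 (.tl (.var 6)))))))))
  refine ⟨Ci + Cs + Co + 40, .cond (.var 5) pStep pInit, ?_⟩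
  intro n N a st msg R hR h0 h1 h2 h3
  have hexInit : ∀ v, ∃ s' t, Exec (.cond (.var 5) pStep pInit) (Store.start (enc (a v))) s' t ∧
      t ≤ (Ci + Cs + Co + 40) * (Ti (a v) + 1) ∧ s' 5 = Data.cons Data.nil (enc (st 0 v)) ∧
      s' 2 = enc (N.outbox (msg 0) v) ∧ s' 4 = Data.nil := by
    intro v
    obtain ⟨s', t, e1, e2, e3, e4⟩ := hi (Function.update (Store.start (enc (a v))) 6 (enc (a v)))
      (a v) (by simp)
    rw [h0] at e3
    refine ⟨_, _, .condFalse (by simp [Expr.eval, Store.start]) (.seq (.assign _ _ _) (.seq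
      (by simpa [Expr.eval, Store.start] using e1) (.seq (.assign _ _ _) (.assign _ _ _)))),
      ?_, ?_, ?_, ?_⟩
    · simp only [Expr.cost]
      nlinarith [Nat.zero_le (Cs * Ti (a v)), Nat.zero_le (Co * Ti (a v))]
    · simp [Expr.eval, e3, enc_pair, Data.hd]
    · simp [Expr.eval, e3, enc_pair, Data.tl]
    · simp [e4 4 (by omega), Store.start]
  have hexStep : ∀ k < R, ∀ v (s : Store), s 5 = Data.cons Data.nil (enc (st k v)) →
      s 1 = enc (N.inbox (msg k) v) →
      ∃ s' t, Exec (.cond (.var 5) pStep pInit) s s' t ∧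
      t ≤ (Ci + Cs + Co + 40) * (Ts (st k v, N.inbox (msg k) v) + To (st (k + 1) v) + 1) ∧
      s' 5 = Data.cons Data.nil (enc (st (k + 1) v)) ∧
      s' 2 = enc (N.outbox (msg (k + 1)) v) ∧ s' 4 = enc (outp (st (k + 1) v)).1 ∧
      s' 3 = (outp (st (k + 1) v)).2 := by
    intro k hk v s hs5 hs1
    obtain ⟨s', t, e1, e2, e3, e4⟩ := hs (Function.update s 6
      (enc (st k v, N.inbox (msg k) v))) (st k v, N.inbox (msg k) v) (by simp)
    rw [h1 k hk] at e3
    obtain ⟨s'', t', f1, f2, f3, f4⟩ := ho (Function.update (Function.update (Function.update s' 5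
      (Data.cons Data.nil (s' 6).hd)) 2 (s' 6).tl) 6 (s' 6).hd) (st (k + 1) v)
      (by simp [e3, enc_pair, Data.hd])
    have e6 : (Expr.cons (.tl (.var 5)) (.var 1)).eval s =
        enc (st k v, N.inbox (msg k) v) := by
      simp [Expr.eval, hs5, hs1, enc_pair, Data.tl]
    refine ⟨_, _, .condTrue (by simp [Expr.eval, hs5]) (.seq (.assign _ _ _) (.seq
      (by rw [e6]; exact e1) (.seq (.assign _ _ _) (.seq (.assign _ _ _) (.seq (.assign _ _ _)
        (.seq (by simpa [Expr.eval] using f1) (.seq (.assign _ _ _) (.assign _ _ _)))))))),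
      ?_, ?_, ?_, ?_, ?_⟩
    · simp only [Expr.cost]
      generalize Ts (st k v, N.inbox (msg k) v) = x at *
      generalize To (st (k + 1) v) = y at *
      nlinarith [Nat.zero_le (Ci * x), Nat.zero_le (Ci * y), Nat.zero_le (Cs * y),
        Nat.zero_le (Co * x)]
    · simp [f4 5 (by omega), e3, enc_pair, Data.hd]
    · simp [f4 2 (by omega), e3, enc_pair, Data.tl]
    · simp only [Expr.eval, Function.update_self, Function.update_of_ne (show (4 : ℕ) ≠ 3 by decide), f3]
      rfl
    · simp only [Expr.eval, Function.update_self, Function.update_of_ne (show (6 : ℕ) ≠ 4 by decide), f3]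
      rfl
  -- The first round only initialises and sends, so state `k` is reached after `k + 1` rounds, and
  -- no halting flag has been computed at `k = 0`.
  have main : ∀ k ≤ R, ∃ s T, N.Run (.cond (.var 5) pStep pInit)
        (fun v => Store.start (enc (a v))) (k + 1) s T
        (∑ k ∈ Finset.range (k + 1), ∑ v, ∑ i, (enc (msg k v i) : Data).size) ∧
      (∀ v, s v 5 = Data.cons Data.nil (enc (st k v)) ∧ s v 1 = enc (N.inbox (msg k) v) ∧
        s v 4 = (if k = 0 then Data.nil else enc (outp (st k v)).1) ∧
        (0 < k → s v 3 = (outp (st k v)).2)) ∧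
      ∀ v, T v ≤ (Ci + Cs + Co + 40) * (Ti (a v) + 1 + ∑ k ∈ Finset.range k,
          (Ts (st k v, N.inbox (msg k) v) + To (st (k + 1) v) + 1)) := by
    intro k
    induction k with
    | zero =>
      intro _
      choose s t e1 e2 e3 e4 e5 using hexInit
      refine ⟨N.deliver s, fun v => 0 + t v, ?_, ?_, ?_⟩
      · have := Network.Run.succ (N := N) (s₂ := s) (t := t)
          (.zero (p := .cond (.var 5) pStep pInit) (s := fun v => Store.start (enc (a v))))
          (fun v => Or.inr ⟨by simp [Store.Halted, Store.start], e1 v⟩)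
        rw [N.bitsSent_of_outbox e4] at this
        rw [Finset.sum_range_one]
        rwa [zero_add (∑ v, _)] at this
      · intro v
        refine ⟨?_, N.deliver_inbox e4 v, ?_, by simp⟩
        · rw [N.deliver_of_ne _ _ (by decide) (by decide), e3]
        · rw [N.deliver_of_ne _ _ (by decide) (by decide), e5, if_pos rfl]
      · intro v
        simpa using e2 v
    | succ k ih =>
      intro hk
      obtain ⟨s, T, g1, g2, g3⟩ := ih (by omega)
      choose s' t e1 e2 e3 e4 e5 e6 using fun v =>
        hexStep k hk v (s v) (g2 v).1 (g2 v).2.1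
      refine ⟨N.deliver s', fun v => T v + t v, ?_, ?_, ?_⟩
      · rw [Finset.sum_range_succ, ← N.bitsSent_of_outbox e4]
        refine Network.Run.succ g1 (t := t) fun v => Or.inr ⟨?_, e1 v⟩
        rw [Store.Halted, (g2 v).2.2.1]
        split_ifs with hk0
        · simp
        · rw [h2 k hk (by omega) v]
          simp [enc_false]
      · intro v
        refine ⟨?_, N.deliver_inbox e4 v, ?_, fun _ => ?_⟩
        · rw [N.deliver_of_ne _ _ (by decide) (by decide), e3]
        · rw [N.deliver_of_ne _ _ (by decide) (by decide), e5, if_neg (by omega)]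
        · rw [N.deliver_of_ne _ _ (by decide) (by decide), e6]
      · intro v
        rw [Finset.sum_range_succ, ← add_assoc, mul_add]
        exact Nat.add_le_add (g3 v) (e2 v)
  obtain ⟨s, T, g1, g2, g3⟩ := main R le_rfl
  refine ⟨s, T, g1, fun v => ⟨?_, (g2 v).2.2.2 hR⟩, g3⟩
  rw [Store.Halted, (g2 v).2.2.1, if_neg (by omega), h3]
  simp [enc_true]

/-! ### Construction of folded views: the protocol -/

namespace FoldView

/-- An entry of a table of trees: the label, and the edges with the numbers of their far ports and
the names of the subtrees. -/
abbrev Entry : Type := Data × List (Data × Data)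

/-- A table of trees: the names by entry, the entries by name, the number of entries, and the
recent entries, latest first. -/
abbrev Book : Type := Data × Data × ℕ × List (Data × Entry)

/-- Hash consing: an entry that is already present keeps its name, so equality of trees becomes
equality of names. The inverse table is kept for the final listing. -/
def intern (x : Entry) (b : Book) : Data × Book :=
  if (b.1.get (enc x)).toBool then (b.1.get (enc x), b) else
    (Data.mark b.2.2.1, b.1.set (enc x) (Data.mark b.2.2.1), b.2.1.set (Data.mark b.2.2.1) (enc x),
      b.2.2.1 + 1, (Data.mark b.2.2.1, x) :: b.2.2.2)

def internCost (x : Entry) (b : Book) : ℕ :=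
  (enc x : Data).size + (Data.mark b.2.2.1).size + b.2.2.1.size

def translate (m : Data) (x : Entry) : Entry := (x.1, x.2.map fun c => (c.1, m.get c.2))

/-- Senders list subtrees before trees, so the names inside `e` already have translations in `s.1`;
the name of `e` itself is added to them. -/
def recvEntry (s : Data × Book) (e : Data × Entry) : Data × Book :=
  let r := intern (translate s.1 e.2) s.2
  (s.1.set e.1 r.1, r.2)

def recvEntryCost (s : Data × Book) (e : Data × Entry) : ℕ :=
  (enc e : Data).size + internCost (translate s.1 e.2) s.2

/-- A message: the number of the port where it was sent, the name of the current tree of the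
sender, and its recent entries. -/
abbrev Msg : Type := Data × Data × List (Data × Entry)

abbrev Inbound : Type := (List Data × List Data) × List (Data × Data) × Book

def recvMsg (s : Inbound) (w : Wire Msg) : Inbound :=
  let r := w.val.2.2.foldl recvEntry (s.1.1.headD Data.nil, s.2.2)
  ((s.1.1.tail, r.1 :: s.1.2), (w.val.1, r.1.get w.val.2.1) :: s.2.1, r.2)

def recvMsgCost (s : Inbound) (w : Wire Msg) : ℕ :=
  (enc w.val : Data).size +
    Impl.foldCost recvEntryCost recvEntry (s.1.1.headD Data.nil, s.2.2) w.val.2.2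

/-- The state of a party: the remaining rounds and all rounds; its label and its ports; the
translations of the names of its neighbours and the name of its own tree; its table. -/
abbrev State : Type := (List Unit × List Unit) × (Data × List Data) × (List Data × Data) × Book

def send (st : State) : State × List (Wire Msg) :=
  (st, st.2.1.2.map fun p => ⟨(p, st.2.2.1.2, st.2.2.2.2.2.2.reverse)⟩)

def sendCost (st : State) : ℕ :=
  st.2.2.2.2.2.2.length +
    (st.2.1.2.map fun p => (enc (p, st.2.2.1.2, st.2.2.2.2.2.2.reverse) : Data).size + 1).sum

/-- The recent entries have just been sent, so collection starts again with the empty list. -/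
def receive (st : State) (msgs : List (Wire Msg)) : Inbound :=
  msgs.foldl recvMsg ((st.2.2.1.1, []), [], st.2.2.2.1, st.2.2.2.2.1, st.2.2.2.2.2.1, [])

def advance (st : State) (r : Inbound) : State :=
  let q := intern (st.2.1.1, r.2.1.reverse) r.2.2
  ((st.1.1.tail, st.1.2), st.2.1, (r.1.2.reverse, q.1), q.2)

def round (x : State × List (Wire Msg)) : State × List (Wire Msg) :=
  send (advance x.1 (receive x.1 x.2))

def roundCost (x : State × List (Wire Msg)) : ℕ :=
  Impl.foldCost recvMsgCost recvMsg
    ((x.1.2.2.1.1, []), [], x.1.2.2.2.1, x.1.2.2.2.2.1, x.1.2.2.2.2.2.1, []) x.2 +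
    (receive x.1 x.2).2.1.length + (receive x.1 x.2).1.2.length +
    internCost (x.1.2.1.1, (receive x.1 x.2).2.1.reverse) (receive x.1 x.2).2.2 +
    sendCost (advance x.1 (receive x.1 x.2))

/-- The tree of depth `0` is a label without edges. The number of rounds is stored twice: one copy
counts down, the other fixes the number of levels to be listed. -/
def start (x : ℕ × ℕ × Data × Unit) : State :=
  let q := intern (x.2.2.1, []) (Data.nil, Data.nil, 0, [])
  ((List.replicate x.1 (), List.replicate x.1 ()), (x.2.2.1, (List.range x.2.1).map enc),
    (List.replicate x.2.1 Data.nil, q.1), q.2)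

def init (x : ℕ × ℕ × Data × Unit) : State × List (Wire Msg) := send (start x)

def initCost (x : ℕ × ℕ × Data × Unit) : ℕ :=
  x.1 + x.2.1 * x.2.1.size + x.2.1 + x.2.2.1.size + sendCost (start x)

open Impl

theorem impl_intern : Impl (fun x : Entry × Book => intern x.1 x.2)
    (fun x => internCost x.1 x.2) := by
  have hk : Impl (fun x : Entry × Book => (enc x.1 : Data)) (fun _ => 0) :=
    (encode.comp fst).mono fun _ => by simp
  have hn : Impl (fun x : Entry × Book => x.2.2.2.1) (fun _ => 0) :=
    fst.comp (snd.comp (snd.comp snd))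
  have hm : Impl (fun x : Entry × Book => Data.mark x.2.2.2.1) (fun _ => 0) :=
    (mark.comp hn).mono fun _ => by simp
  have hg : Impl (fun x : Entry × Book => x.2.1.get (enc x.1)) (fun x => (enc x.1 : Data).size) :=
    (get.comp (pair (fst.comp snd) hk)).mono fun _ => by simp
  refine (ite (toBool.comp hg) (pair hg snd) (pair hm (pair
    (set.comp (pair (fst.comp snd) (pair hk hm)))
    (pair (set.comp (pair (fst.comp (snd.comp snd)) (pair hm hk))) (pair (succ.comp hn)
      (cons.comp (pair (pair hm fst) (snd.comp (snd.comp (snd.comp snd)))))))))).mono' 2 fun x => ?_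
  simp only [internCost]
  split_ifs <;> omega

theorem size_children_le (x : Entry) :
    (x.2.map fun c => c.2.size + 1).sum ≤ (enc x : Data).size := by
  obtain ⟨a, l⟩ := x
  have : (l.map fun c => c.2.size + 1).sum ≤ (enc l : Data).size := by
    induction l with
    | nil => simp
    | cons c l ih =>
      obtain ⟨c, d⟩ := c
      simp only [List.map_cons, List.sum_cons, enc_cons, enc_pair, enc_data, Data.size]
      omega
  simp only [enc_pair, Data.size]
  omega

theorem impl_translate : Impl (fun x : Data × Entry => translate x.1 x.2)
    (fun x => (enc x.2 : Data).size) := by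
  have h := Impl.map (ε := Data × Entry) (l := fun x => x.2.2)
    (f := fun x c => (c.1, x.1.get c.2)) (snd.comp snd)
    (T := fun x => x.2.2.size)
    ((pair (fst.comp snd) (get.comp (pair (fst.comp fst) (snd.comp snd)))).mono fun _ => by simp)
  refine (pair (fst.comp snd) h).mono fun x => ?_
  have := size_children_le x.2
  simp only at *
  omega

theorem impl_recvEntry : Impl (fun x : (Data × Book) × Data × Entry => recvEntry x.1 x.2)
    (fun x => recvEntryCost x.1 x.2) := by
  have h1 : Impl (fun x : (Data × Book) × Data × Entry => translate x.1.1 x.2.2) _ :=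
    impl_translate.comp (pair (fst.comp fst) (snd.comp snd))
  have h2 : Impl (fun x : (Data × Book) × Data × Entry => intern (translate x.1.1 x.2.2) x.1.2) _ :=
    impl_intern.comp (pair h1 (snd.comp fst))
  have h3 : Impl (fun x : ((Data × Book) × Data × Entry) × Data × Book =>
      (x.1.1.1.set x.1.2.1 x.2.1, x.2.2)) _ :=
    pair (set.comp (pair (fst.comp (fst.comp fst)) (pair (fst.comp (snd.comp fst)) (fst.comp snd))))
      (snd.comp snd)
  refine (h3.comp (pair id h2)).mono fun x => ?_
  have : (enc x.2 : Data).size = x.2.1.size + (enc x.2.2 : Data).size + 1 := rfl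
  simp only [recvEntryCost]
  omega

theorem impl_recvMsg : Impl (fun x : Inbound × Wire Msg => recvMsg x.1 x.2)
    (fun x => recvMsgCost x.1 x.2) := by
  have hd' : Impl (fun l : List Data => l.headD Data.nil) (fun _ => 0) :=
    of_expr (fun k => .hd (.var k)) 2 (fun _ => le_rfl) fun k s a hs => by
      simp only [Expr.eval, hs]; cases a <;> rfl
  have hs : Impl (fun x : (Inbound × Msg) × (Data × Book) × (Data × Entry) =>
      recvEntry x.2.1 x.2.2) (fun x => recvEntryCost x.2.1 x.2.2) :=
    (impl_recvEntry.comp snd).mono fun _ => by simp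
  have h1 := foldl (ε := Inbound × Msg) (l := fun x => x.2.2.2)
    (s₀ := fun x => (x.1.1.1.headD Data.nil, x.1.2.2)) (step := fun _ => recvEntry)
    (snd.comp (snd.comp snd)) (pair (hd'.comp (fst.comp (fst.comp fst))) (snd.comp (snd.comp fst)))
    hs
  have h2 : Impl (fun x : (Inbound × Msg) × Data × Book => (((x.1.1.1.1.tail, x.2.1 :: x.1.1.1.2),
      (x.1.2.1, x.2.1.get x.1.2.2.1) :: x.1.1.2.1, x.2.2) : Inbound)) (fun x => x.1.2.2.1.size) :=
    (pair (pair (tail.comp (fst.comp (fst.comp (fst.comp fst))))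
      (cons.comp (pair (fst.comp snd) (snd.comp (fst.comp (fst.comp fst))))))
      (pair (cons.comp (pair (pair (fst.comp (snd.comp fst)) (get.comp (pair (fst.comp snd)
        (fst.comp (snd.comp (snd.comp fst)))))) (fst.comp (snd.comp (fst.comp fst)))))
        (snd.comp snd))).mono fun _ => by simp
  have h3 : Impl (fun x : Inbound × Wire Msg => (x.1, x.2.val)) (fun x => (enc x.2.val : Data).size) :=
    (pair fst (unwire.comp snd)).mono fun _ => by simp
  refine ((h2.comp (pair id h1)).comp h3).mono' 2 fun x => ?_
  have : x.2.val.2.1.size ≤ (enc x.2.val : Data).size := by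
    obtain ⟨_, ⟨a, b, c⟩⟩ := x
    simp only [enc_pair, enc_data, Data.size]
    omega
  simp only [recvMsgCost]
  change _ + (0 + (_ + foldCost recvEntryCost _ _ _) + _) ≤ _
  omega

theorem impl_send : Impl send sendCost := by
  have h1 : Impl (fun x : State => x.2.2.2.2.2.2.reverse) (fun x => x.2.2.2.2.2.2.length) :=
    (reverse.comp (snd.comp (snd.comp (snd.comp (snd.comp (snd.comp snd)))))).mono fun _ => by simp
  have h2 : Impl (fun x : State => (x.2.2.1.2, x.2.2.2.2.2.2.reverse))
      (fun x => x.2.2.2.2.2.2.length) :=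
    (pair (snd.comp (fst.comp (snd.comp snd))) h1).mono fun _ => by simp
  have hf : Impl (fun x : (List Data × Data × List (Data × Entry)) × Data =>
      (⟨(x.2, x.1.2)⟩ : Wire Msg)) (fun x => (enc (x.2, x.1.2) : Data).size) :=
    (wire.comp (pair snd (snd.comp fst))).mono fun _ => by simp
  have h3 := Impl.map (ε := List Data × Data × List (Data × Entry)) (l := fun x => x.1)
    (f := fun x p => (⟨(p, x.2)⟩ : Wire Msg)) fst hf
  refine (pair id (h3.comp (pair (snd.comp (fst.comp snd)) h2))).mono fun x => ?_
  simp [sendCost]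

theorem impl_round : Impl round roundCost := by
  have hs : Impl (fun x : (State × List (Wire Msg)) × Inbound × Wire Msg => recvMsg x.2.1 x.2.2)
      (fun x => recvMsgCost x.2.1 x.2.2) := (impl_recvMsg.comp snd).mono fun _ => by simp
  have hb : Impl (fun x : State × List (Wire Msg) => x.1.2.2.2) (fun _ => 0) :=
    snd.comp (snd.comp (snd.comp fst))
  have h1 := foldl (ε := State × List (Wire Msg)) (l := fun x => x.2)
    (s₀ := fun x => (((x.1.2.2.1.1, []), [], x.1.2.2.2.1, x.1.2.2.2.2.1, x.1.2.2.2.2.2.1, []) :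
      Inbound)) (step := fun _ => recvMsg)
    snd (pair (pair (fst.comp (fst.comp (snd.comp (snd.comp fst)))) (const _)) (pair (const _)
      (pair (fst.comp hb) (pair (fst.comp (snd.comp hb)) (pair (fst.comp (snd.comp (snd.comp hb)))
        (const _)))))) hs
  have h2 : Impl (fun x : State × Inbound => ((x.1.2.1.1, x.2.2.1.reverse) : Entry))
      (fun x => x.2.2.1.length) :=
    (pair (fst.comp (fst.comp (snd.comp fst))) (reverse.comp (fst.comp (snd.comp snd)))).mono
      fun _ => by simp
  have h3 : Impl (fun x : State × Inbound => intern (x.1.2.1.1, x.2.2.1.reverse) x.2.2.2)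
      (fun x => x.2.2.1.length + internCost (x.1.2.1.1, x.2.2.1.reverse) x.2.2.2) :=
    (impl_intern.comp (pair h2 (snd.comp (snd.comp snd)))).mono fun _ => by simp
  have h4 : Impl (fun x : (State × Inbound) × Data × Book => (((x.1.1.1.1.tail, x.1.1.1.2), x.1.1.2.1,
      (x.1.2.1.2.reverse, x.2.1), x.2.2) : State)) (fun x => x.1.2.1.2.length) :=
    (pair (pair (tail.comp (fst.comp (fst.comp (fst.comp fst)))) (snd.comp (fst.comp (fst.comp fst))))
      (pair (fst.comp (snd.comp (fst.comp fst))) (pair (pair (reverse.comp (snd.comp (fst.comp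
        (snd.comp fst)))) (fst.comp snd)) (snd.comp snd)))).mono fun _ => by simp
  have h5 : Impl (fun x : State × Inbound => advance x.1 x.2) _ := h4.comp (pair id h3)
  refine (impl_send.comp (h5.comp (pair fst h1))).mono fun x => ?_
  simp only [roundCost, receive]
  change (0 + (0 + _ + foldCost recvMsgCost _ _ _)) + _ + _ ≤ _
  omega

theorem impl_init : Impl init initCost := by
  have hl : Impl (fun x : ℕ × ℕ × Data × Unit => x.2.2.1) (fun _ => 0) :=
    fst.comp (snd.comp snd)
  have h1 : Impl (fun x : ℕ × ℕ × Data × Unit => List.replicate x.1 ()) (fun x => x.1) :=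
    (unary.comp fst).mono fun _ => by simp
  have h2 : Impl (fun x : ℕ × ℕ × Data × Unit => List.range (List.replicate x.2.1 ()).length)
      (fun x => x.2.1 + x.2.1 * x.2.1.size) :=
    (range.comp (unary.comp (fst.comp snd))).mono fun _ => by simp
  have h3 := Impl.map (f := fun (_ : ℕ × ℕ × Data × Unit) (i : ℕ) => (enc i : Data))
    h2 ((encode.comp snd).mono (T' := fun _ => 0) fun _ => by simp)
  have h4 := Impl.map (f := fun (_ : ℕ × ℕ × Data × Unit) (i : ℕ) => Data.nil)
    h2 (const Data.nil)
  have h5 : Impl (fun x : ℕ × ℕ × Data × Unit => intern (x.2.2.1, []) (Data.nil, Data.nil, 0, []))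
      (fun x => internCost (x.2.2.1, []) (Data.nil, Data.nil, 0, [])) :=
    (impl_intern.comp (pair (pair hl (const _)) (const _))).mono fun _ => by simp
  have h6 : Impl (fun x : (ℕ × ℕ × Data × Unit) × Data × Book => x.2) (fun _ => 0) := snd
  have h7 := pair (pair h1 h1) (pair (pair hl h3) (pair (pair h4 (fst.comp h5)) (snd.comp h5)))
  refine (impl_send.comp (h7.congr (g := start) fun x => ?_)).mono' 10 fun x => ?_
  · simp [start]
  · simp [initCost, internCost, enc_pair, enc_nil, enc_data, Data.mark, enc_zero, Data.size]
    omega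

end FoldView

/-! ### Construction of folded views: listing the nodes by levels -/

theorem Impl.toList : Impl Data.toList (fun _ => 0) := Impl.cast fun d => by
  induction d with
  | nil => rfl
  | cons a b _ ih => exact congrArg (Data.cons a) ih

namespace FoldView

/-- The nodes of the next level: their positions by name, their number, and their names, latest
first. -/
abbrev Queue : Type := Data × ℕ × List Data

/-- Taking `tl` strips the mark and leaves the encoded position. -/
def enqueue (x : Data) (q : Queue) : Data × Queue :=
  if (q.1.get x).toBool then ((q.1.get x).tl, q) else
    (enc q.2.1, q.1.set x (Data.mark q.2.1), q.2.1 + 1, x :: q.2.2)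

def visitEdge (s : Queue × ℕ × List Data) (c : Data) : Queue × ℕ × List Data :=
  let r := enqueue c.tl s.1
  (r.2, s.2.1 + 1, enc (s.2.1, c.hd, r.1, ()) :: s.2.2)

def visitEdgeCost (s : Queue × ℕ × List Data) (c : Data) : ℕ :=
  c.tl.size + s.1.2.1.size + s.2.1.size

def visitNode (ents : Data) (s : Queue × List Data) (x : Data) : Queue × List Data :=
  let r := (ents.get x).tl.toList.foldl visitEdge (s.1, 0, [])
  (r.1, Data.cons (ents.get x).hd (enc r.2.2.reverse) :: s.2)

def visitNodeCost (ents : Data) (s : Queue × List Data) (x : Data) : ℕ :=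
  x.size + Impl.foldCost visitEdgeCost visitEdge (s.1, 0, []) (ents.get x).tl.toList

def visitLevel (ents : Data) (s : List Data × List Data) (_ : Unit) : List Data × List Data :=
  let r := s.1.foldl (visitNode ents) ((Data.nil, 0, []), [])
  (r.1.2.2.reverse, enc r.2.reverse :: s.2)

def visitLevelCost (ents : Data) (s : List Data × List Data) (_ : Unit) : ℕ :=
  Impl.foldCost (visitNodeCost ents) (visitNode ents) ((Data.nil, 0, []), []) s.1 +
    (s.1.foldl (visitNode ents) ((Data.nil, 0, []), [])).1.2.2.length

def listing (x : Data × Data × List Unit) : Data :=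
  enc (x.2.2.foldl (visitLevel x.1) ([x.2.1], [])).2.reverse

def listingCost (x : Data × Data × List Unit) : ℕ :=
  Impl.foldCost (visitLevelCost x.1) (visitLevel x.1) ([x.2.1], []) x.2.2

/-- The additional `()` accounts for the levels `0, …, h`, which are `h + 1` in number. -/
def finish (st : State) : Bool × Data :=
  if st.1.1.isEmpty then (true, listing (st.2.2.2.2.1, st.2.2.1.2, () :: st.1.2))
  else (false, Data.nil)

def finishCost (st : State) : ℕ :=
  if st.1.1.isEmpty then listingCost (st.2.2.2.2.1, st.2.2.1.2, () :: st.1.2) else 0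

open Impl

theorem impl_enqueue : Impl (fun x : Data × Queue => enqueue x.1 x.2)
    (fun x => x.1.size + x.2.2.1.size) := by
  have hn : Impl (fun x : Data × Queue => x.2.2.1) (fun _ => 0) := fst.comp (snd.comp snd)
  have hg : Impl (fun x : Data × Queue => x.2.1.get x.1) (fun x => x.1.size) :=
    (get.comp (pair (fst.comp snd) fst)).mono fun _ => by simp
  refine (ite (toBool.comp hg) (pair (tl.comp hg) snd) (pair (encode.comp hn) (pair
    (set.comp (pair (fst.comp snd) (pair fst (mark.comp hn)))) (pair (succ.comp hn)
      (cons.comp (pair fst (snd.comp (snd.comp snd)))))))).mono' 2 fun x => ?_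
  dsimp only
  split_ifs <;> omega

theorem impl_visitEdge : Impl (fun x : (Queue × ℕ × List Data) × Data => visitEdge x.1 x.2)
    (fun x => visitEdgeCost x.1 x.2) := by
  have h1 : Impl (fun x : (Queue × ℕ × List Data) × Data => enqueue x.2.tl x.1.1) _ :=
    impl_enqueue.comp (pair (tl.comp snd) (fst.comp fst))
  have hi : Impl (fun x : ((Queue × ℕ × List Data) × Data) × Data × Queue => x.1.1.2.1)
      (fun _ => 0) := fst.comp (snd.comp (fst.comp fst))
  have h2 : Impl (fun x : ((Queue × ℕ × List Data) × Data) × Data × Queue => ((x.2.2, x.1.1.2.1 + 1,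
      enc (x.1.1.2.1, x.1.2.hd, x.2.1, ()) :: x.1.1.2.2) : Queue × ℕ × List Data))
      (fun x => x.1.1.2.1.size) :=
    (pair (snd.comp snd) (pair (succ.comp hi) (cons.comp (pair (encode.comp (pair hi (pair
      (hd.comp (snd.comp fst)) (pair (fst.comp snd) (const ()))))) (snd.comp (snd.comp
        (fst.comp fst))))))).mono fun _ => by simp
  refine (h2.comp (pair id h1)).mono fun x => ?_
  simp only [visitEdgeCost]
  omega

theorem length_foldl_visitEdge : ∀ (l : List Data) (s : Queue × ℕ × List Data),
    (l.foldl visitEdge s).2.2.length = s.2.2.length + l.length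
  | [], _ => rfl
  | c :: l, s => by
    rw [List.foldl_cons, length_foldl_visitEdge]
    simp [visitEdge]
    omega

theorem length_le_foldCost {α σ : Type} {T : σ → α → ℕ} {step : σ → α → σ} :
    ∀ (l : List α) (s : σ), l.length ≤ Impl.foldCost T step s l
  | [], _ => le_rfl
  | a :: l, s => by
    have := length_le_foldCost (T := T) (step := step) l (step s a)
    simp only [Impl.foldCost, List.length_cons]
    omega

theorem impl_visitNode : Impl (fun x : Data × (Queue × List Data) × Data => visitNode x.1 x.2.1 x.2.2)
    (fun x => visitNodeCost x.1 x.2.1 x.2.2) := by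
  have hg : Impl (fun x : Data × (Queue × List Data) × Data => x.1.get x.2.2)
      (fun x => x.2.2.size) := (get.comp (pair fst (snd.comp snd))).mono fun _ => by simp
  have hs : Impl (fun x : (Data × Queue) × (Queue × ℕ × List Data) × Data =>
      visitEdge x.2.1 x.2.2) (fun x => visitEdgeCost x.2.1 x.2.2) :=
    (impl_visitEdge.comp snd).mono fun _ => by simp
  have h1 := foldl (ε := Data × Queue) (l := fun x => x.1.tl.toList)
    (s₀ := fun x => ((x.2, 0, []) : Queue × ℕ × List Data)) (step := fun _ => visitEdge)
    (toList.comp (tl.comp fst)) (pair snd (const _)) hs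
  have h2 : Impl (fun x : (Data × List Data) × (Queue × ℕ × List Data) =>
      ((x.2.1, Data.cons x.1.1.hd (enc x.2.2.2.reverse) :: x.1.2) : Queue × List Data))
      (fun x => x.2.2.2.length) :=
    (pair (fst.comp snd) (cons.comp (pair (dcons.comp (pair (hd.comp (fst.comp fst))
      (encode.comp (reverse.comp (snd.comp (snd.comp snd)))))) (snd.comp fst)))).mono fun _ => by
        simp
  have h3 : Impl (fun x : Data × Queue × List Data => (((x.1, x.2.2),
      x.1.tl.toList.foldl visitEdge (x.2.1, 0, [])) : (Data × List Data) × (Queue × ℕ × List Data)))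
      _ := pair (pair fst (snd.comp snd)) (h1.comp (pair fst (fst.comp snd)))
  refine (h2.comp (h3.comp (pair hg (fst.comp snd)))).mono' 2 fun x => ?_
  simp only [visitNodeCost, length_foldl_visitEdge, List.length_nil]
  have := length_le_foldCost (T := visitEdgeCost) (step := visitEdge) (x.1.get x.2.2).tl.toList
    (x.2.1.1, 0, [])
  change _ + 0 + _ + (_ + (_ + (_ + foldCost visitEdgeCost _ _ _))) + _ ≤ _
  omega

theorem length_foldl_visitNode (ents : Data) : ∀ (l : List Data) (s : Queue × List Data),
    (l.foldl (visitNode ents) s).2.length = s.2.length + l.length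
  | [], _ => rfl
  | c :: l, s => by
    rw [List.foldl_cons, length_foldl_visitNode]
    simp [visitNode]
    omega

theorem impl_visitLevel :
    Impl (fun x : Data × (List Data × List Data) × Unit => visitLevel x.1 x.2.1 x.2.2)
      (fun x => visitLevelCost x.1 x.2.1 x.2.2) := by
  have hs : Impl (fun x : (Data × (List Data × List Data) × Unit) × (Queue × List Data) × Data =>
      visitNode x.1.1 x.2.1 x.2.2) (fun x => visitNodeCost x.1.1 x.2.1 x.2.2) :=
    (impl_visitNode.comp (pair (fst.comp fst) snd)).mono fun _ => by simp
  have h1 := foldl (ε := Data × (List Data × List Data) × Unit) (l := fun x => x.2.1.1)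
    (s₀ := fun _ => ((Data.nil, 0, []), [])) (step := fun x => visitNode x.1)
    (fst.comp (fst.comp snd)) (const _) hs
  have h2 : Impl (fun x : (Data × (List Data × List Data) × Unit) × Queue × List Data =>
      ((x.2.1.2.2.reverse, enc x.2.2.reverse :: x.1.2.1.2) : List Data × List Data))
      (fun x => x.2.1.2.2.length + x.2.2.length) :=
    (pair (reverse.comp (snd.comp (snd.comp (fst.comp snd)))) (cons.comp (pair
      (encode.comp (reverse.comp (snd.comp snd))) (snd.comp (fst.comp (snd.comp fst)))))).mono
      fun _ => by simp
  refine (h2.comp (pair id h1)).mono' 2 fun x => ?_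
  simp only [visitLevelCost, length_foldl_visitNode, List.length_nil]
  have := length_le_foldCost (T := visitNodeCost x.1) (step := visitNode x.1) x.2.1.1
    ((Data.nil, 0, []), [])
  change 0 + (_ + foldCost (visitNodeCost _) _ _ _) + _ ≤ _
  omega

theorem length_foldl_visitLevel (ents : Data) : ∀ (l : List Unit) (s : List Data × List Data),
    (l.foldl (visitLevel ents) s).2.length = s.2.length + l.length
  | [], _ => rfl
  | c :: l, s => by
    rw [List.foldl_cons, length_foldl_visitLevel]
    simp [visitLevel]
    omega

theorem impl_listing : Impl listing listingCost := by
  have hs : Impl (fun x : (Data × Data × List Unit) × (List Data × List Data) × Unit =>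
      visitLevel x.1.1 x.2.1 x.2.2) (fun x => visitLevelCost x.1.1 x.2.1 x.2.2) :=
    (impl_visitLevel.comp (pair (fst.comp fst) snd)).mono fun _ => by simp
  have h1 := foldl (ε := Data × Data × List Unit) (l := fun x => x.2.2)
    (s₀ := fun x => ([x.2.1], [])) (step := fun x => visitLevel x.1)
    (snd.comp snd) (pair (cons.comp (pair (fst.comp snd) (const []))) (const [])) hs
  refine (encode.comp (reverse.comp (snd.comp h1))).mono' 2 fun x => ?_
  simp only [length_foldl_visitLevel, List.length_nil]
  have := length_le_foldCost (T := visitLevelCost x.1) (step := visitLevel x.1) x.2.2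
    ([x.2.1], [])
  change _ + foldCost (visitLevelCost _) _ _ _ + _ + _ + _ ≤ 2 * (foldCost _ _ _ _ + 1)
  omega

theorem impl_finish : Impl finish finishCost := by
  have he : Impl (fun st : State => st.1.1.isEmpty) (fun _ => 0) := by
    have h1 : Impl (fun st : State => (enc st.1.1 : Data)) (fun _ => 0) :=
      (encode.comp (fst.comp fst)).mono fun _ => by simp
    refine ((ite (toBool.comp h1) (const false) (const true)).mono fun st => ?_).congr fun st => ?_
    · simp
    · cases h : st.1.1 <;> rfl
  have hl : Impl (fun st : State => listing (st.2.2.2.2.1, st.2.2.1.2, () :: st.1.2)) _ :=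
    impl_listing.comp (pair (fst.comp (snd.comp (snd.comp (snd.comp snd))))
      (pair (snd.comp (fst.comp (snd.comp snd))) (cons.comp (pair (const ()) (snd.comp fst)))))
  refine (ite he (pair (const true) hl) (const (false, Data.nil))).mono fun st => ?_
  simp [finishCost]

end FoldView

/-- Needed for `idxOf` in specifications; no program tests trees for equality. -/
noncomputable instance : DecidableEq Data := Classical.decEq Data

theorem List.IsPrefix.idxOf_eq {α : Type*} [DecidableEq α] {l l' : List α} (h : l <+: l') {a : α}
    (ha : a ∈ l) : l'.idxOf a = l.idxOf a := by
  obtain ⟨r, rfl⟩ := h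
  exact List.idxOf_append_of_mem ha

/-! ### Correctness and cost of the listing -/

namespace FoldView

open Impl

structure QueueGood (q : Queue) (E : List Data) : Prop where
  interned : Interned q.1 E
  length : q.2.1 = E.length
  names : q.2.2.reverse = E

theorem queueGood_empty : QueueGood (Data.nil, 0, []) [] := ⟨.empty, rfl, rfl⟩

theorem QueueGood.enqueue {q : Queue} {E : List Data} (h : QueueGood q E) (x : Data) :
    ∃ E', QueueGood (enqueue x q).2 E' ∧ E <+: E' ∧ x ∈ E' ∧ (∀ y ∈ E', y ∈ E ∨ y = x) ∧
      (enqueue x q).1 = enc (E'.idxOf x) := by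
  by_cases hx : x ∈ E
  · refine ⟨E, ?_, List.prefix_rfl, hx, fun y hy => Or.inl hy, ?_⟩
    · rw [FoldView.enqueue, if_pos (h.interned.toBool_get.2 hx)]
      exact h
    · rw [FoldView.enqueue, if_pos (h.interned.toBool_get.2 hx)]
      have h1 := h.interned.get (E.idxOf x) (List.idxOf_lt_length_iff.2 hx)
      rw [List.getElem_idxOf] at h1
      simp only [h1]
      rfl
  · refine ⟨E ++ [x], ?_, List.prefix_append _ _, by simp, fun y hy => by simpa using hy, ?_⟩
    · rw [FoldView.enqueue, if_neg (by rw [h.interned.toBool_get]; exact hx)]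
      refine ⟨?_, by simp [h.length], by simp [h.names]⟩
      simp only [h.length]
      exact h.interned.push hx
    · rw [FoldView.enqueue, if_neg (by rw [h.interned.toBool_get]; exact hx)]
      rw [List.idxOf_append_of_notMem hx]
      simp [h.length]

/-- The edge at port `c.2` with the data `c.1`, where `F` lists the nodes of the next level. -/
noncomputable def edgeData (F : List Data) (c : Data × ℕ) : Data :=
  enc (c.2, c.1.hd, (enc (F.idxOf c.1.tl) : Data), ())

noncomputable def nodeData (ents : Data) (F : List Data) (x : Data) : Data :=
  Data.cons (ents.get x).hd (enc (((ents.get x).tl.toList.zipIdx 0).map (edgeData F)))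

/-- The output is described relative to any list `F` that extends the names found so far. Positions
never move, so edges can be written before the next level is complete. -/
theorem foldl_visitEdge_spec {M W D : ℕ} : ∀ (cs : List Data) (q : Queue) (i : ℕ) (out : List Data)
    (E : List Data), QueueGood q E →
    let r := cs.foldl visitEdge (q, i, out)
    ∃ E', QueueGood r.1 E' ∧ E <+: E' ∧ (∀ c ∈ cs, c.tl ∈ E') ∧
      (∀ x ∈ E', x ∈ E ∨ ∃ c ∈ cs, c.tl = x) ∧
      (∀ F, E' <+: F → r.2.2.reverse = out.reverse ++ (cs.zipIdx i).map (edgeData F)) ∧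
      (E'.length ≤ M → i + cs.length ≤ D → (∀ c ∈ cs, c.tl.size ≤ W) →
        foldCost visitEdgeCost visitEdge (q, i, out) cs ≤ (W + M.size + D.size + 1) * cs.length)
  | [], q, i, out, E, hq => by
    refine ⟨E, hq, List.prefix_rfl, by simp, fun x hx => Or.inl hx, by simp, by simp [foldCost]⟩
  | c :: cs, q, i, out, E, hq => by
    obtain ⟨E₁, h1, h2, h3, h4, h5⟩ := hq.enqueue c.tl
    obtain ⟨E', g1, g2, g3, g4, g5, g6⟩ := foldl_visitEdge_spec (M := M) (W := W) (D := D) cs (enqueue c.tl q).2 (i + 1)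
      (enc (i, c.hd, (enqueue c.tl q).1, ()) :: out) E₁ h1
    refine ⟨E', g1, h2.trans g2, ?_, ?_, ?_, ?_⟩
    · rintro x hx
      rcases List.mem_cons.1 hx with rfl | hx
      · exact g2.subset h3
      · exact g3 x hx
    · intro x hx
      rcases g4 x hx with hx | ⟨d, hd, rfl⟩
      · rcases h4 x hx with hx | rfl
        · exact Or.inl hx
        · exact Or.inr ⟨c, by simp, rfl⟩
      · exact Or.inr ⟨d, by simp [hd], rfl⟩
    · intro F hF
      refine (g5 F hF).trans ?_
      rw [List.zipIdx_cons, List.map_cons, List.reverse_cons, List.append_assoc,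
        List.singleton_append, edgeData, (g2.trans hF).idxOf_eq h3, h5]
    · intro hM hD hW
      have := g6 hM (by simp at hD; omega) fun c hc => hW c (by simp [hc])
      have e1 : q.2.1.size ≤ M.size := Nat.size_le_size (by
        rw [hq.length]; exact (h2.trans g2).length_le.trans hM)
      have e2 : i.size ≤ D.size := Nat.size_le_size (by simp at hD; omega)
      have e3 := hW c (by simp)
      rw [List.length_cons, mul_add, mul_one, foldCost]
      have e4 : visitEdge (q, i, out) c =
        ((enqueue c.tl q).2, i + 1, enc (i, c.hd, (enqueue c.tl q).1, ()) :: out) := rfl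
      rw [e4]
      simp only [visitEdgeCost] at this ⊢
      omega

theorem foldl_visitNode_spec {M W D : ℕ} (ents : Data) : ∀ (l : List Data) (q : Queue)
    (out : List Data) (E : List Data), QueueGood q E →
    let r := l.foldl (visitNode ents) (q, out)
    ∃ E', QueueGood r.1 E' ∧ E <+: E' ∧ (∀ y ∈ l, ∀ c ∈ (ents.get y).tl.toList, c.tl ∈ E') ∧
      (∀ x ∈ E', x ∈ E ∨ ∃ y ∈ l, ∃ c ∈ (ents.get y).tl.toList, c.tl = x) ∧
      (∀ F, E' <+: F → r.2.reverse = out.reverse ++ l.map (nodeData ents F)) ∧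
      (E'.length ≤ M → (∀ y ∈ l, y.size ≤ W ∧ (ents.get y).tl.toList.length ≤ D ∧
          ∀ c ∈ (ents.get y).tl.toList, c.tl.size ≤ W) →
        foldCost (visitNodeCost ents) (visitNode ents) (q, out) l ≤
          (W + (W + M.size + D.size + 1) * D + 1) * l.length)
  | [], q, out, E, hq => by
    refine ⟨E, hq, List.prefix_rfl, by simp, fun x hx => Or.inl hx, by simp, by simp [foldCost]⟩
  | y :: l, q, out, E, hq => by
    obtain ⟨E₁, h1, h2, h3, h4, h5, h6⟩ := foldl_visitEdge_spec (M := M) (W := W) (D := D)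
      (ents.get y).tl.toList q 0 [] E hq
    obtain ⟨E', g1, g2, g3, g4, g5, g6⟩ := foldl_visitNode_spec (M := M) (W := W) (D := D) ents l
      _ (visitNode ents (q, out) y).2 E₁ h1
    refine ⟨E', g1, h2.trans g2, ?_, ?_, ?_, ?_⟩
    · intro x hx c hc
      rcases List.mem_cons.1 hx with rfl | hx
      · exact g2.subset (h3 c hc)
      · exact g3 x hx c hc
    · intro x hx
      rcases g4 x hx with hx | ⟨z, hz, d, hd, rfl⟩
      · rcases h4 x hx with hx | ⟨c, hc, rfl⟩
        · exact Or.inl hx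
        · exact Or.inr ⟨y, by simp, c, hc, rfl⟩
      · exact Or.inr ⟨z, by simp [hz], d, hd, rfl⟩
    · intro F hF
      refine (g5 F hF).trans ?_
      have := h5 F (g2.trans hF)
      rw [List.reverse_nil, List.nil_append] at this
      simp only [visitNode]
      rw [this]
      simp [nodeData]
    · intro hM hW
      have e1 := g6 hM fun y hy => hW y (by simp [hy])
      obtain ⟨e2, e3, e4⟩ := hW y (by simp)
      have e5 := h6 (g2.length_le.trans hM) (by omega) e4
      have e6 := Nat.mul_le_mul_left (W + M.size + D.size + 1) e3
      rw [List.length_cons, mul_add, mul_one, foldCost]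
      have e7 : (visitNode ents (q, out) y) =
        (((ents.get y).tl.toList.foldl visitEdge (q, 0, [])).1, (visitNode ents (q, out) y).2) := rfl
      rw [e7]
      simp only [visitNodeCost] at e1 ⊢
      omega

/-- The names of the next level, in the order in which they are found. -/
theorem visitLevel_spec {M W D : ℕ} (ents : Data) (l out : List Data) :
    ∃ E : List Data, visitLevel ents (l, out) () =
        (E, enc (l.map (nodeData ents E)) :: out) ∧
      E.Nodup ∧ (∀ x, x ∈ E ↔ ∃ y ∈ l, ∃ c ∈ (ents.get y).tl.toList, c.tl = x) ∧
      (E.length ≤ M → (∀ y ∈ l, y.size ≤ W ∧ (ents.get y).tl.toList.length ≤ D ∧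
          ∀ c ∈ (ents.get y).tl.toList, c.tl.size ≤ W) →
        visitLevelCost ents (l, out) () ≤
          (W + (W + M.size + D.size + 1) * D + 1) * l.length + M) := by
  obtain ⟨E, h1, -, h3, h4, h5, h6⟩ := foldl_visitNode_spec (M := M) (W := W) (D := D) ents l
    (Data.nil, 0, []) [] [] queueGood_empty
  have h7 := h5 E List.prefix_rfl
  rw [List.reverse_nil, List.nil_append] at h7
  refine ⟨E, ?_, h1.interned.nodup, fun x => ⟨fun hx => ?_, ?_⟩, fun hM hW => ?_⟩
  · simp only [visitLevel]
    rw [h7, h1.names]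
  · exact (h4 x hx).resolve_left (by simp)
  · rintro ⟨y, hy, c, hc, rfl⟩
    exact h3 y hy c hc
  · have := h6 hM hW
    have e : (l.foldl (visitNode ents) ((Data.nil, 0, []), [])).1.2.2.length = E.length := by
      rw [← h1.names, List.length_reverse]
    simp only [visitLevelCost]
    omega

end FoldView

namespace LevelList

theorem encodeEdge_injective : Function.Injective encodeEdge := by
  rintro ⟨⟨a, b⟩, c⟩ ⟨⟨a', b'⟩, c'⟩ h
  simp only [encodeEdge, Data.ofList, Data.cons.injEq] at h
  rw [Data.ofNat_injective h.1, Data.ofNat_injective h.2.1, Data.ofNat_injective h.2.2.1]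

theorem ofList_map_injective {α : Type} {f : α → Data} (hf : Function.Injective f) :
    Function.Injective fun l : List α => Data.ofList (l.map f) := fun l l' h => by
  have := congrArg Data.toList h
  simp only [Data.toList_ofList] at this
  exact List.map_injective_iff.2 hf this

theorem encodeNode_injective : Function.Injective encodeNode := by
  rintro ⟨a, l⟩ ⟨a', l'⟩ h
  simp only [encodeNode, Data.cons.injEq] at h
  rw [Data.ofInt_injective h.1, ofList_map_injective encodeEdge_injective h.2]

/-- For Boolean functions the encoded output serves as the key of a table, so it must determine the
level list. -/
theorem encode_injective : Function.Injective encode :=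
  ofList_map_injective (ofList_map_injective encodeNode_injective)

end LevelList

namespace FoldView

open Impl

section

variable {n : ℕ} {N : Network n} {X : Fin n → ℤ} {h : ℕ} {v : Fin n}

/-- `ν` names the nodes of the view of depth `h`, up to equality of the subtrees, and `ents`
holds the entries of all names. -/
structure Naming (N : Network n) (X : Fin n → ℤ) (h : ℕ) (ents : Data)
    (ν : (Σ w, N.graph.Walk v w) → Data) : Prop where
  get : ∀ p, p.2.length ≤ h → ents.get (ν p) = enc (Data.ofInt (X p.1),
    if p.2.length < h then List.ofFn fun i : Fin (N.deg p.1) =>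
      ((enc (N.backPort p.1 i : ℕ) : Data), ν (N.ext p i)) else [])
  iff : ∀ p q, p.2.length ≤ h → p.2.length = q.2.length → (ν p = ν q ↔
    N.viewTree X (h - p.2.length) p.1 = N.viewTree X (h - p.2.length) q.1)

/-- The names of the nodes of depth `j`. -/
def levelNames (ents x : Data) : ℕ → List Data
  | 0 => [x]
  | j + 1 => (visitLevel ents (levelNames ents x j, []) ()).1

theorem foldl_visitLevel_eq (ents x : Data) (k : ℕ) :
    (List.replicate k ()).foldl (visitLevel ents) ([x], []) = (levelNames ents x k,
      ((List.range k).map fun j => (enc ((levelNames ents x j).map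
        (nodeData ents (levelNames ents x (j + 1)))) : Data)).reverse) := by
  induction k with
  | zero => rfl
  | succ k ih =>
    rw [List.replicate_succ', List.foldl_append, ih, List.foldl_cons, List.foldl_nil]
    obtain ⟨E, h1, -⟩ := visitLevel_spec (M := 0) (W := 0) (D := 0) ents (levelNames ents x k)
      ((List.range k).map fun j => (enc ((levelNames ents x j).map
        (nodeData ents (levelNames ents x (j + 1)))) : Data)).reverse
    have h2 : levelNames ents x (k + 1) = E := congrArg Prod.fst h1
    rw [h1, ← h2, List.range_succ]
    simp

variable {ents : Data} {ν : (Σ w, N.graph.Walk v w) → Data}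

namespace Naming

theorem toList_get (hν : Naming N X h ents ν) (p : Σ w, N.graph.Walk v w) (hp : p.2.length ≤ h) :
    (ents.get (ν p)).tl.toList = if p.2.length < h then List.ofFn fun i : Fin (N.deg p.1) =>
      Data.cons (enc (N.backPort p.1 i : ℕ)) (ν (N.ext p i)) else [] := by
  rw [hν.get p hp, enc_pair, Data.tl]
  change (Data.ofList (List.map enc _)).toList = _
  rw [Data.toList_ofList]
  split_ifs
  · rw [List.map_ofFn]; rfl
  · rfl

/-- The entry of a name lists the names of the one-edge extensions of any walk that bears it, so the
search by names follows the walks level by level. -/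
theorem mem_levelNames (hν : Naming N X h ents ν) (j : ℕ) (x : Data) :
    x ∈ levelNames ents (ν ⟨v, .nil⟩) j ↔ ∃ p : Σ w, N.graph.Walk v w,
      p.2.length = j ∧ j ≤ h ∧ ν p = x := by
  induction j generalizing x with
  | zero =>
    rw [levelNames, List.mem_singleton]
    constructor
    · rintro rfl
      exact ⟨_, rfl, Nat.zero_le _, rfl⟩
    · rintro ⟨⟨w, p⟩, hp, -, rfl⟩
      cases p with
      | nil => rfl
      | cons _ _ => simp at hp
  | succ j ih =>
    obtain ⟨E, h1, -, h2, -⟩ := visitLevel_spec (M := 0) (W := 0) (D := 0) ents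
      (levelNames ents (ν ⟨v, .nil⟩) j) []
    rw [levelNames, h1, h2]
    constructor
    · rintro ⟨y, hy, c, hc, rfl⟩
      obtain ⟨p, rfl, hp, rfl⟩ := (ih y).1 hy
      rw [hν.toList_get p hp] at hc
      split_ifs at hc with hlt
      · obtain ⟨i, rfl⟩ := (List.mem_ofFn' _ _).1 hc
        exact ⟨N.ext p i, N.length_ext p i, hlt, rfl⟩
      · simp at hc
    · rintro ⟨q, hq, hlt, rfl⟩
      obtain ⟨p, i, rfl⟩ := N.exists_ext q (by omega)
      rw [N.length_ext] at hq
      have hp : p.2.length = j := by omega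
      refine ⟨ν p, (ih _).2 ⟨p, hp, by omega, rfl⟩, Data.cons (enc (N.backPort p.1 i : ℕ)) (ν (N.ext p i)), ?_, rfl⟩
      rw [hν.toList_get p (by omega), if_pos (by omega)]
      exact (List.mem_ofFn' _ _).2 ⟨i, rfl⟩

theorem nodup_levelNames (x : Data) (j : ℕ) : (levelNames ents x j).Nodup := by
  cases j with
  | zero => simp [levelNames]
  | succ j =>
    obtain ⟨E, h1, h2, -⟩ := visitLevel_spec (M := 0) (W := 0) (D := 0) ents
      (levelNames ents x j) []
    rw [levelNames, h1]
    exact h2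

/-- At a fixed depth the name depends only on the end of the walk. -/
theorem length_levelNames_le (hν : Naming N X h ents ν) (j : ℕ) :
    (levelNames ents (ν ⟨v, .nil⟩) j).length ≤ n := by
  choose p h1 h2 h3 using fun k : Fin (levelNames ents (ν ⟨v, .nil⟩) j).length =>
    (hν.mem_levelNames j _).1 (List.getElem_mem k.2)
  have : Function.Injective fun k => (p k).1 := by
    intro a b hab
    have := (hν.iff (p a) (p b) (by rw [h1]; exact h2 a) (by rw [h1, h1])).2 (congrArg _ hab)
    rw [h3, h3] at this
    exact Fin.ext ((nodup_levelNames _ j).getElem_inj_iff.1 this)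
  simpa using Fintype.card_le_of_injective _ this

/-- The node of a level list for a walk. -/
noncomputable def node (N : Network n) (X : Fin n → ℤ) (h : ℕ) (F : List Data)
    (ν : (Σ w, N.graph.Walk v w) → Data) (p : Σ w, N.graph.Walk v w) : ℤ × List ((ℕ × ℕ) × ℕ) :=
  (X p.1, if p.2.length < h then List.ofFn fun i : Fin (N.deg p.1) =>
    (((i : ℕ), (N.backPort p.1 i : ℕ)), F.idxOf (ν (N.ext p i))) else [])

theorem encodeNode_node (hν : Naming N X h ents ν) (F : List Data) (p : Σ w, N.graph.Walk v w)
    (hp : p.2.length ≤ h) :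
    LevelList.encodeNode (node N X h F ν p) = nodeData ents F (ν p) := by
  rw [nodeData, hν.toList_get p hp, hν.get p hp, enc_pair, Data.hd, LevelList.encodeNode, node]
  refine congrArg (Data.cons _) ?_
  change _ = Data.ofList (List.map id _)
  rw [List.map_id]
  congr 1
  split_ifs
  · apply List.ext_getElem
    · simp
    · intro i h1 h2
      simp [edgeData]
      rfl
  · rfl

theorem exists_isLayout (hn : 2 ≤ n) (hν : Naming N X h ents ν) :
    ∃ c pos, N.IsLayout X h v c pos ∧
      listing (ents, ν ⟨v, .nil⟩, List.replicate (h + 1) ()) = c.encode := by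
  classical
  set L := levelNames ents (ν ⟨v, .nil⟩) with hL
  -- A list node is defined through some walk with the given name. By `hnd` any such walk will do,
  -- since the encoded node is a function of the name and the encoding is injective.
  let nd : ℕ → Data → ℤ × List ((ℕ × ℕ) × ℕ) := fun j x =>
    if hx : ∃ p : Σ w, N.graph.Walk v w, p.2.length = j ∧ j ≤ h ∧ ν p = x then
      node N X h (L (j + 1)) ν hx.choose else (0, [])
  have hnd : ∀ p : Σ w, N.graph.Walk v w, p.2.length ≤ h →
      nd p.2.length (ν p) = node N X h (L (p.2.length + 1)) ν p := by
    intro p hp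
    have hx : ∃ q : Σ w, N.graph.Walk v w, q.2.length = p.2.length ∧ p.2.length ≤ h ∧ ν q = ν p :=
      ⟨p, rfl, hp, rfl⟩
    simp only [nd, dif_pos hx]
    obtain ⟨h1, h2, h3⟩ := hx.choose_spec
    apply LevelList.encodeNode_injective
    rw [hν.encodeNode_node _ _ (h1.le.trans hp), hν.encodeNode_node _ _ hp, h3]
  let c : LevelList := (List.range (h + 1)).map fun j => (L j).map (nd j)
  have hc : ∀ j ≤ h, c.getD j [] = (L j).map (nd j) := by
    intro j hj
    rw [List.getD_eq_getElem _ _ (by simp [c]; omega)]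
    simp [c]
  have hc' : ∀ j, h < j → c.getD j [] = [] := by
    intro j hj
    rw [List.getD_eq_default _ _ (by simp [c]; omega)]
  have hmem : ∀ p : Σ w, N.graph.Walk v w, p.2.length ≤ h → ν p ∈ L p.2.length := fun p hp =>
    (hν.mem_levelNames _ _).2 ⟨p, rfl, hp, rfl⟩
  refine ⟨c, fun p => (L p.2.length).idxOf (ν p), ⟨?_, ?_, ?_, ?_, ?_⟩, ?_⟩
  · intro hne
    obtain ⟨j, hj, hj'⟩ := List.mem_map.1 hne
    rw [List.mem_range] at hj
    obtain ⟨p, rfl⟩ := N.exists_walk_length_eq hn v j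
    rw [List.map_eq_nil_iff] at hj'
    have := hmem p (by omega)
    rw [hj'] at this
    simp at this
  · simp [hL, levelNames]
  · intro p hp
    rw [hc _ hp, List.getElem?_map, List.getElem?_eq_getElem (List.idxOf_lt_length_iff.2 (hmem p hp)),
      List.getElem_idxOf, Option.map_some, hnd p hp, node]
    simp only [N.length_ext]
  · intro j k hk
    by_cases hj : j ≤ h
    · rw [hc j hj, List.length_map] at hk
      obtain ⟨p, h1, -, h2⟩ := (hν.mem_levelNames j _).1 (List.getElem_mem hk)
      refine ⟨p, h1, ?_, hj⟩
      rw [h1, h2]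
      exact (nodup_levelNames _ j).idxOf_getElem k hk
    · rw [hc' j (by omega)] at hk
      simp at hk
  · intro p q hp hpq
    rw [← hν.iff p q hp hpq, ← hpq]
    exact List.idxOf_inj (hmem p hp)
  · rw [listing, foldl_visitLevel_eq, List.reverse_reverse, LevelList.encode, List.map_map]
    change Data.ofList (List.map id _) = _
    rw [List.map_id]
    refine congrArg _ (List.map_congr_left fun j hj => ?_)
    rw [List.mem_range] at hj
    simp only [Function.comp, List.map_map]
    change Data.ofList (List.map id _) = _
    rw [List.map_id]
    refine congrArg _ (List.map_congr_left fun x hx => ?_)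
    obtain ⟨p, rfl, hp, rfl⟩ := (hν.mem_levelNames j x).1 hx
    rw [Function.comp, hnd p hp, hν.encodeNode_node _ _ hp]

theorem listingCost_le (hν : Naming N X h ents ν) {W : ℕ}
    (hW : ∀ p : Σ w, N.graph.Walk v w, p.2.length ≤ h → (ν p).size ≤ W) :
    listingCost (ents, ν ⟨v, .nil⟩, List.replicate (h + 1) ()) ≤
      ((W + (W + n.size + N.maxDeg.size + 1) * N.maxDeg + 1) * n + n + 1) * (h + 1) := by
  obtain ⟨-, hcost⟩ := Impl.foldl_inv (T := visitLevelCost ents) (step := visitLevel ents)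
    (fun _ => (W + (W + n.size + N.maxDeg.size + 1) * N.maxDeg + 1) * n + n)
    (fun s _ => ∃ j, s.1 = levelNames ents (ν ⟨v, .nil⟩) j) (by
      rintro ⟨_, out⟩ a l ⟨j, rfl⟩
      refine ⟨?_, j + 1, rfl⟩
      obtain ⟨E, h1, h2, h3, h4⟩ := visitLevel_spec (M := n) (W := W) (D := N.maxDeg) ents
        (levelNames ents (ν ⟨v, .nil⟩) j) out
      have hE : E = levelNames ents (ν ⟨v, .nil⟩) (j + 1) := (congrArg Prod.fst h1).symm
      refine (h4 (hE ▸ hν.length_levelNames_le (j + 1)) ?_).trans ?_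
      · intro y hy
        obtain ⟨p, rfl, hp, rfl⟩ := (hν.mem_levelNames j y).1 hy
        rw [hν.toList_get p hp]
        refine ⟨hW p hp, ?_, ?_⟩
        · split_ifs
          · simpa using N.deg_le_maxDeg p.1
          · simp
        · intro c hc
          split_ifs at hc
          · obtain ⟨i, rfl⟩ := (List.mem_ofFn' _ _).1 hc
            exact hW (N.ext p i) (by rw [N.length_ext]; omega)
          · simp at hc
      · have := Nat.mul_le_mul_left (W + (W + n.size + N.maxDeg.size + 1) * N.maxDeg + 1)
          (hν.length_levelNames_le j)
        omega) (List.replicate (h + 1) ()) ([ν ⟨v, .nil⟩], []) ⟨0, rfl⟩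
  refine hcost.trans ?_
  rw [List.map_replicate, List.sum_replicate, smul_eq_mul, mul_comm]

end Naming

end

end FoldView

/-! ### Construction of folded views: tables of trees -/

namespace FoldView

open Impl

/-- The name of a tree in the table `K`. -/
noncomputable def name (K : List Data) (T : Data) : Data := Data.mark (K.idxOf T)

def children (T : Data) : List Data := T.tl.toList

/-- The entry of a tree, when its subtrees are named by `ρ`. -/
def entryOf (ρ : Data → Data) (T : Data) : Entry := (T.hd, (children T).map fun c => (c.hd, ρ c.tl))

/-- Trees in which each edge carries a number. -/
def IsNode (T : Data) : Prop :=
  T = Data.cons T.hd (Data.ofList ((children T).map fun c => Data.cons c.hd c.tl))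

/-- Bounds for the label, the degree and the port numbers at the root. -/
structure Small (W D : ℕ) (T : Data) : Prop where
  label : T.hd.size ≤ W
  degree : (children T).length ≤ D
  port : ∀ c ∈ children T, c.hd.size ≤ W

noncomputable def insertTree (K : List Data) (T : Data) : List Data := if T ∈ K then K else K ++ [T]

theorem prefix_insertTree (K : List Data) (T : Data) : K <+: insertTree K T := by
  unfold insertTree; split_ifs
  · exact List.prefix_rfl
  · exact List.prefix_append _ _

theorem mem_insertTree {K : List Data} {T U : Data} : U ∈ insertTree K T ↔ U ∈ K ∨ U = T := by
  unfold insertTree; split_ifs with h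
  · exact ⟨Or.inl, fun hU => hU.elim _root_.id fun e => e ▸ h⟩
  · simp

theorem length_insertTree_le (K : List Data) (T : Data) :
    (insertTree K T).length ≤ K.length + 1 := by
  unfold insertTree; split_ifs <;> simp

theorem name_eq_of_prefix {K K' : List Data} (h : K <+: K') {T : Data} (hT : T ∈ K) :
    name K' T = name K T := by rw [name, name, h.idxOf_eq hT]

theorem name_inj {K : List Data} {T U : Data} (hT : T ∈ K) : name K T = name K U ↔ T = U := by
  rw [name, name, Data.mark_injective.eq_iff, List.idxOf_inj hT]

theorem entryOf_congr {ρ ρ' : Data → Data} {T : Data} (h : ∀ c ∈ children T, ρ c.tl = ρ' c.tl) :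
    entryOf ρ T = entryOf ρ' T := by
  unfold entryOf
  congr 1
  exact List.map_congr_left fun c hc => by rw [h c hc]

/-- Names are injective on the table, so the entry determines the children and hence the tree.
Membership is needed for the children of one of the two trees only. -/
theorem entryOf_inj {K : List Data} {T U : Data} (hT : IsNode T) (hU : IsNode U)
    (hTK : ∀ c ∈ children T, c.tl ∈ K)
    (h : entryOf (name K) T = entryOf (name K) U) : T = U := by
  simp only [entryOf, Prod.mk.injEq] at h
  rw [hT, hU, h.1]
  congr 2
  have h2 := h.2
  clear h hT hU
  generalize children U = l' at h2 ⊢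
  revert hTK h2 l'
  generalize children T = l
  induction l with
  | nil =>
    intro hTK l' h2
    cases l' with
    | nil => rfl
    | cons _ _ => simp at h2
  | cons c l ih =>
    intro hTK l' h2
    cases l' with
    | nil => simp at h2
    | cons c' l' =>
      simp only [List.map_cons, List.cons.injEq, Prod.mk.injEq] at h2
      rw [List.map_cons, List.map_cons, ih (fun c hc => hTK c (by simp [hc])) l' h2.2, h2.1.1,
        (name_inj (hTK c (by simp))).1 h2.1.2]

theorem enc_entry_injective : Function.Injective (enc : Entry → Data) := by
  have hid : Function.Injective (enc : Data → Data) := Function.injective_id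
  exact enc_prod_injective hid (enc_list_injective (enc_prod_injective hid hid))

/-- The size of an entry with bounded label, port numbers and names. -/
def entryBound (W D : ℕ) : ℕ := W + (2 * W + 2) * D + 2

theorem size_entryOf_le {W D : ℕ} {T : Data} {ρ : Data → Data} (hT : Small W D T)
    (hρ : ∀ c ∈ children T, (ρ c.tl).size ≤ W) :
    (enc (entryOf ρ T) : Data).size ≤ entryBound W D := by
  have h1 := hT.label
  have h2 := size_enc_list_le (B := 2 * W + 1) ((children T).map fun c => (c.hd, ρ c.tl)) (by
    intro a ha
    obtain ⟨c, hc, rfl⟩ := List.mem_map.1 ha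
    have := hT.port c hc
    have := hρ c hc
    simp only [enc_pair, enc_data, Data.size]
    omega)
  have h3 := Nat.mul_le_mul_left (2 * W + 2) hT.degree
  rw [List.length_map, show 2 * W + 1 + 1 = 2 * W + 2 from rfl] at h2
  simp only [entryOf, enc_pair, enc_data, Data.size, entryBound]
  omega

theorem size_name_le {W M : ℕ} (hM : 4 * M.size + 3 ≤ W) {K : List Data} (hK : K.length ≤ M)
    (T : Data) : (name K T).size ≤ W :=
  (Data.size_mark_le (List.idxOf_le_length.trans hK)).trans hM

/-- A table whose subtrees are listed before the trees. -/
structure Closed (K : List Data) : Prop where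
  nodup : K.Nodup
  isNode : ∀ T ∈ K, IsNode T
  children : ∀ K' T, K' ++ [T] <+: K → ∀ c ∈ children T, c.tl ∈ K'

theorem Closed.child_mem {K : List Data} (h : Closed K) {T : Data} (hT : T ∈ K) {c : Data}
    (hc : c ∈ FoldView.children T) : c.tl ∈ K := by
  obtain ⟨s, t, rfl⟩ := List.append_of_mem hT
  exact List.mem_append_left _ (h.children s T ⟨t, by simp⟩ c hc)

theorem Closed.insertTree {K : List Data} (h : Closed K) {T : Data} (hT : IsNode T)
    (hTK : ∀ c ∈ FoldView.children T, c.tl ∈ K) : Closed (insertTree K T) := by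
  unfold FoldView.insertTree
  split_ifs with hmem
  · exact h
  · refine ⟨?_, ?_, ?_⟩
    · rw [← List.concat_eq_append]
      exact h.nodup.concat hmem
    · intro U hU
      rcases List.mem_append.1 hU with hU | hU
      · exact h.isNode U hU
      · rw [List.mem_singleton.1 hU]; exact hT
    · intro K' U hU c hc
      rcases List.prefix_concat_iff.1 hU with heq | hU
      · obtain ⟨rfl, h2⟩ := List.append_inj' heq rfl
        obtain rfl : U = T := by simpa using h2
        exact hTK c hc
      · exact h.children K' U hU c hc

/-- The book `b` describes the table `K`, and its recent entries are those from `k` on. -/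
structure BookGood (b : Book) (K : List Data) (k : ℕ) : Prop where
  closed : Closed K
  interned : Interned b.1 (K.map fun T => enc (entryOf (name K) T))
  ents : ∀ T ∈ K, b.2.1.get (name K T) = enc (entryOf (name K) T)
  cnt : b.2.2.1 = K.length
  le : k ≤ K.length
  pend : b.2.2.2.reverse = (K.drop k).map fun T => (name K T, entryOf (name K) T)

theorem Closed.entryOf_eq {K K' : List Data} (h : Closed K) (hK : K <+: K') {T : Data}
    (hT : T ∈ K) : entryOf (name K') T = entryOf (name K) T :=
  entryOf_congr fun _ hc => name_eq_of_prefix hK (h.child_mem hT hc)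

/-- A tree is recognised by its entry alone. A new tree goes to the end of the table, which changes
neither the old names nor the old entries. -/
theorem BookGood.intern {b : Book} {K : List Data} {k : ℕ} (h : BookGood b K k) {T : Data}
    (hT : IsNode T) (hTK : ∀ c ∈ FoldView.children T, c.tl ∈ K) :
    BookGood (intern (entryOf (name K) T) b).2 (insertTree K T) k ∧
      (intern (entryOf (name K) T) b).1 = name (insertTree K T) T := by
  by_cases hmem : T ∈ K
  · have h1 : b.1.get (enc (entryOf (name K) T)) = name K T := by
      have := h.interned.get (K.idxOf T) (by simpa using List.idxOf_lt_length_iff.2 hmem)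
      rw [List.getElem_map, List.getElem_idxOf] at this
      exact this
    have h2 : insertTree K T = K := if_pos hmem
    rw [FoldView.intern, if_pos (by rw [h1]; rfl), h1, h2]
    exact ⟨h, rfl⟩
  · have h2 : insertTree K T = K ++ [T] := if_neg hmem
    -- An equal entry could only come from `T` itself, by `entryOf_inj`.
    have h0 : (enc (entryOf (name K) T) : Data) ∉ K.map fun T => enc (entryOf (name K) T) := by
      intro hx
      obtain ⟨U, hU, hUT⟩ := List.mem_map.1 hx
      have := entryOf_inj (h.closed.isNode U hU) hT (fun c hc => h.closed.child_mem hU hc)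
        (enc_entry_injective hUT)
      exact hmem (this ▸ hU)
    have hpre : K <+: K ++ [T] := List.prefix_append _ _
    have h3 : name (K ++ [T]) T = Data.mark K.length := by
      rw [name, List.idxOf_append_of_notMem hmem]; simp
    have h4 : ∀ U ∈ K, entryOf (name (K ++ [T])) U = entryOf (name K) U := fun U hU =>
      h.closed.entryOf_eq hpre hU
    have h5 : entryOf (name (K ++ [T])) T = entryOf (name K) T :=
      entryOf_congr fun c hc => name_eq_of_prefix hpre (hTK c hc)
    have hmap : ((K ++ [T]).map fun U => (enc (entryOf (name (K ++ [T])) U) : Data)) =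
        (K.map fun U => (enc (entryOf (name K) U) : Data)) ++ [enc (entryOf (name K) T)] := by
      rw [List.map_append, List.map_singleton, h5,
        List.map_congr_left fun U hU => by rw [h4 U hU]]
    rw [FoldView.intern, if_neg (by rw [h.interned.toBool_get]; exact h0), h2]
    refine ⟨⟨?_, ?_, ?_, ?_, ?_, ?_⟩, ?_⟩
    · rw [← h2]
      exact h.closed.insertTree hT hTK
    · rw [hmap, h.cnt]
      simpa using h.interned.push h0
    · intro U hU
      simp only
      rw [h.cnt, Data.get_set, ← h3]
      rcases List.mem_append.1 hU with hU | hU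
      · rw [if_neg, h4 U hU, name_eq_of_prefix hpre hU]
        · exact h.ents U hU
        · intro he
          rw [name_inj (by simp [hU])] at he
          exact hmem (he ▸ hU)
      · obtain rfl := List.mem_singleton.1 hU
        rw [if_pos rfl, h5]
    · simp [h.cnt]
    · have := h.le
      simp; omega
    · simp only [List.reverse_cons]
      rw [h.pend, List.drop_append_of_le_length h.le, List.map_append, List.map_singleton, h5, h3,
        h.cnt]
      congr 1
      refine List.map_congr_left fun U hU => ?_
      have hU' := List.mem_of_mem_drop hU
      rw [h4 U hU', name_eq_of_prefix hpre hU']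
    · rw [h3, h.cnt]

theorem internCost_le {b : Book} {K : List Data} {k W D M : ℕ} (h : BookGood b K k)
    (hM : 4 * M.size + 3 ≤ W) (hK : K.length ≤ M) {T : Data} (hT : Small W D T) :
    internCost (entryOf (name K) T) b ≤ entryBound W D + 2 * W := by
  have h1 := size_entryOf_le (ρ := name K) hT fun c _ => size_name_le hM hK _
  have h2 := Data.size_mark_le (h.cnt.le.trans hK)
  have h3 := Nat.size_le_size (h.cnt.le.trans hK)
  simp only [internCost]
  omega

/-- The table `m` translates the names of the trees in `L` into names for the table `K`. -/
def MapGood (m : Data) (L K : List Data) : Prop := ∀ T ∈ L, T ∈ K ∧ m.get (name L T) = name K T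

theorem MapGood.of_prefix {m : Data} {L K K' : List Data} (h : MapGood m L K) (hK : K <+: K') :
    MapGood m L K' := fun T hT =>
  ⟨hK.subset (h T hT).1, (h T hT).2.trans (name_eq_of_prefix hK (h T hT).1).symm⟩

/-- The sender's table has grown from `L` to `L'` without renaming, so the names of the children are
among those already translated. -/
theorem MapGood.translate {m : Data} {L L' K : List Data} (h : MapGood m L K) (hL : L <+: L')
    {T : Data} (hT : ∀ c ∈ FoldView.children T, c.tl ∈ L) :
    translate m (entryOf (name L') T) = entryOf (name K) T := by
  simp only [FoldView.translate, entryOf, List.map_map]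
  congr 1
  refine List.map_congr_left fun c hc => ?_
  simp only [Function.comp]
  rw [name_eq_of_prefix hL (hT c hc), (h _ (hT c hc)).2]

/-- Inserting the trees of a list into a table. -/
noncomputable def insertTrees (K L : List Data) : List Data := L.foldl insertTree K

theorem prefix_insertTrees (L : List Data) : ∀ K, K <+: insertTrees K L := by
  induction L with
  | nil => exact fun K => List.prefix_rfl
  | cons T L ih => exact fun K => (prefix_insertTree K T).trans (ih _)

theorem mem_insertTrees {L : List Data} {U : Data} : ∀ {K}, U ∈ insertTrees K L ↔ U ∈ K ∨ U ∈ L := by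
  induction L with
  | nil => simp [insertTrees]
  | cons T L ih =>
    intro K
    have : insertTrees K (T :: L) = insertTrees (insertTree K T) L := rfl
    rw [this, ih, mem_insertTree, List.mem_cons, or_assoc]

theorem length_insertTrees_le (L : List Data) : ∀ K, (insertTrees K L).length ≤ K.length + L.length := by
  induction L with
  | nil => exact fun K => le_rfl
  | cons T L ih =>
    intro K
    have h1 := ih (insertTree K T)
    have h2 := length_insertTree_le K T
    have : insertTrees K (T :: L) = insertTrees (insertTree K T) L := rfl
    rw [this, List.length_cons]
    omega

/-- Receiving the trees `R` after the trees `L`, all of them in the table `L'` of the sender. -/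
theorem foldl_recvEntry_spec {W D M : ℕ} (hM : 4 * M.size + 3 ≤ W) {L' : List Data}
    (hL' : Closed L') {k : ℕ} (hD : L'.length ≤ M → ∀ T ∈ L', Small W D T) :
    ∀ (R L : List Data) (m : Data) (b : Book) (K : List Data), L ++ R = L' → BookGood b K k →
      MapGood m L K →
      let r := (R.map fun T => (name L' T, entryOf (name L') T)).foldl recvEntry (m, b)
      BookGood r.2 (insertTrees K R) k ∧ MapGood r.1 L' (insertTrees K R) ∧
      (L'.length ≤ M → (insertTrees K R).length ≤ M →
        foldCost recvEntryCost recvEntry (m, b)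
          (R.map fun T => (name L' T, entryOf (name L') T)) ≤
            (2 * entryBound W D + 3 * W + 2) * R.length)
  | [], L, m, b, K, hL, hb, hm => by
    rw [List.append_nil] at hL
    subst hL
    exact ⟨hb, hm, by simp [foldCost]⟩
  | T :: R, L, m, b, K, hL, hb, hm => by
    have hpre : L ++ [T] <+: L' := ⟨R, by simpa using hL⟩
    have hpre0 : L <+: L' := (List.prefix_append _ _).trans hpre
    have hTL' : T ∈ L' := hpre.subset (by simp)
    -- Subtrees precede trees in the sender's table, so all children of `T` lie in the part received
    -- before.
    have hch := hL'.children L T hpre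
    have hTL : T ∉ L := by
      have := (hL'.nodup.sublist hpre.sublist)
      rw [List.nodup_append] at this
      exact fun hT => this.2.2 T hT T (by simp) rfl
    have htr : translate m (entryOf (name L') T) = entryOf (name K) T := hm.translate hpre0 hch
    have hchK : ∀ c ∈ children T, c.tl ∈ K := fun c hc => (hm _ (hch c hc)).1
    obtain ⟨h1, h2⟩ := hb.intern (hL'.isNode T hTL') hchK
    have hKpre := prefix_insertTree K T
    have hm' : MapGood (m.set (name L' T) (intern (entryOf (name K) T) b).1) (L ++ [T])
        (insertTree K T) := by
      intro U hU
      rw [← name_eq_of_prefix hpre hU, Data.get_set]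
      rcases List.mem_append.1 hU with hUL | hUT
      · rw [if_neg]
        · obtain ⟨e1, e2⟩ := hm U hUL
          rw [name_eq_of_prefix hpre0 hUL, e2, name_eq_of_prefix hKpre e1]
          exact ⟨hKpre.subset e1, rfl⟩
        · rw [name_inj (hpre.subset hU)]
          rintro rfl
          exact hTL hUL
      · obtain rfl := List.mem_singleton.1 hUT
        rw [if_pos rfl, h2]
        exact ⟨mem_insertTree.2 (Or.inr rfl), rfl⟩
    have hstep : recvEntry (m, b) (name L' T, entryOf (name L') T) =
        (m.set (name L' T) (intern (entryOf (name K) T) b).1, (intern (entryOf (name K) T) b).2) := by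
      simp only [recvEntry, htr]
    obtain ⟨g1, g2, g3⟩ := foldl_recvEntry_spec hM hL' hD R (L ++ [T]) _ _ _ (by simpa using hL)
      h1 hm'
    have hins : insertTrees K (T :: R) = insertTrees (insertTree K T) R := rfl
    simp only [List.map_cons, List.foldl_cons, foldCost, hstep, hins]
    refine ⟨g1, g2, fun e1 e2 => ?_⟩
    have e3 := g3 e1 e2
    have hKM : K.length ≤ M :=
      ((hKpre.trans (prefix_insertTrees R _)).length_le).trans e2
    have hT := hD e1 T hTL'
    have e4 := internCost_le hb hM hKM hT
    have e5 := size_entryOf_le (ρ := name L') hT fun c _ => size_name_le hM e1 _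
    have e6 := size_name_le hM e1 T
    have e7 : (enc (name L' T, entryOf (name L') T) : Data).size =
      (name L' T).size + (enc (entryOf (name L') T) : Data).size + 1 := rfl
    simp only [recvEntryCost, htr, e7, List.length_cons, mul_add, mul_one]
    omega

end FoldView

/-! ### Construction of folded views: a round -/

namespace FoldView

open Impl

/-- What a neighbour sends: its port, the table of trees known to the receiver, its present
table, and its present tree. -/
structure Source where
  port : Data
  old : List Data
  cur : List Data
  tree : Data

namespace Source

noncomputable def recent (s : Source) : List Data := s.cur.drop s.old.length

noncomputable def msg (s : Source) : Msg :=
  (s.port, name s.cur s.tree, s.recent.map fun T => (name s.cur T, entryOf (name s.cur) T))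

structure Good (s : Source) : Prop where
  closed : Closed s.cur
  old_prefix : s.old <+: s.cur
  mem : s.tree ∈ s.cur

theorem Good.append_recent {s : Source} (h : s.Good) : s.old ++ s.recent = s.cur := by
  obtain ⟨t, ht⟩ := h.old_prefix
  rw [recent, ← ht]
  simp

structure Bounded (W D M : ℕ) (s : Source) : Prop where
  port : s.port.size ≤ W
  length : s.cur.length ≤ M
  small : ∀ T ∈ s.cur, Small W D T

end Source

def msgBound (W D : ℕ) : ℕ := 3 * entryBound W D + 4 * W + 5

theorem Source.Bounded.size_msg_le {W D M : ℕ} (hM : 4 * M.size + 3 ≤ W) {s : Source}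
    (hs : s.Bounded W D M) : (enc s.msg : Data).size ≤
      (entryBound W D + W + 2) * s.recent.length + 2 * W + 3 := by
  have h1 := hs.port
  have h2 := size_name_le hM hs.length s.tree
  have h3 := size_enc_list_le (B := entryBound W D + W + 1)
    (s.recent.map fun T => (name s.cur T, entryOf (name s.cur) T)) (by
      intro a ha
      obtain ⟨T, hT, rfl⟩ := List.mem_map.1 ha
      have e1 := size_entryOf_le (ρ := name s.cur) (hs.small T (List.mem_of_mem_drop hT))
        fun c _ => size_name_le hM hs.length _
      have e2 := size_name_le hM hs.length T
      rw [enc_pair, Data.size, enc_data]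
      omega)
  rw [List.length_map] at h3
  have e : (enc s.msg : Data).size = s.port.size + ((name s.cur s.tree).size +
    (enc (s.recent.map fun T => (name s.cur T, entryOf (name s.cur) T)) : Data).size + 1) + 1 := rfl
  rw [e]
  have : entryBound W D + W + 1 + 1 = entryBound W D + W + 2 := rfl
  rw [this] at h3
  omega

theorem Source.Bounded.size_msg_le' {W D M : ℕ} (hM : 4 * M.size + 3 ≤ W) {s : Source}
    (hs : s.Bounded W D M) : (enc s.msg : Data).size ≤ msgBound W D * (s.recent.length + 1) := by
  refine (hs.size_msg_le hM).trans ?_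
  have : (entryBound W D + W + 2) * s.recent.length ≤ msgBound W D * s.recent.length :=
    Nat.mul_le_mul_right _ (by rw [msgBound]; omega)
  have h2 : 2 * W + 3 ≤ msgBound W D := by rw [msgBound]; omega
  rw [mul_add, mul_one]
  omega

/-- The table after the messages of all sources have been read. -/
noncomputable def insertSources (K : List Data) (S : List Source) : List Data :=
  S.foldl (fun K s => insertTrees K s.recent) K

theorem prefix_insertSources (S : List Source) : ∀ K, K <+: insertSources K S := by
  induction S with
  | nil => exact fun K => List.prefix_rfl
  | cons s S ih => exact fun K => (prefix_insertTrees s.recent K).trans (ih _)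

theorem mem_insertSources {S : List Source} {U : Data} : ∀ {K}, U ∈ insertSources K S ↔
    U ∈ K ∨ ∃ s ∈ S, U ∈ s.recent := by
  induction S with
  | nil => simp [insertSources]
  | cons s S ih =>
    intro K
    have : insertSources K (s :: S) = insertSources (insertTrees K s.recent) S := rfl
    rw [this, ih, mem_insertTrees]
    simp [or_assoc]

theorem length_insertSources_le (S : List Source) : ∀ K,
    (insertSources K S).length ≤ K.length + (S.map fun s => s.recent.length).sum := by
  induction S with
  | nil => exact fun K => le_rfl
  | cons s S ih =>
    intro K
    have h1 := ih (insertTrees K s.recent)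
    have h2 := length_insertTrees_le s.recent K
    have : insertSources K (s :: S) = insertSources (insertTrees K s.recent) S := rfl
    rw [this, List.map_cons, List.sum_cons]
    omega

/-- The receiver's table grows only at its end, so translations and names obtained from one message
survive the later ones; this is why all conclusions can refer to the final table. -/
theorem foldl_recvMsg_spec {W D M k : ℕ} (hM : 4 * M.size + 3 ≤ W) :
    ∀ (S : List Source) (ms outm : List Data) (edges : List (Data × Data)) (b : Book)
      (K : List Data), (∀ s ∈ S, s.Good) → List.Forall₂ (fun m s => MapGood m s.old K) ms S →
      BookGood b K k →
      let r := (S.map fun s => (⟨s.msg⟩ : Wire Msg)).foldl recvMsg ((ms, outm), edges, b)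
      BookGood r.2.2 (insertSources K S) k ∧ (∀ s ∈ S, s.tree ∈ insertSources K S) ∧
      r.2.1.reverse =
        edges.reverse ++ S.map (fun s => (s.port, name (insertSources K S) s.tree)) ∧
      (∃ ms', r.1.2.reverse = outm.reverse ++ ms' ∧
        List.Forall₂ (fun m s => MapGood m s.cur (insertSources K S)) ms' S) ∧
      ((∀ s ∈ S, s.Bounded W D M) → (insertSources K S).length ≤ M →
        foldCost recvMsgCost recvMsg ((ms, outm), edges, b)
            (S.map fun s => (⟨s.msg⟩ : Wire Msg)) ≤
          msgBound W D * (S.map fun s => s.recent.length + 1).sum)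
  | [], ms, outm, edges, b, K, hS, hms, hb => by
    refine ⟨hb, by simp, by simp, ⟨[], by simp, .nil⟩, by simp [foldCost]⟩
  | s :: S, [], outm, edges, b, K, hS, hms, hb => by cases hms
  | s :: S, m :: ms, outm, edges, b, K, hS, hms, hb => by
    obtain ⟨hm, hms⟩ := List.forall₂_cons.1 hms
    have hs := hS s (by simp)
    have hins : insertSources K (s :: S) = insertSources (insertTrees K s.recent) S := rfl
    have hpre1 := prefix_insertTrees s.recent K
    have hpre2 := prefix_insertSources S (insertTrees K s.recent)
    set r₁ := (s.recent.map fun T => (name s.cur T, entryOf (name s.cur) T)).foldl recvEntry (m, b)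
      with hr₁
    -- Only correctness is wanted here; with `M := 0` the size hypothesis concerns empty tables and
    -- is vacuous.
    obtain ⟨g1, g2, -⟩ := foldl_recvEntry_spec (D := 0) (M := 0) (k := k)
      (W := 4 * Nat.size 0 + 3) (le_refl _)
      hs.closed (fun h0 T hT => by
        rw [List.length_eq_zero_iff.1 (Nat.le_zero.1 h0)] at hT; simp at hT) s.recent s.old m b K
        hs.append_recent hb hm
    rw [← hr₁] at g1 g2
    have hstep : recvMsg ((m :: ms, outm), edges, b) ⟨s.msg⟩ =
      ((ms, r₁.1 :: outm), (s.port, r₁.1.get (name s.cur s.tree)) :: edges, r₁.2) := rfl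
    obtain ⟨f1, f2, f3, ⟨ms', f4, f5⟩, f6⟩ := foldl_recvMsg_spec (D := D) hM S ms (r₁.1 :: outm)
      ((s.port, r₁.1.get (name s.cur s.tree)) :: edges) r₁.2 (insertTrees K s.recent)
      (fun s hs => hS s (by simp [hs])) (hms.imp fun _ _ h => h.of_prefix hpre1) g1
    obtain ⟨e1, e2⟩ := g2 s.tree hs.mem
    simp only [List.map_cons, List.foldl_cons, foldCost, hstep, hins]
    refine ⟨f1, ?_, ?_, ⟨r₁.1 :: ms', ?_, ?_⟩, fun hB hK => ?_⟩
    · intro s' hs'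
      rcases List.mem_cons.1 hs' with rfl | hs'
      · exact hpre2.subset e1
      · exact f2 s' hs'
    · rw [f3, e2, name_eq_of_prefix hpre2 e1]
      simp
    · rw [f4]
      simp
    · exact List.Forall₂.cons (g2.of_prefix hpre2) f5
    · have hsB := hB s (by simp)
      have c1 := f6 (fun s hs => hB s (by simp [hs])) hK
      have c2 := (foldl_recvEntry_spec (D := D) (k := k) hM hs.closed (fun _ => hsB.small)
        s.recent s.old m b K hs.append_recent hb hm).2.2 hsB.length (hpre2.length_le.trans hK)
      have c3 := hsB.size_msg_le hM
      have c4 : recvMsgCost ((m :: ms, outm), edges, b) ⟨s.msg⟩ = (enc s.msg : Data).size +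
        foldCost recvEntryCost recvEntry (m, b)
          (s.recent.map fun T => (name s.cur T, entryOf (name s.cur) T)) := rfl
      rw [c4, List.sum_cons, mul_add (msgBound W D)]
      have c5 : msgBound W D * (s.recent.length + 1) =
        (entryBound W D + W + 2) * s.recent.length +
          (2 * entryBound W D + 3 * W + 2) * s.recent.length + s.recent.length + msgBound W D := by
        rw [msgBound]; ring
      have c6 : 2 * W + 4 ≤ msgBound W D := by rw [msgBound]; omega
      omega

/-- The tree of a party, made of those of its neighbours. -/
def joinTree (lab : Data) (S : List Source) : Data :=
  Data.cons lab (Data.ofList (S.map fun s => Data.cons s.port s.tree))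

theorem children_joinTree (lab : Data) (S : List Source) :
    children (joinTree lab S) = S.map fun s => Data.cons s.port s.tree := by
  simp [children, joinTree, Data.tl, Data.toList_ofList]

theorem isNode_joinTree (lab : Data) (S : List Source) : IsNode (joinTree lab S) := by
  rw [IsNode, children_joinTree, List.map_map]
  rfl

theorem entryOf_joinTree (ρ : Data → Data) (lab : Data) (S : List Source) :
    entryOf ρ (joinTree lab S) = (lab, S.map fun s => (s.port, ρ s.tree)) := by
  rw [entryOf, children_joinTree, List.map_map]
  rfl

/-- The state `st` of a party, with its table, the part of it that has been sent, its tree, and the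
parts of the tables of its neighbours that it has received. -/
structure StateGood (st : State) (K : List Data) (k : ℕ) (T : Data) (Ls : List (List Data)) : Prop where
  book : BookGood st.2.2.2 K k
  mem : T ∈ K
  name : st.2.2.1.2 = name K T
  maps : List.Forall₂ (fun m L => MapGood m L K) st.2.2.1.1 Ls

noncomputable def nextTable (K : List Data) (lab : Data) (S : List Source) : List Data :=
  insertTree (insertSources K S) (joinTree lab S)

/-- After the round everything the neighbours sent has been translated, so their `cur` takes the
place of `old`. The party's own unsent part begins where its previous table ended. -/
theorem StateGood.advance {st : State} {K : List Data} {k : ℕ} {T : Data} {Ls : List (List Data)}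
    (h : StateGood st K k T Ls) {S : List Source} (hS : ∀ s ∈ S, s.Good)
    (hLs : Ls = S.map fun s => s.old) :
    StateGood (advance st (receive st (S.map fun s => ⟨s.msg⟩))) (nextTable K st.2.1.1 S) K.length
        (joinTree st.2.1.1 S) (S.map fun s => s.cur) := by
  subst hLs
  have hms : List.Forall₂ (fun m s => MapGood m s.old K) st.2.2.1.1 S := by
    have := h.maps
    rwa [List.forall₂_map_right_iff] at this
  -- Emptying the list of recent entries means that all of `K` counts as sent.
  have hb : BookGood (st.2.2.2.1, st.2.2.2.2.1, st.2.2.2.2.2.1, []) K K.length :=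
    ⟨h.book.closed, h.book.interned, h.book.ents, h.book.cnt, le_rfl, by simp⟩
  obtain ⟨f1, f2, f3, ⟨ms', f4, f5⟩, -⟩ := foldl_recvMsg_spec (D := 0) (M := 0) (le_refl _) S
    st.2.2.1.1 [] [] _ K hS hms hb
  change BookGood (receive st (S.map fun s => ⟨s.msg⟩)).2.2 _ _ at f1
  change (receive st (S.map fun s => ⟨s.msg⟩)).2.1.reverse = _ at f3
  change (receive st (S.map fun s => ⟨s.msg⟩)).1.2.reverse = _ at f4
  set r := receive st (S.map fun s => ⟨s.msg⟩)
  have hent : ((st.2.1.1, r.2.1.reverse) : Entry) =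
      entryOf (FoldView.name (insertSources K S)) (joinTree st.2.1.1 S) := by
    rw [entryOf_joinTree, f3]
    rfl
  have hch : ∀ c ∈ children (joinTree st.2.1.1 S), c.tl ∈ insertSources K S := by
    intro c hc
    rw [children_joinTree] at hc
    obtain ⟨s, hs, rfl⟩ := List.mem_map.1 hc
    exact f2 s hs
  obtain ⟨g1, g2⟩ := f1.intern (isNode_joinTree st.2.1.1 S) hch
  rw [← hent] at g1 g2
  refine ⟨g1, mem_insertTree.2 (Or.inr rfl), g2, ?_⟩
  rw [List.forall₂_map_right_iff]
  have : (FoldView.advance st r).2.2.1.1 = ms' := f4.trans (List.nil_append _)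
  rw [this]
  exact f5.imp fun _ _ h => h.of_prefix (prefix_insertTree _ _)

theorem StateGood.send {st : State} {K : List Data} {k : ℕ} {T : Data} {Ls : List (List Data)}
    (h : StateGood st K k T Ls) (L : List Data) (hL : L.length = k) :
    (send st).2 = st.2.1.2.map fun p => ⟨(Source.mk p L K T).msg⟩ := by
  rw [FoldView.send]
  refine List.map_congr_left fun p _ => ?_
  rw [h.book.pend, h.name, Source.msg, Source.recent, hL]

theorem StateGood.sendCost_le {st : State} {K : List Data} {k : ℕ} {T : Data} {Ls : List (List Data)}
    (h : StateGood st K k T Ls) {W D M : ℕ} (hM : 4 * M.size + 3 ≤ W) (hK : K.length ≤ M)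
    (hsmall : ∀ U ∈ K, Small W D U) (hp : ∀ p ∈ st.2.1.2, p.size ≤ W) :
    sendCost st ≤ (msgBound W D + 1) * (st.2.1.2.length + 1) * (K.length - k + 1) := by
  have h1 : st.2.2.2.2.2.2.length = K.length - k := by
    rw [← List.length_reverse, h.book.pend, List.length_map, List.length_drop]
  have hk := h.book.le
  have h2 : ∀ p ∈ st.2.1.2, (enc (p, st.2.2.1.2, st.2.2.2.2.2.2.reverse) : Data).size ≤
      msgBound W D * (K.length - k + 1) := by
    intro p hpm
    rw [h.book.pend, h.name]
    have := Source.Bounded.size_msg_le' hM (s := ⟨p, K.take k, K, T⟩) ⟨hp p hpm, hK, hsmall⟩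
    have hl : (K.take k).length = k := by simp [hk]
    simpa only [Source.msg, Source.recent, hl, List.length_drop] using this
  have h3 : (st.2.1.2.map fun p =>
      (enc (p, st.2.2.1.2, st.2.2.2.2.2.2.reverse) : Data).size + 1).sum ≤
      st.2.1.2.length * (msgBound W D * (K.length - k + 1) + 1) := by
    have := List.sum_le_card_nsmul (st.2.1.2.map fun p =>
      (enc (p, st.2.2.1.2, st.2.2.2.2.2.2.reverse) : Data).size + 1)
      (msgBound W D * (K.length - k + 1) + 1) (by
        intro x hx
        obtain ⟨p, hp, rfl⟩ := List.mem_map.1 hx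
        have := h2 p hp
        omega)
    simpa using this
  rw [sendCost, h1]
  generalize K.length - k = y at *
  generalize st.2.1.2.length = z at *
  generalize msgBound W D = B at *
  refine (Nat.add_le_add_left h3 y).trans ?_
  nlinarith [Nat.zero_le (B * y), Nat.zero_le (z * y)]

/-- The work is proportional to the entries received plus, once for each port, the entries to be
sent; `msgBound` is the price of one of them. -/
theorem StateGood.roundCost_le {st : State} {K : List Data} {k : ℕ} {T : Data}
    {Ls : List (List Data)} (h : StateGood st K k T Ls) {S : List Source} (hS : ∀ s ∈ S, s.Good)
    (hLs : Ls = S.map fun s => s.old) {W D M : ℕ} (hM : 4 * M.size + 3 ≤ W)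
    (hB : ∀ s ∈ S, s.Bounded W D M) (hK : (nextTable K st.2.1.1 S).length ≤ M)
    (hsmall : ∀ U ∈ nextTable K st.2.1.1 S, Small W D U) (hp : ∀ p ∈ st.2.1.2, p.size ≤ W) :
    roundCost (st, S.map fun s => ⟨s.msg⟩) ≤
      (msgBound W D + 1) * ((S.map fun s => s.recent.length + 1).sum + S.length + 1 +
        (st.2.1.2.length + 1) * ((nextTable K st.2.1.1 S).length - K.length + 1)) := by
  have hadv := h.advance hS hLs
  have hsend := hadv.sendCost_le hM hK hsmall hp
  subst hLs
  have hms : List.Forall₂ (fun m s => MapGood m s.old K) st.2.2.1.1 S := by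
    have := h.maps
    rwa [List.forall₂_map_right_iff] at this
  have hb : BookGood (st.2.2.2.1, st.2.2.2.2.1, st.2.2.2.2.2.1, []) K K.length :=
    ⟨h.book.closed, h.book.interned, h.book.ents, h.book.cnt, le_rfl, by simp⟩
  obtain ⟨f1, f2, f3, ⟨ms', f4, f5⟩, f6⟩ := foldl_recvMsg_spec (D := D) hM S
    st.2.2.1.1 [] [] _ K hS hms hb
  change BookGood (receive st (S.map fun s => ⟨s.msg⟩)).2.2 _ _ at f1
  change (receive st (S.map fun s => ⟨s.msg⟩)).2.1.reverse = _ at f3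
  change (receive st (S.map fun s => ⟨s.msg⟩)).1.2.reverse = _ at f4
  have hK' := (prefix_insertTree (insertSources K S) (joinTree st.2.1.1 S)).length_le.trans hK
  have c1 := f6 hB hK'
  have hent : ((st.2.1.1, (receive st (S.map fun s => ⟨s.msg⟩)).2.1.reverse) : Entry) =
      entryOf (FoldView.name (insertSources K S)) (joinTree st.2.1.1 S) := by
    rw [entryOf_joinTree, f3]
    rfl
  have c2 := internCost_le f1 hM hK' (hsmall _ (mem_insertTree.2 (Or.inr rfl)))
  rw [← hent] at c2
  have c3 : (receive st (S.map fun s => ⟨s.msg⟩)).2.1.length = S.length := by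
    rw [← List.length_reverse, f3]; simp
  have c4 : (receive st (S.map fun s => ⟨s.msg⟩)).1.2.length = S.length := by
    rw [← List.length_reverse, f4, List.reverse_nil, List.nil_append, f5.length_eq]
  rw [roundCost]
  simp only [c3, c4]
  have c5 : entryBound W D + 2 * W ≤ msgBound W D := by rw [msgBound]; omega
  have c6 : 1 ≤ msgBound W D := by rw [msgBound]; omega
  have c7 : (FoldView.advance st (receive st (S.map fun s => ⟨s.msg⟩))).2.1 = st.2.1 := rfl
  rw [c7] at hsend
  generalize (S.map fun s => s.recent.length + 1).sum = x at *
  generalize (nextTable K st.2.1.1 S).length - K.length + 1 = y at *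
  have c8 := Nat.mul_le_mul_right S.length c6
  have e : (msgBound W D + 1) * (x + S.length + 1 + (st.2.1.2.length + 1) * y) =
    msgBound W D * x + x + msgBound W D * S.length + S.length + msgBound W D + 1 +
      (msgBound W D + 1) * (st.2.1.2.length + 1) * y := by ring
  rw [e]
  refine (Nat.add_le_add (Nat.add_le_add (Nat.add_le_add (Nat.add_le_add c1 le_rfl) le_rfl) c2)
    hsend).trans ?_
  omega

end FoldView

/-! ### Construction of folded views: correctness of the protocol -/

namespace FoldView

open Impl

variable {n : ℕ} (N : Network n) (X : Fin n → ℤ)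

/-- The tables of the parties after some rounds: the part that has been sent, and all of it. -/
noncomputable def tables : ℕ → Fin n → List Data × List Data
  | 0, v => ([], [N.viewTree X 0 v])
  | k + 1, v => ((tables k v).2, nextTable (tables k v).2 (Data.ofInt (X v))
      (List.ofFn fun i : Fin (N.deg v) => ⟨enc (N.backPort v i : ℕ), (tables k (N.nbr v i)).1,
        (tables k (N.nbr v i)).2, N.viewTree X k (N.nbr v i)⟩))

/-- What party `v` sends through port `i`. -/
noncomputable def source (k : ℕ) (v : Fin n) (i : Fin (N.deg v)) : Source :=
  ⟨enc (i : ℕ), (tables N X k v).1, (tables N X k v).2, N.viewTree X k v⟩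

noncomputable def sources (k : ℕ) (v : Fin n) : List Source :=
  List.ofFn fun i : Fin (N.deg v) => source N X k (N.nbr v i) (N.backPort v i)

theorem tables_succ (k : ℕ) (v : Fin n) : tables N X (k + 1) v =
    ((tables N X k v).2, nextTable (tables N X k v).2 (Data.ofInt (X v)) (sources N X k v)) := rfl

noncomputable def message (k : ℕ) (v : Fin n) (i : Fin (N.deg v)) : Msg := (source N X k v i).msg

theorem inbox_message (k : ℕ) (v : Fin n) :
    N.inbox (message N X k) v = (sources N X k v).map fun s => ⟨s.msg⟩ := by
  rw [Network.inbox, sources, List.map_ofFn]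
  rfl

theorem joinTree_sources (k : ℕ) (v : Fin n) :
    joinTree (Data.ofInt (X v)) (sources N X k v) = N.viewTree X (k + 1) v := by
  rw [joinTree, sources, List.map_ofFn]
  change _ = Data.cons _ (Data.ofList ((N.out v).map _))
  rw [Network.out, List.map_ofFn]
  rfl

noncomputable def state (h : ℕ) : ℕ → Fin n → State
  | 0, v => start (h, N.deg v, Data.ofInt (X v), ())
  | k + 1, v => advance (state h k v) (receive (state h k v) (N.inbox (message N X k) v))

theorem isNode_viewTree (k : ℕ) (v : Fin n) : IsNode (N.viewTree X k v) := by
  cases k with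
  | zero => rfl
  | succ k => rw [← joinTree_sources]; exact isNode_joinTree _ _

theorem children_viewTree_zero (v : Fin n) : children (N.viewTree X 0 v) = [] := rfl

theorem entryOf_viewTree_zero (ρ : Data → Data) (v : Fin n) :
    entryOf ρ (N.viewTree X 0 v) = (Data.ofInt (X v), []) := rfl

theorem children_viewTree_succ (k : ℕ) (v : Fin n) : children (N.viewTree X (k + 1) v) =
    List.ofFn fun i : Fin (N.deg v) =>
      Data.cons (enc (N.backPort v i : ℕ)) (N.viewTree X k (N.nbr v i)) := by
  rw [← joinTree_sources, children_joinTree, sources, List.map_ofFn]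
  rfl

theorem entryOf_viewTree_succ (ρ : Data → Data) (k : ℕ) (v : Fin n) :
    entryOf ρ (N.viewTree X (k + 1) v) = (Data.ofInt (X v), List.ofFn fun i : Fin (N.deg v) =>
      ((enc (N.backPort v i : ℕ) : Data), ρ (N.viewTree X k (N.nbr v i)))) := by
  rw [← joinTree_sources, entryOf_joinTree, sources, List.map_ofFn]
  rfl

/-- The invariant of the protocol. -/
structure RoundGood (h k : ℕ) (v : Fin n) : Prop where
  state : StateGood (state N X h k v) (tables N X k v).2 (tables N X k v).1.length
    (N.viewTree X k v) (List.ofFn fun i : Fin (N.deg v) => (tables N X k (N.nbr v i)).1)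
  clock : (FoldView.state N X h k v).1 = (List.replicate (h - k) (), List.replicate h ())
  ports : (FoldView.state N X h k v).2.1 =
    (Data.ofInt (X v), List.ofFn fun i : Fin (N.deg v) => enc (i : ℕ))
  old_prefix : (tables N X k v).1 <+: (tables N X k v).2

theorem bookGood_empty : BookGood (Data.nil, Data.nil, 0, []) [] 0 :=
  ⟨⟨List.nodup_nil, by simp, fun K' T h => by simp at h⟩, .empty, by simp, rfl, le_rfl, by simp⟩

theorem map_range_eq_ofFn {α : Type*} (d : ℕ) (f : ℕ → α) :
    (List.range d).map f = List.ofFn fun i : Fin d => f i := by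
  apply List.ext_getElem <;> simp

theorem roundGood_zero (h : ℕ) (v : Fin n) : RoundGood N X h 0 v := by
  obtain ⟨h1, h2⟩ := bookGood_empty.intern (isNode_viewTree N X 0 v) (by
    rw [children_viewTree_zero]; simp)
  have h3 : insertTree [] (N.viewTree X 0 v) = [N.viewTree X 0 v] := by simp [insertTree]
  rw [h3, entryOf_viewTree_zero] at h1 h2
  refine ⟨⟨h1, by simp [tables], h2, ?_⟩, rfl, ?_, by simp [tables]⟩
  · change List.Forall₂ _ (List.replicate (N.deg v) Data.nil) _
    rw [List.forall₂_iff_get]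
    refine ⟨by simp, fun i h1 h2 T hT => ?_⟩
    simp [tables] at hT
  · change (_, (List.range (N.deg v)).map enc) = _
    rw [map_range_eq_ofFn]

variable {N X}

theorem RoundGood.source_good {h k : ℕ} {v : Fin n} (hv : RoundGood N X h k v)
    (i : Fin (N.deg v)) : (source N X k v i).Good :=
  ⟨hv.state.book.closed, hv.old_prefix, hv.state.mem⟩

theorem RoundGood.succ {h k : ℕ} (hk : ∀ v, RoundGood N X h k v) (v : Fin n) :
    RoundGood N X h (k + 1) v := by
  have hS : ∀ s ∈ sources N X k v, s.Good := by
    intro s hs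
    obtain ⟨i, rfl⟩ := (List.mem_ofFn' _ _).1 hs
    exact (hk _).source_good _
  have hLs : (List.ofFn fun i : Fin (N.deg v) => (tables N X k (N.nbr v i)).1) =
      (sources N X k v).map fun s => s.old := by
    rw [sources, List.map_ofFn]; rfl
  have h1 := (hk v).state.advance hS hLs
  rw [← inbox_message, (hk v).ports, joinTree_sources] at h1
  have hLs' : (List.ofFn fun i : Fin (N.deg v) => (tables N X (k + 1) (N.nbr v i)).1) =
      (sources N X k v).map fun s => s.cur := by
    rw [sources, List.map_ofFn]; rfl
  refine ⟨?_, ?_, (hk v).ports, ?_⟩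
  · rw [hLs']
    exact h1
  · change ((FoldView.state N X h k v).1.1.tail, (FoldView.state N X h k v).1.2) = _
    rw [(hk v).clock]
    simp [List.tail_replicate, Nat.sub_sub]
  · rw [tables_succ]
    exact (prefix_insertSources _ _).trans (prefix_insertTree _ _)

variable (N X) in
theorem roundGood (h k : ℕ) : ∀ v, RoundGood N X h k v := by
  induction k with
  | zero => exact roundGood_zero N X h
  | succ k ih => exact RoundGood.succ ih

theorem send_state (h k : ℕ) (v : Fin n) : send (state N X h k v) =
    (state N X h k v, N.outbox (message N X k) v) := by
  have hk := roundGood N X h k v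
  refine Prod.ext rfl ?_
  rw [hk.state.send (tables N X k v).1 rfl, hk.ports, List.map_ofFn]
  rfl

theorem init_eq (h : ℕ) (v : Fin n) : init (h, N.deg v, Data.ofInt (X v), ()) =
    (state N X h 0 v, N.outbox (message N X 0) v) := send_state h 0 v

theorem round_eq (h k : ℕ) (v : Fin n) : round (state N X h k v, N.inbox (message N X k) v) =
    (state N X h (k + 1) v, N.outbox (message N X (k + 1)) v) := send_state h (k + 1) v

/-- All trees in the tables stand for views. -/
theorem mem_tables {k : ℕ} : ∀ {v : Fin n} {T : Data}, T ∈ (tables N X k v).2 →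
    ∃ d ≤ k, ∃ w, T = N.viewTree X d w := by
  induction k with
  | zero =>
    intro v T hT
    exact ⟨0, le_rfl, v, by simpa [tables] using hT⟩
  | succ k ih =>
    intro v T hT
    rw [tables_succ, nextTable, mem_insertTree, mem_insertSources, joinTree_sources] at hT
    rcases hT with (hT | ⟨s, hs, hT⟩) | rfl
    · obtain ⟨d, hd, w, rfl⟩ := ih hT
      exact ⟨d, by omega, w, rfl⟩
    · obtain ⟨i, rfl⟩ := (List.mem_ofFn' _ _).1 hs
      obtain ⟨d, hd, w, rfl⟩ := ih (List.mem_of_mem_drop hT)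
      exact ⟨d, by omega, w, rfl⟩
    · exact ⟨k + 1, le_rfl, v, rfl⟩

/-- A table consists of distinct trees of views, and each depth up to `k` contributes at most `n` of
them. This bounds the volume of the messages. -/
theorem length_tables_le (k : ℕ) (v : Fin n) : (tables N X k v).2.length ≤ (k + 1) * n := by
  classical
  have hnd := (roundGood N X 0 k v).state.book.closed.nodup
  rw [← List.toFinset_card_of_nodup hnd]
  have hsub : (tables N X k v).2.toFinset ⊆
      (Finset.range (k + 1) ×ˢ Finset.univ).image fun x : ℕ × Fin n => N.viewTree X x.1 x.2 := by
    intro T hT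
    obtain ⟨d, hd, w, rfl⟩ := mem_tables (List.mem_toFinset.1 hT)
    exact Finset.mem_image.2 ⟨(d, w), by simp; omega, rfl⟩
  refine (Finset.card_le_card hsub).trans (Finset.card_image_le.trans ?_)
  simp

/-- A round adds at most the tables of `D` neighbours and one tree. The bound does not mention `n`,
and this is what keeps `log n` out of the length of names and so out of the communication. -/
theorem length_tables_le_pow (k : ℕ) : ∀ v : Fin n,
    (tables N X k v).2.length ≤ (N.maxDeg + 2) ^ k := by
  induction k with
  | zero => intro v; simp [tables]
  | succ k ih =>
    intro v
    rw [tables_succ, nextTable]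
    have h1 := length_insertTree_le (insertSources (tables N X k v).2 (sources N X k v))
      (joinTree (Data.ofInt (X v)) (sources N X k v))
    have h2 := length_insertSources_le (sources N X k v) (tables N X k v).2
    have h3 : ((sources N X k v).map fun s => s.recent.length).sum ≤
        N.maxDeg * (N.maxDeg + 2) ^ k := by
      refine (List.sum_le_card_nsmul _ ((N.maxDeg + 2) ^ k) fun x hx => ?_).trans ?_
      · obtain ⟨s, hs, rfl⟩ := List.mem_map.1 hx
        obtain ⟨i, rfl⟩ := (List.mem_ofFn' _ _).1 hs
        refine le_trans ?_ (ih (N.nbr v i))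
        rw [Source.recent, List.length_drop]
        exact Nat.sub_le _ _
      · rw [List.length_map, sources, List.length_ofFn, smul_eq_mul]
        exact Nat.mul_le_mul_right _ (N.deg_le_maxDeg v)
    have h4 := ih v
    have h5 : 1 ≤ (N.maxDeg + 2) ^ k := Nat.one_le_pow _ _ (by omega)
    have h6 : (N.maxDeg + 2) ^ (k + 1) = N.maxDeg * (N.maxDeg + 2) ^ k + 2 * (N.maxDeg + 2) ^ k := by
      ring
    simp only
    omega

/-- The names that a party has for the nodes of its view. -/
noncomputable def nodeName (N : Network n) (X : Fin n → ℤ) (h : ℕ) (v : Fin n)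
    (p : Σ w, N.graph.Walk v w) : Data :=
  name (tables N X h v).2 (N.viewTree X (h - p.2.length) p.1)

/-- The party's own tree is in the table, and closure under subtrees carries membership along every
walk. -/
theorem viewTree_mem_tables (h : ℕ) (v : Fin n) : ∀ p : Σ w, N.graph.Walk v w, p.2.length ≤ h →
    N.viewTree X (h - p.2.length) p.1 ∈ (tables N X h v).2 := by
  have hs := (roundGood N X h h v).state
  refine N.walk_induction (fun _ => hs.mem) fun p i ih hp => ?_
  rw [N.length_ext] at hp ⊢
  have h1 := ih (by omega)
  rw [show h - p.2.length = (h - (p.2.length + 1)) + 1 by omega] at h1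
  refine hs.book.closed.child_mem h1 (c := Data.cons (enc (N.backPort p.1 i : ℕ)) _) ?_
  rw [children_viewTree_succ]
  exact (List.mem_ofFn' _ _).2 ⟨i, rfl⟩

theorem naming_state (h : ℕ) (v : Fin n) :
    Naming N X h (state N X h h v).2.2.2.2.1 (nodeName N X h v) := by
  have hs := (roundGood N X h h v).state
  refine ⟨fun p hp => ?_, fun p q hp hpq => ?_⟩
  · rw [nodeName, hs.book.ents _ (viewTree_mem_tables h v p hp)]
    split_ifs with hlt
    · rw [show h - p.2.length = (h - (p.2.length + 1)) + 1 by omega, entryOf_viewTree_succ]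
      simp only [nodeName, N.length_ext]
      rfl
    · rw [show h - p.2.length = 0 by omega, entryOf_viewTree_zero]
  · rw [nodeName, nodeName, name_inj (viewTree_mem_tables h v p hp), ← hpq]

theorem finish_of_lt {h k : ℕ} (hk : k < h) (v : Fin n) :
    finish (state N X h k v) = (false, Data.nil) := by
  rw [finish, (roundGood N X h k v).clock, if_neg]
  simp
  omega

theorem finish_eq (h : ℕ) (v : Fin n) : finish (state N X h h v) = (true,
    listing ((state N X h h v).2.2.2.2.1, nodeName N X h v ⟨v, .nil⟩, List.replicate (h + 1) ())) := by
  have hs := roundGood N X h h v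
  rw [finish, hs.clock, if_pos (by simp), hs.state.name]
  rfl

theorem exists_isLayout_finish (hn : 2 ≤ n) (h : ℕ) (v : Fin n) :
    ∃ c pos, N.IsLayout X h v c pos ∧ finish (state N X h h v) = (true, c.encode) := by
  obtain ⟨c, pos, h1, h2⟩ := (naming_state (N := N) (X := X) h v).exists_isLayout hn
  exact ⟨c, pos, h1, by rw [finish_eq, h2]⟩

end FoldView

/-! ### Construction of folded views: cost of the protocol -/

namespace Network

variable {n : ℕ} (N : Network n)

theorem sum_deg : ∑ v, N.deg v = 2 * N.numEdges := by
  classical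
  have h1 : ∀ v, N.deg v = N.graph.degree v := fun v => by
    rw [← SimpleGraph.card_neighborSet_eq_degree, Fintype.card_congr (N.port v), Fintype.card_fin]
  rw [Finset.sum_congr rfl fun v _ => h1 v, SimpleGraph.sum_degrees_eq_twice_card_edges, numEdges,
    ← SimpleGraph.coe_edgeFinset, Set.ncard_coe_finset]

end Network

namespace FoldView

open Impl

variable {n : ℕ} {N : Network n} {X : Fin n → ℤ}

theorem small_viewTree {b W : ℕ} (hX : ∀ v, |X v| < 2 ^ b) (hb : 4 * b + 5 ≤ W)
    (hD : 4 * N.maxDeg.size + 1 ≤ W) (d : ℕ) (w : Fin n) : Small W N.maxDeg (N.viewTree X d w) := by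
  have h1 := (size_enc_int_le (hX w)).trans hb
  cases d with
  | zero => exact ⟨h1, by simp [children_viewTree_zero], by simp [children_viewTree_zero]⟩
  | succ d =>
    refine ⟨h1, ?_, ?_⟩
    · rw [children_viewTree_succ, List.length_ofFn]
      exact N.deg_le_maxDeg w
    · intro c hc
      rw [children_viewTree_succ] at hc
      obtain ⟨i, rfl⟩ := (List.mem_ofFn' _ _).1 hc
      exact (size_enc_nat_le ((N.backPort w i).2.le.trans (N.deg_le_maxDeg _))).trans hD

/-- `W` bounds the sizes of all labels, port numbers and names within `h` rounds. -/
structure Fits (N : Network n) (X : Fin n → ℤ) (h W M : ℕ) : Prop where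
  name : 4 * M.size + 3 ≤ W
  table : (N.maxDeg + 2) ^ h ≤ M
  port : 4 * N.maxDeg.size + 1 ≤ W
  small : ∀ d w, Small W N.maxDeg (N.viewTree X d w)

variable {h W M : ℕ}

theorem Fits.length_le (hW : Fits N X h W M) {k : ℕ} (hk : k ≤ h) (v : Fin n) :
    (tables N X k v).2.length ≤ M :=
  (length_tables_le_pow k v).trans ((Nat.pow_le_pow_right (by omega) hk).trans hW.table)

theorem Fits.small_tables (hW : Fits N X h W M) {k : ℕ} {v : Fin n} :
    ∀ T ∈ (tables N X k v).2, Small W N.maxDeg T := by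
  intro T hT
  obtain ⟨d, -, w, rfl⟩ := mem_tables hT
  exact hW.small d w

theorem Fits.port_size (hW : Fits N X h W M) (v : Fin n) (i : Fin (N.deg v)) :
    (enc (i : ℕ) : Data).size ≤ W :=
  (size_enc_nat_le (i.2.le.trans (N.deg_le_maxDeg _))).trans hW.port

theorem Fits.bounded (hW : Fits N X h W M) {k : ℕ} (hk : k ≤ h) (v : Fin n) (i : Fin (N.deg v)) :
    (source N X k v i).Bounded W N.maxDeg M :=
  ⟨hW.port_size v i, hW.length_le hk v, hW.small_tables⟩

variable (N X) in
/-- The number of trees that are new in a round. -/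
noncomputable def fresh (k : ℕ) (v : Fin n) : ℕ :=
  (tables N X k v).2.length - (tables N X k v).1.length

/-- A telescoping sum: the part already sent in a round is the whole table of the round before, so
each tree is new exactly once. -/
theorem sum_fresh (v : Fin n) (k : ℕ) :
    ∑ j ∈ Finset.range (k + 1), fresh N X j v = (tables N X k v).2.length := by
  induction k with
  | zero => simp [fresh, tables]
  | succ k ih =>
    rw [Finset.sum_range_succ, ih, fresh]
    have h1 := (roundGood N X 0 (k + 1) v).old_prefix.length_le
    have h2 : (tables N X (k + 1) v).1 = (tables N X k v).2 := rfl
    rw [h2] at h1 ⊢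
    omega

theorem sum_fresh_le (v : Fin n) (k : ℕ) :
    ∑ j ∈ Finset.range (k + 1), (fresh N X j v + 1) ≤ (k + 1) * (n + 1) := by
  rw [Finset.sum_add_distrib, sum_fresh]
  have := length_tables_le (N := N) (X := X) k v
  simp only [Finset.sum_const, Finset.card_range, smul_eq_mul, mul_one]
  rw [mul_add, mul_one]
  omega

theorem Fits.size_message_le (hW : Fits N X h W M) {k : ℕ} (hk : k ≤ h) (v : Fin n)
    (i : Fin (N.deg v)) :
    (enc (message N X k v i) : Data).size ≤ msgBound W N.maxDeg * (fresh N X k v + 1) := by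
  have := (hW.bounded hk v i).size_msg_le' hW.name
  rwa [Source.recent, List.length_drop] at this

/-- Through a given port each tree is sent once, and each round adds one header. The ports of all
parties number `2 |E|`. -/
theorem Fits.sum_message_le (hW : Fits N X h W M) :
    ∑ k ∈ Finset.range (h + 1), ∑ v, ∑ i, (enc (message N X k v i) : Data).size ≤
      msgBound W N.maxDeg * ((h + 1) * (n + 1)) * (2 * N.numEdges) := by
  rw [Finset.sum_comm, ← N.sum_deg, Finset.mul_sum]
  refine Finset.sum_le_sum fun v _ => ?_
  rw [Finset.sum_comm]
  refine (Finset.sum_le_card_nsmul _ _ (msgBound W N.maxDeg * ((h + 1) * (n + 1))) fun i _ => ?_).trans ?_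
  · calc _ ≤ ∑ k ∈ Finset.range (h + 1), msgBound W N.maxDeg * (fresh N X k v + 1) :=
        Finset.sum_le_sum fun k hk => hW.size_message_le (by simp at hk; omega) v i
      _ ≤ _ := by
        rw [← Finset.mul_sum]
        exact Nat.mul_le_mul_left _ (sum_fresh_le v h)
  · simp [mul_comm]

theorem Fits.roundCost_le (hW : Fits N X h W M) {k : ℕ} (hk : k < h) (v : Fin n) :
    roundCost (state N X h k v, N.inbox (message N X k) v) ≤
      (msgBound W N.maxDeg + 1) * (∑ i, (fresh N X k (N.nbr v i) + 1) + (N.maxDeg + 1) +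
        (N.maxDeg + 1) * (fresh N X (k + 1) v + 1)) := by
  have hg := roundGood N X h k v
  have hS : ∀ s ∈ sources N X k v, s.Good := by
    intro s hs
    obtain ⟨i, rfl⟩ := (List.mem_ofFn' _ _).1 hs
    exact (roundGood N X h k _).source_good _
  have hB : ∀ s ∈ sources N X k v, s.Bounded W N.maxDeg M := by
    intro s hs
    obtain ⟨i, rfl⟩ := (List.mem_ofFn' _ _).1 hs
    exact hW.bounded hk.le _ _
  have hLs : (List.ofFn fun i : Fin (N.deg v) => (tables N X k (N.nbr v i)).1) =
      (sources N X k v).map fun s => s.old := by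
    rw [sources, List.map_ofFn]; rfl
  have hnext : nextTable (tables N X k v).2 (state N X h k v).2.1.1 (sources N X k v) =
      (tables N X (k + 1) v).2 := by rw [hg.ports]; rfl
  have h1 := hg.state.roundCost_le hS hLs hW.name hB (by rw [hnext]; exact hW.length_le hk v)
    (by rw [hnext]; exact hW.small_tables) (by
      rw [hg.ports]
      intro p hp
      obtain ⟨i, rfl⟩ := (List.mem_ofFn' _ _).1 hp
      exact hW.port_size v i)
  rw [← inbox_message, hnext, hg.ports, List.length_ofFn] at h1
  refine h1.trans (Nat.mul_le_mul_left _ ?_)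
  have e1 : ((sources N X k v).map fun s => s.recent.length + 1).sum =
      ∑ i, (fresh N X k (N.nbr v i) + 1) := by
    rw [sources, List.map_ofFn, List.sum_ofFn]
    refine Finset.sum_congr rfl fun i _ => ?_
    simp only [Function.comp, Source.recent, List.length_drop]
    rfl
  have e2 : (sources N X k v).length = N.deg v := by rw [sources, List.length_ofFn]
  have e3 : (tables N X (k + 1) v).2.length - (tables N X k v).2.length = fresh N X (k + 1) v := rfl
  rw [e1, e2, e3, add_assoc _ (N.deg v)]
  have := N.deg_le_maxDeg v
  gcongr

/-- Three contributions of the same order: the new trees of at most `D` neighbours, a fixed overhead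
per port and round, and the party's own new trees, which are sent through every port. -/
theorem Fits.sum_roundCost_le (hW : Fits N X h W M) (v : Fin n) :
    ∑ k ∈ Finset.range h, roundCost (state N X h k v, N.inbox (message N X k) v) ≤
      (msgBound W N.maxDeg + 1) * ((N.maxDeg + 1) * (3 * ((h + 1) * (n + 1)))) := by
  refine (Finset.sum_le_sum fun k hk => hW.roundCost_le (Finset.mem_range.1 hk) v).trans ?_
  rw [← Finset.mul_sum]
  refine Nat.mul_le_mul_left _ ?_
  rw [Finset.sum_add_distrib, Finset.sum_add_distrib, Finset.sum_comm, ← Finset.mul_sum]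
  have h1 : ∑ i, ∑ k ∈ Finset.range h, (fresh N X k (N.nbr v i) + 1) ≤
      N.maxDeg * ((h + 1) * (n + 1)) := by
    refine (Finset.sum_le_card_nsmul _ _ ((h + 1) * (n + 1)) fun i _ => ?_).trans ?_
    · refine le_trans ?_ (sum_fresh_le (N := N) (X := X) (N.nbr v i) h)
      exact Finset.sum_le_sum_of_subset (Finset.range_mono (Nat.le_succ h))
    · simp only [Finset.card_univ, Fintype.card_fin, smul_eq_mul]
      exact Nat.mul_le_mul_right _ (N.deg_le_maxDeg v)
  have h2 : ∑ k ∈ Finset.range h, (fresh N X (k + 1) v + 1) ≤ (h + 1) * (n + 1) := by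
    refine le_trans ?_ (sum_fresh_le (N := N) (X := X) v h)
    rw [Finset.sum_range_succ']
    omega
  have h3 : ∑ _k ∈ Finset.range h, (N.maxDeg + 1) ≤ (N.maxDeg + 1) * ((h + 1) * (n + 1)) := by
    simp only [Finset.sum_const, Finset.card_range, smul_eq_mul]
    rw [mul_comm]
    refine Nat.mul_le_mul_left _ ?_
    nlinarith
  have h4 := Nat.mul_le_mul_left (N.maxDeg + 1) h2
  have e : (N.maxDeg + 1) * (3 * ((h + 1) * (n + 1))) = N.maxDeg * ((h + 1) * (n + 1)) +
    (h + 1) * (n + 1) + (N.maxDeg + 1) * ((h + 1) * (n + 1)) +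
      (N.maxDeg + 1) * ((h + 1) * (n + 1)) := by ring
  rw [e]
  omega

theorem Fits.initCost_le (hW : Fits N X h W M) (v : Fin n) :
    initCost (h, N.deg v, Data.ofInt (X v), ()) ≤
      h + N.maxDeg * W + W + (msgBound W N.maxDeg + 1) * ((N.maxDeg + 1) * 2) := by
  have hg := roundGood N X h 0 v
  have h1 := hg.state.sendCost_le hW.name (hW.length_le (Nat.zero_le h) v) hW.small_tables (by
      rw [hg.ports]
      intro p hp
      obtain ⟨i, rfl⟩ := (List.mem_ofFn' _ _).1 hp
      exact hW.port_size v i)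
  rw [hg.ports, List.length_ofFn] at h1
  have h2 : (tables N X 0 v).2.length - (tables N X 0 v).1.length + 1 = 2 := rfl
  rw [h2, mul_assoc] at h1
  have h3 := N.deg_le_maxDeg v
  have h4 : N.deg v * (N.deg v).size + N.deg v ≤ N.maxDeg * W := by
    have e1 := Nat.size_le_size h3
    have e2 := hW.port
    calc _ = N.deg v * ((N.deg v).size + 1) := by ring
      _ ≤ _ := Nat.mul_le_mul h3 (by omega)
  have h5 : (Data.ofInt (X v)).size ≤ W := (hW.small 0 v).label
  have h6 : (msgBound W N.maxDeg + 1) * ((N.deg v + 1) * 2) ≤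
      (msgBound W N.maxDeg + 1) * ((N.maxDeg + 1) * 2) :=
    Nat.mul_le_mul_left _ (Nat.mul_le_mul_right _ (by omega))
  have h7 : sendCost (start (h, N.deg v, Data.ofInt (X v), ())) ≤
    (msgBound W N.maxDeg + 1) * ((N.deg v + 1) * 2) := h1
  rw [initCost]
  simp only
  omega

theorem finishCost_of_lt {k : ℕ} (hk : k < h) (v : Fin n) : finishCost (state N X h k v) = 0 := by
  rw [finishCost, (roundGood N X h k v).clock, if_neg]
  simp
  omega

theorem Fits.finishCost_le (hW : Fits N X h W M) (v : Fin n) : finishCost (state N X h h v) ≤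
    ((W + (W + n.size + N.maxDeg.size + 1) * N.maxDeg + 1) * n + n + 1) * (h + 1) := by
  have hs := roundGood N X h h v
  have h1 := (naming_state (N := N) (X := X) h v).listingCost_le fun p _ =>
    size_name_le hW.name (hW.length_le le_rfl v) _
  rw [finishCost, hs.clock, if_pos (by simp), hs.state.name]
  exact h1

/-- The listing is made in the last round only; before that the clock is still running. -/
theorem sum_finishCost (hh : 0 < h) (v : Fin n) :
    ∑ k ∈ Finset.range h, finishCost (state N X h (k + 1) v) = finishCost (state N X h h v) := by
  obtain ⟨m, rfl⟩ := Nat.exists_eq_succ_of_ne_zero hh.ne'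
  rw [Finset.sum_range_succ, Finset.sum_eq_zero, zero_add]
  intro k hk
  exact finishCost_of_lt (by simpa using hk) v

end FoldView

/-! ### The folded-view program and its numerical bounds -/

namespace FoldView

open Impl

variable {n : ℕ} {N : Network n} {X : Fin n → ℤ} {h W M : ℕ}

/-- The programs that construct the folded views, with preprocessing `f` of the input and
postprocessing `g` of the output. -/
theorem exists_program {ι : Type} [Enc ι] {f : ι → ℕ × ℕ × Data × Unit} {g : Data → Data}
    {Tf : ι → ℕ} {Tg : Data → ℕ} (hf : Impl f Tf) (hg : Impl g Tg) :
    ∃ (C : ℕ) (p : Program), ∀ (n : ℕ) (N : Network n) (X : Fin n → ℤ) (h : ℕ) (a : Fin n → ι),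
      0 < h → (∀ v, f (a v) = (h, N.deg v, Data.ofInt (X v), ())) →
      ∃ s T, N.Run p (fun v => Store.start (enc (a v))) (h + 1) s T
          (∑ k ∈ Finset.range (h + 1), ∑ v, ∑ i, (enc (message N X k v i) : Data).size) ∧
        (∀ v, (s v).Halted ∧ (s v).output = g (finish (state N X h h v)).2) ∧
        ∀ v, T v ≤ C * (Tf (a v) + initCost (h, N.deg v, Data.ofInt (X v), ()) + 1 +
          ∑ k ∈ Finset.range h, (roundCost (state N X h k v, N.inbox (message N X k) v) +
            (finishCost (state N X h (k + 1) v) + Tg (finish (state N X h (k + 1) v)).2) + 1)) := by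
  have ho : Impl (fun st : State => ((finish st).1, g (finish st).2))
      (fun st => finishCost st + Tg (finish st).2) :=
    ((pair fst (hg.comp snd)).comp impl_finish).mono fun _ => by simp
  obtain ⟨C, p, hp⟩ := exists_protocol_program (impl_init.comp hf) impl_round ho
  refine ⟨C, p, fun n N X h a hh ha => ?_⟩
  obtain ⟨s, T, h1, h2, h3⟩ := hp n N a (fun k v => state N X h k v) (message N X) h hh
    (fun v => by rw [ha]; exact init_eq h v) (fun k _ v => round_eq h k v)
    (fun k hk _ v => by rw [finish_of_lt hk]) (fun v => by rw [finish_eq])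
  refine ⟨s, T, h1, h2, fun v => ?_⟩
  have := h3 v
  rwa [ha] at this

theorem msgBound_succ_le {W D : ℕ} (hW : 1 ≤ W) (hD : 1 ≤ D) : msgBound W D + 1 ≤ 31 * (W * D) := by
  have h1 : W ≤ W * D := Nat.le_mul_of_pos_right _ hD
  have h2 : D ≤ W * D := Nat.le_mul_of_pos_left _ hW
  have h3 : (2 * W + 2) * D = 2 * (W * D) + 2 * D := by ring
  rw [msgBound, entryBound, h3]
  omega

/-- The constant is `744 + 124 + 12 + 5`: the rounds, the first message, the listing, and five
summands of lower order. -/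
theorem time_arith {B W D h n S Z : ℕ} (hB : B ≤ 31 * (W * D)) (hW : 1 ≤ W) (hD : 1 ≤ D)
    (hh : 1 ≤ h) (hn : 1 ≤ n) (hZ : Z + 1 ≤ W) :
    (h + D * W + W + B * ((D + 1) * 2)) + 1 + (B * ((D + 1) * (3 * ((h + 1) * (n + 1)))) +
      ((W + (W + S + Z + 1) * D + 1) * n + n + 1) * (h + 1) + h) ≤
      885 * ((W + S) * D ^ 2 * h * n) := by
  have hV : W ≤ W + S := Nat.le_add_right _ _
  set V := W + S
  have hV1 : 1 ≤ V := hW.trans hV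
  have hhn : 1 ≤ h * n := Nat.mul_pos hh hn
  have hDhn : 1 ≤ D * (h * n) := Nat.mul_pos hD hhn
  have q0 : V * D ≤ V * D ^ 2 * h * n := by
    calc V * D = V * D * 1 := by ring
      _ ≤ V * D * (D * (h * n)) := Nat.mul_le_mul_left _ hDhn
      _ = _ := by ring
  have q1 : D * W ≤ V * D := by rw [mul_comm]; exact Nat.mul_le_mul_right _ hV
  have q2 : V ≤ V * D := Nat.le_mul_of_pos_right _ hD
  have q3 : h ≤ V * D ^ 2 * h * n := by
    calc h = 1 * 1 ^ 2 * h * 1 := by ring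
      _ ≤ _ := by gcongr
  have q4 : B * ((D + 1) * 2) ≤ 124 * (V * D ^ 2 * h * n) := by
    calc B * ((D + 1) * 2) ≤ 31 * (V * D) * ((D + D) * 2) := by
          gcongr; exact hB.trans (by gcongr)
      _ = 124 * (V * D ^ 2 * 1) := by ring
      _ ≤ 124 * (V * D ^ 2 * (h * n)) := by gcongr
      _ = _ := by ring
  have q5 : B * ((D + 1) * (3 * ((h + 1) * (n + 1)))) ≤ 744 * (V * D ^ 2 * h * n) := by
    calc B * ((D + 1) * (3 * ((h + 1) * (n + 1)))) ≤
          31 * (V * D) * ((D + D) * (3 * ((h + h) * (n + n)))) := by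
          gcongr; exact hB.trans (by gcongr)
      _ = _ := by ring
  have q6 : (W + (V + Z + 1) * D + 1) * n + n + 1 ≤ 6 * (V * D * n) := by
    have e1 : (V + Z + 1) * D ≤ (2 * V) * D := Nat.mul_le_mul_right _ (by omega)
    have e2 : W + (V + Z + 1) * D + 1 ≤ 4 * (V * D) := by
      have : 2 * V * D = 2 * (V * D) := by ring
      omega
    have e3 := Nat.mul_le_mul_right n e2
    have e4 : n ≤ V * D * n := Nat.le_mul_of_pos_left _ (Nat.mul_pos hV1 hD)
    have e5 : 4 * (V * D) * n = 4 * (V * D * n) := by ring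
    omega
  have q7 : ((W + (V + Z + 1) * D + 1) * n + n + 1) * (h + 1) ≤ 12 * (V * D ^ 2 * h * n) := by
    calc _ ≤ 6 * (V * D * n) * (h + h) := Nat.mul_le_mul q6 (by omega)
      _ = 12 * (V * D * 1 * h * n) := by ring
      _ ≤ 12 * (V * D * D * h * n) := by gcongr
      _ = _ := by ring
  omega

/-- The bound for the sizes of labels, port numbers and names. -/
theorem exists_fits {b : ℕ} (hX : ∀ v, |X v| < 2 ^ b) (hh : 1 ≤ h) :
    ∃ W M, Fits N X h W M ∧ W ≤ (4 * b + 25) * ((Nat.log 2 N.maxDeg + 1) * h) := by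
  set L := Nat.log 2 N.maxDeg + 1 with hL
  have h0 : N.maxDeg < 2 ^ L := Nat.lt_pow_succ_log_self (by omega) _
  have h1 : N.maxDeg.size ≤ L := Nat.size_le.2 h0
  have h2 : N.maxDeg + 2 ≤ 2 ^ (L + 1) := by rw [pow_succ]; omega
  have h3 : ((N.maxDeg + 2) ^ h).size ≤ (L + 1) * h + 1 := by
    refine Nat.size_le.2 (lt_of_le_of_lt (Nat.pow_le_pow_left h2 h) ?_)
    rw [← pow_mul]
    exact Nat.pow_lt_pow_right (by omega) (by omega)
  have hLh : L ≤ L * h := Nat.le_mul_of_pos_right _ hh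
  have hhL : h ≤ L * h := Nat.le_mul_of_pos_left _ (by omega)
  have e : (L + 1) * h = L * h + h := by ring
  have hbLh : 4 * b ≤ 4 * b * (L * h) := Nat.le_mul_of_pos_right _ (by omega)
  -- `W` adds up the bounds for names, labels and port numbers, and `M` is the bound for the tables.
  refine ⟨4 * ((N.maxDeg + 2) ^ h).size + 3 + (4 * b + 5) + (4 * N.maxDeg.size + 1), _,
    ⟨by omega, le_rfl, by omega, small_viewTree hX (by omega) (by omega)⟩, ?_⟩
  rw [add_mul]
  omega

theorem Fits.bits_le (hW : Fits N X h W M) (hW1 : 1 ≤ W) (hD : 1 ≤ N.maxDeg) (hh : 1 ≤ h)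
    (hn : 1 ≤ n) :
    ∑ k ∈ Finset.range (h + 1), ∑ v, ∑ i, (enc (message N X k v i) : Data).size ≤
      248 * (W * N.maxDeg * h * n * N.numEdges) := by
  refine hW.sum_message_le.trans ?_
  have := (Nat.le_succ _).trans (msgBound_succ_le hW1 hD)
  calc _ ≤ 31 * (W * N.maxDeg) * ((h + h) * (n + n)) * (2 * N.numEdges) := by gcongr
    _ = _ := by ring

theorem Fits.time_le (hW : Fits N X h W M) (hW1 : N.maxDeg.size + 1 ≤ W) (hD : 1 ≤ N.maxDeg)
    (hh : 1 ≤ h) (hn : 1 ≤ n) (v : Fin n) :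
    0 + initCost (h, N.deg v, Data.ofInt (X v), ()) + 1 +
      ∑ k ∈ Finset.range h, (roundCost (state N X h k v, N.inbox (message N X k) v) +
        (finishCost (state N X h (k + 1) v) + 0) + 1) ≤
      885 * ((W + n.size) * N.maxDeg ^ 2 * h * n) := by
  have h1 := hW.initCost_le v
  have h2 := hW.sum_roundCost_le v
  have h3 := hW.finishCost_le v
  have h4 := sum_finishCost (N := N) (X := X) (h := h) (by omega) v
  refine le_trans ?_ (time_arith (msgBound_succ_le (by omega) hD) (by omega) hD hh hn hW1)
  rw [Finset.sum_add_distrib, Finset.sum_add_distrib]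
  simp only [add_zero, zero_add, h4, Finset.sum_const, Finset.card_range, smul_eq_mul, mul_one]
  exact Nat.add_le_add (Nat.add_le_add h1 le_rfl)
    (Nat.add_le_add (Nat.add_le_add h2 h3) le_rfl)

end FoldView

theorem natLog_succ_le_max {D : ℕ} : ((Nat.log 2 D + 1 : ℕ) : ℝ) ≤ 2 * max 1 (Real.logb 2 D) := by
  have h1 : (Nat.log 2 D : ℝ) ≤ Real.logb 2 D := by exact_mod_cast Real.natLog_le_logb D 2
  have h2 := le_max_left 1 (Real.logb 2 D)
  have h3 := le_max_right 1 (Real.logb 2 D)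
  push_cast
  linarith

/-- The construction of minimal folded views. -/
theorem exists_foldedView_program :
    ∃ p : Program, ∀ b : ℕ, ∃ C : ℝ, ∀ (n h : ℕ) (N : Network n) (X : Fin n → ℤ),
      2 ≤ n → 1 ≤ h → (∀ v, |X v| < 2 ^ b) →
      ∃ (r : ℕ) (s : Fin n → Store) (T : Fin n → ℕ) (B : ℕ),
        N.Run p (fun v => Store.start (Data.ofList
          [Data.ofNat h, Data.ofNat (N.deg v), Data.ofInt (X v)])) r s T B ∧
        (∀ v, (s v).Halted ∧
          ∃ (A : RootedGraph ℤ (ℕ × ℕ)) (c : LevelList),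
            (N.viewUpTo X h v).IsMinimalFoldedView A ∧ c.Represents A ∧
            (s v).output = c.encode) ∧
        (∀ v, (T v : ℝ) ≤
          C * ((N.maxDeg : ℝ) ^ 2 * (h : ℝ) ^ 2 * n * (Real.logb 2 n) ^ 2)) ∧
        (r : ℝ) ≤ C * h ∧
        (B : ℝ) ≤ C * (N.maxDeg * N.numEdges * (h : ℝ) ^ 2 * n *
          max 1 (Real.logb 2 N.maxDeg)) := by
  obtain ⟨C, p, hp⟩ := FoldView.exists_program (ι := ℕ × ℕ × Data × Unit) Impl.id
    (Impl.id (α := Data))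
  -- The three summands serve the time, the bits and the rounds.
  refine ⟨p, fun b => ⟨(C * (885 * (8 * b + 52)) + 496 * (4 * b + 25) + 2 : ℕ), ?_⟩⟩
  intro n h N X hn hh hX
  obtain ⟨s, T, h1, h2, h3⟩ := hp n N X h (fun v => (h, N.deg v, Data.ofInt (X v), ())) hh
    fun _ => rfl
  obtain ⟨W, M, hW, hWb⟩ := FoldView.exists_fits (N := N) (h := h) hX hh
  have v₀ : Fin n := ⟨0, by omega⟩
  have hD : 1 ≤ N.maxDeg := (N.deg_pos hn v₀).trans_le (N.deg_le_maxDeg v₀)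
  have hDn : N.maxDeg ≤ n := Finset.sup_le fun v _ => (N.deg_lt v).le
  have hport := hW.port
  set L := Nat.log 2 N.maxDeg + 1 with hL
  set ℓ := Nat.log 2 n with hℓ
  have hℓ1 : 1 ≤ ℓ := natLog_pos_of_two_le hn
  have hLℓ : L ≤ 2 * ℓ := by
    have : Nat.log 2 N.maxDeg ≤ ℓ := Nat.log_mono_right hDn
    omega
  have hlog : (ℓ : ℝ) ≤ Real.logb 2 n := by exact_mod_cast Real.natLog_le_logb n 2
  have hsize := size_le_two_mul_log hn
  have hDsize : 1 ≤ N.maxDeg.size := Nat.size_pos.2 hD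
  have hV : W + n.size ≤ (8 * b + 52) * (ℓ * h) := by
    have e1 : L * h ≤ 2 * ℓ * h := Nat.mul_le_mul_right _ hLℓ
    have e2 := Nat.mul_le_mul_left (4 * b + 25) e1
    have e3 : ℓ ≤ ℓ * h := Nat.le_mul_of_pos_right _ hh
    have e4 : (8 * b + 52) * (ℓ * h) = (4 * b + 25) * (2 * ℓ * h) + 2 * (ℓ * h) := by ring
    omega
  refine ⟨h + 1, s, T, _, h1, fun v => ⟨(h2 v).1, ?_⟩, fun v => ?_, ?_, ?_⟩
  · obtain ⟨c, pos, e1, e2⟩ := FoldView.exists_isLayout_finish (N := N) (X := X) hn h v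
    obtain ⟨A, e3, e4⟩ := e1.exists_represents
    exact ⟨A, c, e3, e4, by rw [(h2 v).2, e2]⟩
  · have e1 := (h3 v).trans (Nat.mul_le_mul_left C
      (hW.time_le (by omega) hD hh (by omega) v))
    have e2 : 885 * ((W + n.size) * N.maxDeg ^ 2 * h * n) ≤
        885 * (8 * b + 52) * (N.maxDeg ^ 2 * h ^ 2 * n * ℓ ^ 2) := by
      calc _ ≤ 885 * ((8 * b + 52) * (ℓ * h) * N.maxDeg ^ 2 * h * n) := by gcongr
        _ = 885 * (8 * b + 52) * (N.maxDeg ^ 2 * h ^ 2 * n * (ℓ * 1)) := by ring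
        -- The estimate has a single factor `ℓ` up to here; the second one is slack.
        _ ≤ 885 * (8 * b + 52) * (N.maxDeg ^ 2 * h ^ 2 * n * (ℓ * ℓ)) := by gcongr
        _ = _ := by ring
    have e3 : (T v : ℝ) ≤ (C * (885 * (8 * b + 52) * (N.maxDeg ^ 2 * h ^ 2 * n * ℓ ^ 2)) : ℕ) :=
      Nat.cast_le.2 (e1.trans (Nat.mul_le_mul_left _ e2))
    refine e3.trans ?_
    have e4 : ((C * (885 * (8 * b + 52) * (N.maxDeg ^ 2 * h ^ 2 * n * ℓ ^ 2)) : ℕ) : ℝ) =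
        (C * (885 * (8 * b + 52)) : ℕ) * ((N.maxDeg : ℝ) ^ 2 * (h : ℝ) ^ 2 * n * (ℓ : ℝ) ^ 2) := by
      push_cast; ring
    rw [e4]
    gcongr
    omega
  · have e1 : ((h + 1 : ℕ) : ℝ) ≤ (2 : ℕ) * (h : ℝ) := by exact_mod_cast (by omega : h + 1 ≤ 2 * h)
    refine e1.trans ?_
    gcongr
    omega
  · have e1 := hW.bits_le (by omega) hD hh (by omega)
    have e2 : 248 * (W * N.maxDeg * h * n * N.numEdges) ≤
        248 * (4 * b + 25) * (N.maxDeg * N.numEdges * h ^ 2 * n * L) := by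
      calc _ ≤ 248 * ((4 * b + 25) * (L * h) * N.maxDeg * h * n * N.numEdges) := by gcongr
        _ = _ := by ring
    refine (Nat.cast_le.2 (e1.trans e2)).trans ?_
    have e3 : ((248 * (4 * b + 25) * (N.maxDeg * N.numEdges * h ^ 2 * n * L) : ℕ) : ℝ) =
      (248 * (4 * b + 25) : ℕ) * (N.maxDeg * N.numEdges * (h : ℝ) ^ 2 * n * (L : ℝ)) := by
        push_cast; ring
    rw [e3]
    calc _ ≤ (248 * (4 * b + 25) : ℕ) * (N.maxDeg * N.numEdges * (h : ℝ) ^ 2 * n *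
          (2 * max 1 (Real.logb 2 N.maxDeg))) := by
          gcongr
          exact natLog_succ_le_max
      _ = ((2 * (248 * (4 * b + 25)) : ℕ) : ℝ) * (N.maxDeg * N.numEdges * (h : ℝ) ^ 2 * n *
          max 1 (Real.logb 2 N.maxDeg)) := by push_cast; ring
      _ ≤ _ := by
        gcongr
        omega

/-! ### Deterministic execution, and the computation of Boolean functions -/

theorem Exec.deterministic {p : Program} {s s₁ s₂ : Store} {t₁ t₂ : ℕ} (h₁ : Exec p s s₁ t₁)
    (h₂ : Exec p s s₂ t₂) : s₁ = s₂ := by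
  induction h₁ generalizing s₂ t₂ with
  | skip s => cases h₂; rfl
  | assign x e s => cases h₂; rfl
  | seq _ _ ih ih' =>
    cases h₂ with
    | seq h h' => rw [ih h] at ih'; exact ih' h'
  | condTrue he _ ih =>
    cases h₂ with
    | condTrue _ h => exact ih h
    | condFalse he' _ => exact absurd he' he
  | condFalse he _ ih =>
    cases h₂ with
    | condTrue he' _ => exact absurd he he'
    | condFalse _ h => exact ih h
  | loopStop he =>
    cases h₂ with
    | loopStop _ => rfl
    | loopStep he' _ _ => exact absurd he he'
  | loopStep he _ _ ih ih' =>
    cases h₂ with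
    | loopStop he' => exact absurd he' he
    | loopStep _ h h' => rw [ih h] at ih'; exact ih' h'

namespace Network

variable {n n' : ℕ} {N : Network n} {N' : Network n'}

theorem LocalStep.deterministic {p : Program} {s s₁ s₂ : Store} {t₁ t₂ : ℕ}
    (h₁ : LocalStep p s s₁ t₁) (h₂ : LocalStep p s s₂ t₂) : s₁ = s₂ := by
  rcases h₁ with ⟨h, h₁, -⟩ | ⟨h, h₁⟩ <;> rcases h₂ with ⟨h', h₂, -⟩ | ⟨h', h₂⟩
  · rw [h₁, h₂]
  · exact absurd h h'
  · exact absurd h' h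
  · exact h₁.deterministic h₂

/-- Parties with the same views of all depths. -/
def SameViews (N : Network n) (X : Fin n → ℤ) (N' : Network n') (X' : Fin n' → ℤ) (v : Fin n)
    (v' : Fin n') : Prop :=
  ∀ d, N.preTree X d v = N'.preTree X' d v'

variable {X : Fin n → ℤ} {X' : Fin n' → ℤ}

theorem SameViews.unfold {v : Fin n} {v' : Fin n'} (h : SameViews N X N' X' v v') :
    X v = X' v' ∧ N.deg v = N'.deg v' ∧ ∀ i (hi : i < N.deg v) (hi' : i < N'.deg v'),
      (N.backPort v ⟨i, hi⟩ : ℕ) = N'.backPort v' ⟨i, hi'⟩ ∧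
        SameViews N X N' X' (N.nbr v ⟨i, hi⟩) (N'.nbr v' ⟨i, hi'⟩) := by
  have key := fun d => unfoldTree_succ_eq.1 (h (d + 1))
  have key' := fun d => (map_out_eq N N' _ _ v v').1 (key d).2
  exact ⟨(key 0).1, (key' 0).1, fun i hi hi' =>
    ⟨((key' 0).2 i hi hi').1, fun d => ((key' d).2 i hi hi').2⟩⟩

/-- By induction on the rounds. Neighbours at corresponding ports again have the same views and send
from the same back port, since views record it; so the same messages arrive in the same order. -/
theorem Run.sameViews {p : Program} {s s₁ : Fin n → Store} {s' s₁' : Fin n' → Store} {r : ℕ}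
    {T : Fin n → ℕ} {T' : Fin n' → ℕ} {B B' : ℕ} (h : N.Run p s r s₁ T B)
    (h' : N'.Run p s' r s₁' T' B')
    (h0 : ∀ v v', SameViews N X N' X' v v' → s v = s' v') :
    ∀ v v', SameViews N X N' X' v v' → s₁ v = s₁' v' := by
  induction h generalizing s₁' T' B' with
  | zero => cases h'; exact h0
  | @succ r s₁ s₂ T t B _ hs ih =>
    cases h' with
    | @succ _ q₁ q₂ T' t' B' hr' hs' =>
      have e : ∀ v v', SameViews N X N' X' v v' → s₂ v = q₂ v' := fun v v' hv => by
        have h1 := hs v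
        rw [ih hr' v v' hv] at h1
        exact h1.deterministic (hs' v')
      intro v v' hv
      obtain ⟨-, hd, hn⟩ := hv.unfold
      rw [deliver, deliver, e v v' hv]
      congr 2
      refine List.ext_getElem (by simpa using hd) fun i hi hi' => ?_
      simp only [List.getElem_ofFn, List.length_ofFn] at hi hi' ⊢
      rw [(hn i hi hi').1, e _ _ (hn i hi hi').2]

/-- After a party has halted, its output does not change. -/
theorem Run.exists_prefix {p : Program} {s s₂ : Fin n → Store} {r k : ℕ} {T : Fin n → ℕ} {B : ℕ}
    (h : N.Run p s (r + k) s₂ T B) :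
    ∃ s₁ T₁ B₁, N.Run p s r s₁ T₁ B₁ ∧
      ∀ v, (s₁ v).Halted → (s₂ v).Halted ∧ (s₂ v).output = (s₁ v).output := by
  induction k generalizing s₂ T B with
  | zero => exact ⟨s₂, T, B, h, fun v hv => ⟨hv, rfl⟩⟩
  | succ k ih =>
    cases h with
    | @succ _ q₁ q₂ T t B hr hs =>
      obtain ⟨s₁, T₁, B₁, h1, h2⟩ := ih hr
      refine ⟨s₁, T₁, B₁, h1, fun v hv => ?_⟩
      obtain ⟨e1, e2⟩ := h2 v hv
      have e3 : q₂ v = (q₁ v).clearOutbox := by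
        rcases hs v with ⟨-, h, -⟩ | ⟨h, -⟩
        · exact h
        · exact absurd e1 h
      rw [Store.Halted, Store.output, N.deliver_of_ne _ _ (by decide) (by decide),
        N.deliver_of_ne _ _ (by decide) (by decide), e3]
      exact ⟨e1, e2⟩

/-- The runs may have different lengths. The longer one is compared at the moment when the shorter
one ends, and what a halted party outputs stays. -/
theorem Run.output_eq {p : Program} {s s₁ : Fin n → Store} {s' s₁' : Fin n' → Store} {r r' : ℕ}
    {T : Fin n → ℕ} {T' : Fin n' → ℕ} {B B' : ℕ} (h : N.Run p s r s₁ T B)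
    (h' : N'.Run p s' r' s₁' T' B')
    (h0 : ∀ v v', SameViews N X N' X' v v' → s v = s' v') {v : Fin n} {v' : Fin n'}
    (hv : SameViews N X N' X' v v') (ht : (s₁ v).Halted) (ht' : (s₁' v').Halted) :
    (s₁ v).output = (s₁' v').output := by
  rcases Nat.le_total r r' with hr | hr
  · obtain ⟨k, rfl⟩ := Nat.exists_eq_add_of_le hr
    obtain ⟨q, _, _, h1, h2⟩ := h'.exists_prefix
    have e := h.sameViews h1 h0 v v' hv
    rw [e] at ht
    rw [(h2 v' ht).2, e]
  · obtain ⟨k, rfl⟩ := Nat.exists_eq_add_of_le hr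
    obtain ⟨q, _, _, h1, h2⟩ := h.exists_prefix
    have e := h1.sameViews h' h0 v v' hv
    rw [← e] at ht'
    rw [(h2 v ht').2, e]

/-- A layout determines the view. -/
theorem IsLayout.preTree_eq {h : ℕ} {v : Fin n} {v' : Fin n'} {c : LevelList}
    {pos : (Σ w, N.graph.Walk v w) → ℕ} {pos' : (Σ w, N'.graph.Walk v' w) → ℕ}
    (hc : N.IsLayout X h v c pos) (hc' : N'.IsLayout X' h v' c pos') :
    N.preTree X h v = N'.preTree X' h v' := by
  have key : ∀ k (p : Σ w, N.graph.Walk v w) (p' : Σ w, N'.graph.Walk v' w), p.2.length + k = h →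
      p.2.length = p'.2.length → pos p = pos' p' →
      N.preTree X k p.1 = N'.preTree X' k p'.1 := by
    intro k
    induction k with
    | zero => intros; rfl
    | succ k ih =>
      intro p p' hk hl hp
      have h1 := hc.node p (by omega)
      have h2 := hc'.node p' (by omega)
      rw [hp, hl, h2, if_pos (by omega), if_pos (by omega)] at h1
      obtain ⟨h3, h4⟩ := Prod.mk.inj (Option.some.inj h1)
      rw [List.ext_get_iff] at h4
      simp only [List.length_ofFn, List.get_eq_getElem, List.getElem_ofFn, Prod.mk.injEq,
        true_and] at h4
      refine unfoldTree_succ_eq.2 ⟨h3.symm, (map_out_eq N N' _ _ _ _).2 ⟨h4.1.symm, fun i hi hi' => ?_⟩⟩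
      obtain ⟨h5, h6⟩ := h4.2 i hi' hi
      refine ⟨h5.symm, ih (N.ext p ⟨i, hi⟩) (N'.ext p' ⟨i, hi'⟩) ?_ ?_ h6.symm⟩
      · rw [length_ext]; omega
      · rw [length_ext, length_ext, hl]
  exact key h ⟨v, .nil⟩ ⟨v', .nil⟩ (by simp) rfl (by rw [hc.root, hc'.root])

/-- Stabilisation on the disjoint union of the two networks, which has `n + n'` nodes. -/
theorem sameViews_of_preTree_eq {h : ℕ} {v : Fin n} {v' : Fin n'} (hh : n + n' ≤ h + 1)
    (he : N.preTree X h v = N'.preTree X' h v') : SameViews N X N' X' v v' := fun d =>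
  unfoldTree_stable₂ Data.nil (by simpa using hh) he d

/-- All degrees are below `n`, so graph, degrees and port bijections range over finite sets. Hence
one fixed program can carry a table for all networks in question. -/
instance : Finite (Network n) := by
  let f : {q : Σ g : SimpleGraph (Fin n), Σ d : Fin n → Fin n,
      ∀ v, g.neighborSet v ≃ Fin (d v) // q.1.Connected} → Network n :=
    fun q => ⟨q.1.1, q.2, fun v => q.1.2.1 v, q.1.2.2⟩
  exact Finite.of_surjective f fun N =>
    ⟨⟨⟨N.graph, fun v => ⟨N.deg v, N.deg_lt v⟩, N.port⟩, N.connected⟩, rfl⟩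

end Network

/-! ### Boolean functions by table lookup on folded views -/

namespace Data

theorem exists_table {ι : Type} [Finite ι] (key val : ι → Data)
    (h : ∀ i j, key i = key j → val i = val j) : ∃ m : Data, ∀ i, m.get (key i) = val i := by
  classical
  have := Fintype.ofFinite ι
  have key : ∀ s : Finset ι, ∃ m : Data, ∀ i ∈ s, m.get (key i) = val i := by
    intro s
    induction s using Finset.induction_on with
    | empty => exact ⟨nil, by simp⟩
    | insert a s _ ih =>
      obtain ⟨m, hm⟩ := ih
      refine ⟨m.set (key a) (val a), fun i hi => ?_⟩
      rw [get_set]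
      split_ifs with hk
      · exact (h _ _ hk).symm
      · rcases Finset.mem_insert.1 hi with rfl | hi
        · exact absurd rfl hk
        · exact hm i hi
  obtain ⟨m, hm⟩ := key Finset.univ
  exact ⟨m, fun i => hm i (Finset.mem_univ i)⟩

end Data

/-- The label of a party with a given input bit. -/
def bitLabel (b : Bool) : ℤ := if b then 1 else 0

theorem bitLabel_injective : Function.Injective bitLabel := by
  intro a b h
  cases a <;> cases b <;> simp_all [bitLabel]

/-- One bit is put in front of the binary digits. The depth `2 n + 1` exceeds the required `2 n - 1`
and is obtained by a single `cons`. -/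
theorem Impl.two_mul_add_one : Impl (fun k : ℕ => 2 * k + 1) (fun _ => 0) := by
  refine of_expr (fun k => .cons (.cons .nil .nil) (.var k)) 5 (fun _ => le_rfl) fun k s a hs => ?_
  change _ = Data.ofBits (2 * a + 1).bits
  rw [Nat.bit1_bits]
  simp only [Expr.eval, hs]
  rfl

theorem exists_impl_viewInput : ∃ T, Impl (fun a : ℕ × ℕ × Bool × Unit =>
    (2 * a.1 + 1, a.2.1, Data.ofInt (bitLabel a.2.2.1), ())) T := by
  have h1 : Impl (fun b : Bool => Data.ofInt (bitLabel b)) _ :=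
    (Impl.ite Impl.id (Impl.const (Data.ofInt 1)) (Impl.const (Data.ofInt 0))).congr fun b => by
      cases b <;> rfl
  exact ⟨_, Impl.pair (Impl.two_mul_add_one.comp Impl.fst)
    (Impl.pair (Impl.fst.comp Impl.snd) (Impl.pair
      (h1.comp (Impl.fst.comp (Impl.snd.comp Impl.snd))) (Impl.const ())))⟩

/-- The program of a single party. -/
def lonelyProgram (a b : Bool) : Program :=
  .seq (.cond (.hd (.tl (.tl (.var 0))))
    (.assign 3 (Impl.constExpr (Data.ofBool a))) (.assign 3 (Impl.constExpr (Data.ofBool b))))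
    (.assign 4 (.cons .nil .nil))

/-- A lone party has no ports. This case is separate because layouts need two parties; at `n = 1`
the bound `n ^ 6 log n` vanishes, and indeed no bit is sent. -/
theorem Network.outputs_lonelyProgram (N : Network 1) (f : (Fin 1 → Bool) → Bool)
    (x : Fin 1 → Bool) :
    N.Outputs (lonelyProgram (f fun _ => true) (f fun _ => false)) x (f x) 1 0 := by
  have hx : x = fun _ => x 0 := funext fun i => by rw [Subsingleton.elim i 0]
  have key : ∀ s : Store, (s 0).tl.tl.hd = Data.ofBool (x 0) → s 4 = Data.nil → ∃ s' t,
      LocalStep (lonelyProgram (f fun _ => true) (f fun _ => false)) s s' t ∧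
        s' 4 ≠ Data.nil ∧ s' 3 = Data.ofBool (f x) := by
    intro s h0 h4
    rw [hx]
    cases hb : x 0 <;> rw [hb] at h0
    · exact ⟨_, _, Or.inr ⟨not_not.2 h4, .seq (.condFalse h0 (.assign _ _ _)) (.assign _ _ _)⟩,
        by simp [Expr.eval], by simp [Impl.eval_constExpr]⟩
    · exact ⟨_, _, Or.inr ⟨not_not.2 h4, .seq (.condTrue (by simp [Expr.eval, h0, Data.ofBool])
        (.assign _ _ _)) (.assign _ _ _)⟩, by simp [Expr.eval], by simp [Impl.eval_constExpr]⟩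
  choose s t h1 h2 h3 using fun v : Fin 1 => key (Store.start (Data.ofList
    [Data.ofNat 1, Data.ofNat (N.deg v), Data.ofBool (x v)])) (by
      rw [Subsingleton.elim v 0]; rfl) rfl
  have hB : N.bitsSent s = 0 := by
    refine Finset.sum_eq_zero fun v _ => Finset.sum_eq_zero fun i _ => ?_
    have := N.deg_lt v
    exact absurd i.2 (by omega)
  have hr := Run.succ (N := N) .zero h1
  rw [hB] at hr
  refine ⟨_, _, hr, fun v => ⟨?_, ?_⟩⟩
  · rw [Store.Halted, N.deliver_of_ne _ _ (by decide) (by decide)]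
    exact h2 v
  · rw [Store.output, N.deliver_of_ne _ _ (by decide) (by decide)]
    exact h3 v

/-- Parties with the same folded views have the same output. -/
theorem Network.Outputs.eq_of_finish_eq {n : ℕ} {N N' : Network n} {p : Program} {x x' : Fin n → Bool}
    {y y' : Bool} {r r' B B' : ℕ} (h : N.Outputs p x y r B) (h' : N'.Outputs p x' y' r' B')
    (hn : 2 ≤ n) {v v' : Fin n}
    (he : (FoldView.finish (FoldView.state N (fun u => bitLabel (x u)) (2 * n + 1) (2 * n + 1) v)).2 =
      (FoldView.finish (FoldView.state N' (fun u => bitLabel (x' u)) (2 * n + 1) (2 * n + 1) v')).2) :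
    y = y' := by
  obtain ⟨c, pos, h1, h2⟩ := FoldView.exists_isLayout_finish (N := N)
    (X := fun u => bitLabel (x u)) hn (2 * n + 1) v
  obtain ⟨c', pos', h1', h2'⟩ := FoldView.exists_isLayout_finish (N := N')
    (X := fun u => bitLabel (x' u)) hn (2 * n + 1) v'
  rw [h2, h2'] at he
  obtain rfl := LevelList.encode_injective he
  have hv := Network.sameViews_of_preTree_eq (by omega) (h1.preTree_eq h1')
  obtain ⟨s, T, hs, ho⟩ := h
  obtain ⟨s', T', hs', ho'⟩ := h'
  have := hs.output_eq hs' (fun u u' hu => by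
    obtain ⟨e1, e2, -⟩ := hu.unfold
    rw [e2, bitLabel_injective e1]) hv (ho v).1 (ho' v').1
  rw [(ho v).2, (ho' v').2] at this
  simpa [Data.toBool_ofBool] using congrArg Data.toBool this

namespace FoldView

/-- The communication for the folded views that decide Boolean functions. -/
theorem sum_message_bitLabel_le {n : ℕ} (hn : 2 ≤ n) (N : Network n) (x : Fin n → Bool) :
    ∑ k ∈ Finset.range (2 * n + 1 + 1), ∑ v, ∑ i,
      (enc (message N (fun u => bitLabel (x u)) k v i) : Data).size ≤
        129456 * (n ^ 6 * Nat.log 2 n) := by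
  have v₀ : Fin n := ⟨0, by omega⟩
  obtain ⟨W, M, hW, hWb⟩ := exists_fits (N := N) (X := fun u => bitLabel (x u)) (b := 1)
    (h := 2 * n + 1) (fun v => by cases x v <;> simp [bitLabel]) (by omega)
  have hD : 1 ≤ N.maxDeg := (N.deg_pos hn v₀).trans_le (N.deg_le_maxDeg v₀)
  have hDn : N.maxDeg ≤ n := Finset.sup_le fun v _ => (N.deg_lt v).le
  have hE : N.numEdges ≤ n * n := by
    have h1 : ∑ v, N.deg v ≤ n * n :=
      (Finset.sum_le_card_nsmul _ _ n fun v _ => (N.deg_lt v).le).trans (by simp)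
    have h2 := N.sum_deg
    omega
  have hL : Nat.log 2 N.maxDeg + 1 ≤ 2 * Nat.log 2 n := by
    have h1 : Nat.log 2 N.maxDeg ≤ Nat.log 2 n := Nat.log_mono_right hDn
    have h2 := natLog_pos_of_two_le hn
    omega
  have hh : 2 * n + 1 ≤ 3 * n := by omega
  have hport := hW.port
  refine (hW.bits_le (by omega) hD (by omega) (by omega)).trans ?_
  calc _ ≤ 248 * ((4 * 1 + 25) * (2 * Nat.log 2 n * (3 * n)) * n * (3 * n) * n * (n * n)) := by
        gcongr
        exact hWb.trans (by gcongr)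
    _ = _ := by ring

end FoldView

/-- Every computable Boolean function is computed in linear time. -/
theorem exists_function_program :
    ∃ C : ℝ, ∀ (n : ℕ) (f : (Fin n → Bool) → Bool) (K : Set (Network n)),
      (∃ p : Program, ∀ N ∈ K, ∀ x, ∃ r B : ℕ, N.Outputs p x (f x) r B) →
      ∃ p : Program, ∀ N ∈ K, ∀ x, ∃ r B : ℕ, N.Outputs p x (f x) r B ∧
        (r : ℝ) ≤ C * n ∧ (B : ℝ) ≤ C * ((n : ℝ) ^ 6 * Real.logb 2 n) := by
  -- The constant is `248 * 29 * 2 * 3 * 3`: the factor in `Fits.bits_le`, the factor `4 * b + 25`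
  -- at `b = 1`, the estimate `log D + 1 ≤ 2 log n`, and twice `2 n + 1 ≤ 3 n`.
  refine ⟨129456, fun n f K ⟨q, hq⟩ => ?_⟩
  obtain rfl | rfl | hn : n = 0 ∨ n = 1 ∨ 2 ≤ n := by omega
  -- A connected graph is nonempty, so there is no network without parties.
  · exact ⟨.skip, fun N => by
      obtain ⟨v⟩ := N.connected.nonempty
      exact v.elim0⟩
  · exact ⟨_, fun N _ x => ⟨1, 0, N.outputs_lonelyProgram f x, by norm_num, by norm_num⟩⟩
  let ι := K × (Fin n → Bool) × Fin n
  let key : ι → Data := fun a => (FoldView.finish (FoldView.state a.1.1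
    (fun u => bitLabel (a.2.1 u)) (2 * n + 1) (2 * n + 1) a.2.2)).2
  -- The table `m` becomes a constant of the program. It is well defined because the given program
  -- `q` already has to answer alike wherever the folded views agree.
  obtain ⟨m, hm⟩ := Data.exists_table key (fun a => Data.ofBool (f a.2.1)) fun a a' haa => by
    obtain ⟨r, B, h⟩ := hq a.1.1 a.1.2 a.2.1
    obtain ⟨r', B', h'⟩ := hq a'.1.1 a'.1.2 a'.2.1
    exact congrArg Data.ofBool (h.eq_of_finish_eq h' hn haa)
  obtain ⟨T, hT⟩ := exists_impl_viewInput
  obtain ⟨C, p, hp⟩ := FoldView.exists_program hT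
    (Impl.get.comp (Impl.pair (Impl.const m) (Impl.id (α := Data))))
  refine ⟨p, fun N hN x => ?_⟩
  obtain ⟨s, T', h1, h2, -⟩ := hp n N (fun u => bitLabel (x u)) (2 * n + 1)
    (fun v => (n, N.deg v, x v, ())) (by omega) fun _ => rfl
  refine ⟨_, _, ⟨s, T', h1, fun v => ⟨(h2 v).1, ?_⟩⟩, ?_, ?_⟩
  · rw [(h2 v).2]
    exact hm (⟨N, hN⟩, x, v)
  · have : (2 * n + 1 + 1 : ℕ) ≤ 129456 * n := by omega
    exact_mod_cast this
  · refine (Nat.cast_le.2 (FoldView.sum_message_bitLabel_le hn N x)).trans ?_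
    have : (Nat.log 2 n : ℝ) ≤ Real.logb 2 n := by exact_mod_cast Real.natLog_le_logb n 2
    push_cast
    gcongr

theorem mainTheorem5 :
    -- construction of the minimal folded view of depth `h`
    (∃ p : Program, ∀ b : ℕ, ∃ C : ℝ, ∀ (n h : ℕ) (N : Network n) (X : Fin n → ℤ),
      2 ≤ n → 1 ≤ h → (∀ v, |X v| < 2 ^ b) →
      ∃ (r : ℕ) (s : Fin n → Store) (T : Fin n → ℕ) (B : ℕ),
        N.Run p (fun v => Store.start (Data.ofList
          [Data.ofNat h, Data.ofNat (N.deg v), Data.ofInt (X v)])) r s T B ∧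
        (∀ v, (s v).Halted ∧
          ∃ (A : RootedGraph ℤ (ℕ × ℕ)) (c : LevelList),
            (N.viewUpTo X h v).IsMinimalFoldedView A ∧ c.Represents A ∧
            (s v).output = c.encode) ∧
        (∀ v, (T v : ℝ) ≤
          C * ((N.maxDeg : ℝ) ^ 2 * (h : ℝ) ^ 2 * n * (Real.logb 2 n) ^ 2)) ∧
        (r : ℝ) ≤ C * h ∧
        (B : ℝ) ≤ C * (N.maxDeg * N.numEdges * (h : ℝ) ^ 2 * n *
          max 1 (Real.logb 2 N.maxDeg))) ∧
    -- counting views from the minimal folded view of depth `2 (n - 1)`, without communication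
    (∃ p : Program, ∀ b : ℕ, ∃ C : ℝ, ∀ (n : ℕ) (N : Network n) (X : Fin n → ℤ) (v : Fin n)
        (S : Finset ℤ) (A : RootedGraph ℤ (ℕ × ℕ)) (c : LevelList),
      2 ≤ n → (∀ u, |X u| < 2 ^ b) → (∀ z ∈ S, |z| < 2 ^ b) →
      (N.viewUpTo X (2 * (n - 1)) v).IsMinimalFoldedView A → c.Represents A →
      ∃ (s : Store) (t : ℕ),
        Exec p (Store.start (Data.ofList
          [Data.ofNat n, Data.ofList (S.toList.map Data.ofInt), c.encode])) s t ∧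
        s.output = Data.ofList
          [Data.ofNat (N.views X).ncard, Data.ofNat (N.viewsIn X S).ncard] ∧
        (t : ℝ) ≤ C * (N.maxDeg * (n : ℝ) ^ 5 * Real.logb 2 n)) ∧
    -- Boolean functions
    (∃ C : ℝ, ∀ (n : ℕ) (f : (Fin n → Bool) → Bool) (K : Set (Network n)),
      (∃ p : Program, ∀ N ∈ K, ∀ x, ∃ r B : ℕ, N.Outputs p x (f x) r B) →
      ∃ p : Program, ∀ N ∈ K, ∀ x, ∃ r B : ℕ, N.Outputs p x (f x) r B ∧
        (r : ℝ) ≤ C * n ∧ (B : ℝ) ≤ C * ((n : ℝ) ^ 6 * Real.logb 2 n)) := by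
  exact ⟨exists_foldedView_program, exists_countViews_program, exists_function_program⟩
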